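/- **Setting.** Let $m,J,k,\kappa,\lambda,\tau_\ast,h,r$ be positive constants, put $\omega_\ast:=\tau_\ast/\kappa$, let $\psi\colon\mathbb{R}^2\to\mathbb{R}$ be smooth, let $\mathbb{S}\subset\mathbb{R}^2$ be the unit circle and $R$ the rotation of $\mathbb{R}^2$ by $\pi/2$ counter-clockwise. For $\varepsilon>0$ and $d_{\mathrm r},d_{\mathrm s},d_{\mathrm t}\in L_\infty(\mathbb{R})$ (with essential supremum norm $\|\cdot\|$) consider on $\mathbb{R}^2\times\mathbb{S}\times\mathbb{R}^3$ the system $$\begin{aligned} \dot p&=v\,o,\qquad \dot o=\omega\,Ro,\\ m\,\dot v&=-\lambda\big(\psi(p+r\,o)-\eta\big)-\tfrac1\varepsilon\,k\,v-\lambda\,d_{\mathrm s}+d_{\mathrm t},\\ J\,\dot\omega&=-\kappa(\omega-\omega_\ast)+d_{\mathrm r},\\ \dot\eta&=-\varepsilon h\,\eta+\varepsilon h\,\psi(p+r\,o)+\varepsilon h\,d_{\mathrm s}, \end{aligned}\tag{$*$}$$ with solutions in the sense of Carathéodory. Let $P\subset\mathbb{R}^2$ be open and nonempty and let $\Psi_r\colon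 P\to\mathbb{R}$ be the disk average $\Psi_r(p)=\frac1\pi\int_{|q|\le1}\psi(p+rq)\,dq$. A function $\gamma\colon[0,\infty)\to[0,\infty)$ is of class $\mathcal K$ if it is continuous, strictly increasing and $\gamma(0)=0$; a continuous function $\beta\colon[0,\infty)^2\to[0,\infty)$ is of class $\mathcal{KL}$ if $\beta(\cdot,t)$ is of class $\mathcal K$ for every $t\ge 0$ and $\beta(s,\cdot)$ is nonincreasing with limit $0$ at $\infty$ for every $s\ge 0$. **Theorem 1.** Let $y_\ast<y_0$ be real numbers such that $C_0:=\{p\in P:\Psi_r(p)\le y_0\}$ is compact and $\nabla\Psi_r(p)\ne0$ for every $p\in P$ with $y_\ast<\Psi_r(p)\le y_0$. Let $\Lambda$ be the smallest interval containing all values $\psi(p+r\,o)$ with $p\in C_0$ and $o\in\mathbb{S}$ (if $C_0$ is connected, $\Lambda$ is the set of these values), and let $|\eta|_\Lambda$ denote the distance of $\eta\in\mathbb{R}$ to $\Lambda$. Let $\rho_v,\rho_\omega,\rho_\eta>0$. Then there exist $\beta$ of class $\mathcal{KL}$ with $\beta(s,0)=s$ for all $s\ge0$, functions $\gamma_{\mathrm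 r},\gamma_{\mathrm s},\gamma_{\mathrm t},\nu_p,\nu_\eta$ of class $\mathcal K$, and constants $\varepsilon_0,\delta_{\mathrm r},\delta_{\mathrm s},\delta_{\mathrm t},\nu_v>0$ such that for every $\varepsilon\in(0,\varepsilon_0)$, every $t_0\in\mathbb{R}$, every $p_0\in C_0$, every $o_0\in\mathbb{S}$, all $v_0,\omega_0,\eta_0\in\mathbb{R}$ with $|v_0|\le\rho_v$, $|\omega_0-\omega_\ast|\le\rho_\omega$, $|\eta_0|_\Lambda\le\rho_\eta$, and all $d_{\mathrm r},d_{\mathrm s},d_{\mathrm t}\in L_\infty(\mathbb{R})$ with $\|d_{\mathrm r}\|\le\delta_{\mathrm r}$, $\|d_{\mathrm s}\|\le\delta_{\mathrm s}$, $\|d_{\mathrm t}\|\le\delta_{\mathrm t}$, the initial value problem for $(*)$ with value $(p_0,o_0,v_0,\omega_0,\eta_0)$ at time $t_0$ has a (unique) maximal solution $(p,o,v,\omega,\eta)$, it is defined on all of $[t_0,\infty)$, and for every $t\ge t_0$ one has $p(t)\in P$ and $$\begin{aligned} \Psi_r(p(t))-y_\ast&\le\max\big\{\beta\big(\max\{\Psi_r(p_0)-y_\ast,0\},\varepsilon(t-t_0)\big),\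 \gamma_{\mathrm r}(\|d_{\mathrm r}\|)+\gamma_{\mathrm s}(\|d_{\mathrm s}\|)+\gamma_{\mathrm t}(\|d_{\mathrm t}\|)\big\}+\nu_p(\varepsilon),\\ |v(t)|&\le|v_0|\,e^{-\frac1\varepsilon\frac km(t-t_0)}+\nu_v\,\varepsilon,\\ |\omega(t)-\omega_\ast|&\le|\omega_0-\omega_\ast|\,e^{-\frac\kappa J(t-t_0)}+\tfrac1\kappa\|d_{\mathrm r}\|,\\ |\eta(t)|_\Lambda&\le|\eta_0|_\Lambda\,e^{-\varepsilon h(t-t_0)}+\|d_{\mathrm s}\|+\nu_\eta(\varepsilon). \end{aligned}$$ -/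

import Mathlib

open MeasureTheory

namespace SourceSeeking

noncomputable section

/-- The Euclidean plane. -/
abbrev Plane : Type := EuclideanSpace ℝ (Fin 2)

/-- Counter-clockwise rotation by the angle `π / 2`. -/
def rot (u : Plane) : Plane := !₂[-(u 1), u 0]

/-- Class `𝒦`: continuous, strictly increasing on `[0, ∞)`, zero at zero.
Only the values on `[0, ∞)` matter. -/
structure IsClassK (γ : ℝ → ℝ) : Prop where
  continuousOn : ContinuousOn γ (Set.Ici 0)
  strictMonoOn : StrictMonoOn γ (Set.Ici 0)
  map_zero : γ 0 = 0

/-- Class `𝒦ℒ`: continuous on `[0, ∞) × [0, ∞)`, of class `𝒦` in the first argument, and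
decreasing to zero in the second argument. -/
structure IsClassKL (β : ℝ → ℝ → ℝ) : Prop where
  continuousOn : ContinuousOn (fun q : ℝ × ℝ => β q.1 q.2) (Set.Ici 0 ×ˢ Set.Ici 0)
  classK : ∀ t, 0 ≤ t → IsClassK (fun s => β s t)
  antitoneOn : ∀ s, 0 ≤ s → AntitoneOn (β s) (Set.Ici 0)
  tendsto_zero : ∀ s, 0 ≤ s → Filter.Tendsto (β s) Filter.atTop (nhds 0)

/-- The positive constants of the vehicle and of the controller: body mass `m`, moment of
inertia `J`, damping constants `k` (translational) and `κ` (rotational), force gain `lam`,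
constant torque `τ`, filter constant `h`, and distance `r` of the sensor to the center. -/
structure Params where
  m : ℝ
  J : ℝ
  k : ℝ
  κ : ℝ
  lam : ℝ
  τ : ℝ
  h : ℝ
  r : ℝ
  m_pos : 0 < m
  J_pos : 0 < J
  k_pos : 0 < k
  κ_pos : 0 < κ
  lam_pos : 0 < lam
  τ_pos : 0 < τ
  h_pos : 0 < h
  r_pos : 0 < r

/-- The rotational velocity `ω_* = τ_* / κ`. -/
def Params.ωstar (c : Params) : ℝ := c.τ / c.κ

/-- The average of `ψ` over the disk of radius `r` centered at `p`. -/
def diskAverage (ψ : Plane → ℝ) (r : ℝ) (p : Plane) : ℝ :=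
  (1 / Real.pi) * ∫ q in Metric.closedBall (0 : Plane) 1, ψ (p + r • q)

/-- The `y`-sublevel set of the averaged signal function on the domain `P`. -/
def sublevel (ψ : Plane → ℝ) (r : ℝ) (P : Set Plane) (y : ℝ) : Set Plane :=
  {p | p ∈ P ∧ diskAverage ψ r p ≤ y}

/-- The set of signal values at the points `p + r o`, where `p` is in the `y`-sublevel set of the
averaged signal function and `o` is in the unit circle. -/
def signalValues (ψ : Plane → ℝ) (r : ℝ) (P : Set Plane) (y : ℝ) : Set ℝ :=
  {a | ∃ p ∈ sublevel ψ r P y, ∃ o ∈ Metric.sphere (0 : Plane) 1, a = ψ (p + r • o)}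

/-- The smallest interval that contains all these signal values; it is the set of these values
itself as soon as that set is connected, e.g. if the sublevel set is connected. -/
def signalInterval (ψ : Plane → ℝ) (r : ℝ) (P : Set Plane) (y : ℝ) : Set ℝ :=
  convexHull ℝ (signalValues ψ r P y)

/-- States of the closed-loop system: position `p`, orientation `o` (required below to be in the
unit circle), translational velocity `v`, rotational velocity `ω`, filter state `η`. -/
structure State where
  p : Plane
  o : Plane
  v : ℝ
  ω : ℝ
  η : ℝ

/-- `x` is a Carathéodory solution, on the interval `I`, of the closed-loop system

* `p' = v o`,
* `o' = ω R o`,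
* `m v' = -lam (ψ (p + r o) - η) - (k / ε) v - lam d_s + d_t`,
* `J ω' = -κ (ω - ω_*) + d_r`,
* `η' = -ε h η + ε h ψ (p + r o) + ε h d_s`

with initial value `x₀` at the initial time `t₀`, written as integral equations. -/
structure IsSolution (c : Params) (ψ : Plane → ℝ) (ε : ℝ) (dr ds dt : ℝ → ℝ)
    (t₀ : ℝ) (x₀ : State) (I : Set ℝ) (x : ℝ → State) : Prop where
  ordConnected : I.OrdConnected
  mem : t₀ ∈ I
  norm_o : ∀ t ∈ I, (x t).o ∈ Metric.sphere (0 : Plane) 1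
  cont_p : ContinuousOn (fun t => (x t).p) I
  cont_o : ContinuousOn (fun t => (x t).o) I
  cont_v : ContinuousOn (fun t => (x t).v) I
  cont_ω : ContinuousOn (fun t => (x t).ω) I
  cont_η : ContinuousOn (fun t => (x t).η) I
  eq_p : ∀ t ∈ I, (x t).p = x₀.p + ∫ s in t₀..t, (x s).v • (x s).o
  eq_o : ∀ t ∈ I, (x t).o = x₀.o + ∫ s in t₀..t, (x s).ω • rot (x s).o
  eq_v : ∀ t ∈ I, (x t).v = x₀.v + ∫ s in t₀..t,
    (1 / c.m) * (-c.lam * (ψ ((x s).p + c.r • (x s).o) - (x s).η)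
      - (1 / ε) * c.k * (x s).v - c.lam * ds s + dt s)
  eq_ω : ∀ t ∈ I, (x t).ω = x₀.ω + ∫ s in t₀..t,
    (1 / c.J) * (-c.κ * ((x s).ω - c.ωstar) + dr s)
  eq_η : ∀ t ∈ I, (x t).η = x₀.η + ∫ s in t₀..t,
    (-ε * c.h * (x s).η + ε * c.h * ψ ((x s).p + c.r • (x s).o) + ε * c.h * ds s)

/-- `x`, on the interval `I`, is the maximal solution with initial value `x₀` at the initial time
`t₀`: it is a solution, and it extends every other solution of the same initial value problem. -/
def IsMaximalSolution (c : Params) (ψ : Plane → ℝ) (ε : ℝ) (dr ds dt : ℝ → ℝ)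
    (t₀ : ℝ) (x₀ : State) (I : Set ℝ) (x : ℝ → State) : Prop :=
  IsSolution c ψ ε dr ds dt t₀ x₀ I x ∧
    ∀ (I' : Set ℝ) (x' : ℝ → State), IsSolution c ψ ε dr ds dt t₀ x₀ I' x' →
      I' ⊆ I ∧ Set.EqOn x' x I'

end

end SourceSeeking

open SourceSeeking

/-!
In the slow time `ε t`, the position follows a perturbed gradient descent of the averaged signal
`Ψ = diskAverage ψ r`. The translational velocity is fast and relaxes to
`v ≈ -(ε lam / k) (ψ (p + r o) - η)`, so that `Ψ(p)' = v ⟨∇Ψ(p), o⟩` is of order `ε`, and the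
orientation turns with rotational velocity close to `ω_*`. By the divergence theorem,
`∇Ψ(p) = 1 / (π r) ∮ ψ (p + r o) o` (`fderiv_diskAverage`). Hence the average of
`ψ (p + r o) ⟨∇Ψ(p), o⟩` over one turn is `(r / 2) ‖∇Ψ(p)‖²` (`turnMean_mul_slope`), while
`η ⟨∇Ψ(p), o⟩` has average zero.

Averaging is made rigorous by correctors. The function `energy` is `Ψ(p)` plus `ε m / k` times
`v ⟨∇Ψ(p), o⟩`, which replaces the fast velocity by its quasi-stationary value, plus
`ε lam / (k ω_*)` times a primitive along rotations, which removes the oscillations. Its rate along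
a solution is exactly `-ε lam r / (2 k) ‖∇Ψ(p)‖²` plus `ε` times an error
(`IsSolution.isPrimitiveOn_energy`), and the error is bounded by a multiple of the norms of the
disturbances, of `ε`, and of a decaying exponential due to the initial velocities
(`abs_energyError_le`). On a compact set, `lam r / (2 k) ‖∇Ψ‖²` dominates an increasing
homeomorphism `α` of `Ψ - y_*` (`exists_orderIso_comp_le`). The flow of `y' = -α(y) / 2` is the
class `𝒦ℒ` function `β` (`exists_classKL_flow`), and comparison with this flow gives the bound on
`Ψ(p(t)) - y_*` (`le_max_flow_of_sub_le_integral`, `IsSolution.diskAverage_le`). The other half of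
the rate `α` serves to dominate the error; therefore the gains are of the form `s ↦ α⁻¹ (8 C s)`.
The bounds on `v`, `ω` and `η` are variations of constants; for `η`, one uses that the signal is
close to the signal interval wherever `Ψ` is hardly larger than `y₀`.

These estimates hold as long as the position stays in a compact neighbourhood `K` of the sublevel
set, and they imply that it stays in a smaller open set (`exists_apriori_bounds`). As the
disturbances enter additively, subtraction of their integrals leaves a differential equation with
a continuous right-hand side. Solutions of the truncated equation exist by the Picard–Lindelöf
theorem, and by the a priori bounds the truncation does not act on them
(`exists_isSolution_Icc`). With uniqueness by Gronwall's inequality, the union of all solutions is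
the maximal solution, and it satisfies the bounds at all times `t ≥ t₀`.
-/

namespace SourceSeeking

/-! ### Comparison functions -/

/-- A continuous function `u ≥ 0` on a compact space that is positive wherever the continuous
function `D` is positive dominates an increasing homeomorphism of `D`. The lower envelope
`s ↦ inf (u + (s - D)⁺)` is monotone and continuous; it is cut off by `s` and multiplied by
`s / (1 + s)` to make it strictly increasing and zero at zero. -/
lemma exists_orderIso_comp_le {X : Type*} [TopologicalSpace X] [CompactSpace X] {u D : X → ℝ}
    (hu : Continuous u) (hD : Continuous D) (hu0 : ∀ x, 0 ≤ u x) (h : ∀ x, 0 < D x → 0 < u x) :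
    ∃ α : ℝ ≃o ℝ, α 0 = 0 ∧ (∀ s, 0 ≤ s → α s ≤ s) ∧ ∀ x, 0 ≤ D x → α (D x) ≤ u x := by
  rcases isEmpty_or_nonempty X with hX | hX
  · exact ⟨OrderIso.refl ℝ, rfl, fun s _ => le_rfl, fun x => (hX.false x).elim⟩
  set f : ℝ → X → ℝ := fun s x => u x + max (s - D x) 0 with hf
  set A : ℝ → ℝ := fun s => sInf (f s '' Set.univ) with hA
  have hf0 : ∀ s x, 0 ≤ f s x := fun s x => add_nonneg (hu0 x) (le_max_right _ _)
  have hbdd : ∀ s, BddBelow (f s '' Set.univ) := fun s =>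
    ⟨0, by rintro _ ⟨x, -, rfl⟩; exact hf0 s x⟩
  have hAle : ∀ s x, A s ≤ f s x := fun s x => csInf_le (hbdd s) ⟨x, trivial, rfl⟩
  have hleA : ∀ s c, (∀ x, c ≤ f s x) → c ≤ A s := fun s c hc =>
    le_csInf (Set.univ_nonempty.image _) (by rintro _ ⟨x, -, rfl⟩; exact hc x)
  have hAcont : Continuous A := by
    refine isCompact_univ.continuous_sInf (f := f) ?_
    simp only [hf, Function.HasUncurry.uncurry, id]
    fun_prop
  have hA0 : ∀ s, 0 ≤ A s := fun s => hleA s 0 (hf0 s)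
  have hAmono : Monotone A := fun s t hst => hleA t _ fun x => (hAle s x).trans (by
    simp only [hf]; gcongr)
  have hApos : ∀ s, 0 < s → 0 < A s := by
    intro s hs
    have hfc : Continuous (f s) := by simp only [hf]; fun_prop
    obtain ⟨x, -, hx⟩ := isCompact_univ.exists_isMinOn Set.univ_nonempty hfc.continuousOn
    refine lt_of_lt_of_le ?_ (hleA s (f s x) fun y => hx (Set.mem_univ y))
    rcases lt_or_ge 0 (D x) with hd | hd
    · exact add_pos_of_pos_of_nonneg (h x hd) (le_max_right _ _)
    · exact add_pos_of_nonneg_of_pos (hu0 x) (lt_max_of_lt_left (by linarith))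
  -- For `s ≤ 0` the first summand vanishes, and the last one extends the function by `s`.
  set α : ℝ → ℝ := fun s => min (max s 0) (A s) * (max s 0 / (1 + max s 0)) + min s 0 with hα
  have hm0 : ∀ s, 0 ≤ min (max s 0) (A s) := fun s => le_min (le_max_right _ _) (hA0 s)
  have hq0 : ∀ s : ℝ, 0 ≤ max s 0 / (1 + max s 0) := fun s => by positivity
  have hq1 : ∀ s : ℝ, max s 0 / (1 + max s 0) ≤ 1 := fun s => by
    rw [div_le_one (by positivity)]; linarith
  have hmono : StrictMono α := by
    intro s t hst
    rcases lt_or_ge s 0 with hs | hs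
    · have h1 : α s = s := by simp [hα, max_eq_right hs.le, min_eq_left hs.le]
      have h2 : min t 0 ≤ α t := le_add_of_nonneg_left (mul_nonneg (hm0 t) (hq0 t))
      rw [h1]
      exact (lt_min hst hs).trans_le h2
    · have ht : 0 < t := hs.trans_lt hst
      simp only [hα, min_eq_right hs, min_eq_right ht.le, max_eq_left hs, max_eq_left ht.le,
        add_zero]
      have h1 : min s (A s) ≤ min t (A t) := min_le_min hst.le (hAmono hst.le)
      have h2 : 0 < min t (A t) := lt_min ht (hApos t ht)
      have h3 : s / (1 + s) < t / (1 + t) := by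
        rw [div_lt_div_iff₀ (by linarith) (by linarith)]; linarith
      calc min s (A s) * (s / (1 + s)) ≤ min t (A t) * (s / (1 + s)) := by gcongr
        _ < _ := by gcongr
  have hcont : Continuous α := by
    simp only [hα]
    refine ((((continuous_id.max continuous_const).min hAcont)).mul
      ((continuous_id.max continuous_const).div
        (continuous_const.add (continuous_id.max continuous_const)) fun s => ?_)).add
      (continuous_id.min continuous_const)
    have : (0:ℝ) ≤ max s 0 := le_max_right _ _
    exact (show 0 < 1 + max s 0 by linarith).ne'
  have hsurj : Function.Surjective α := by
    refine hcont.surjective ?_ ?_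
    · obtain ⟨d, hd⟩ := isCompact_univ.bddAbove_image (f := D) hD.continuousOn
      have hd' : ∀ x, D x ≤ max d 0 := fun x => (hd ⟨x, trivial, rfl⟩).trans (le_max_left _ _)
      have hd0 : 0 ≤ max d 0 := le_max_right _ _
      refine Filter.tendsto_atTop_mono' _ (f₁ := fun s => (s - max d 0) * (1/2)) ?_ ?_
      · filter_upwards [Filter.eventually_ge_atTop (1 + max d 0)] with s hs
        have hs0 : 0 ≤ s := by linarith
        have h1 : s - max d 0 ≤ min s (A s) := le_min (by linarith) (hleA s _ fun x =>
          le_add_of_nonneg_of_le (hu0 x) (le_max_of_le_left (by linarith [hd' x])))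
        have h2 : 1 / 2 ≤ s / (1 + s) := by
          rw [div_le_div_iff₀ (by norm_num) (by linarith)]; linarith
        simp only [hα, max_eq_left hs0, min_eq_right hs0, add_zero]
        exact mul_le_mul h1 h2 (by norm_num) (by linarith)
      · exact (Filter.tendsto_atTop_add_const_right _ (-max d 0) Filter.tendsto_id).atTop_mul_const
          (by norm_num)
    · refine Filter.tendsto_id.congr' ?_
      filter_upwards [Filter.eventually_le_atBot 0] with s hs
      simp [hα, max_eq_right hs, min_eq_left hs]
  refine ⟨hmono.orderIsoOfSurjective α hsurj, ?_, ?_, ?_⟩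
  · change α 0 = 0
    simp [hα]
  · intro s hs
    change α s ≤ s
    simp only [hα, min_eq_right hs, add_zero]
    calc _ ≤ max s 0 * 1 := mul_le_mul (min_le_left _ _) (hq1 s) (hq0 s) (le_max_right _ _)
      _ = s := by rw [mul_one, max_eq_left hs]
  · intro x hx
    change α (D x) ≤ u x
    simp only [hα, min_eq_right hx, add_zero]
    calc _ ≤ A (D x) * 1 := mul_le_mul (min_le_right _ _) (hq1 _) (hq0 _) (hA0 _)
      _ ≤ f (D x) x := by rw [mul_one]; exact hAle _ _
      _ = u x := by simp [hf]

lemma exists_orderIso_comp_le_on {X : Type*} [TopologicalSpace X] {K : Set X} (hK : IsCompact K)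
    {u D : X → ℝ} (hu : ContinuousOn u K) (hD : ContinuousOn D K) (hu0 : ∀ x ∈ K, 0 ≤ u x)
    (h : ∀ x ∈ K, 0 < D x → 0 < u x) :
    ∃ α : ℝ ≃o ℝ, α 0 = 0 ∧ (∀ s, 0 ≤ s → α s ≤ s) ∧ ∀ x ∈ K, 0 ≤ D x → α (D x) ≤ u x := by
  have := isCompact_iff_compactSpace.1 hK
  obtain ⟨α, h0, h1, h2⟩ := exists_orderIso_comp_le (X := K) hu.domRestrict hD.domRestrict
    (fun x => hu0 x x.2) (fun x => h x x.2)
  exact ⟨α, h0, h1, fun x hx => h2 ⟨x, hx⟩⟩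

lemma isClassK_orderIso_mul {χ : ℝ ≃o ℝ} (h0 : χ 0 = 0) {c : ℝ} (hc : 0 < c) :
    IsClassK (fun s => χ (c * s)) where
  continuousOn := (χ.continuous.comp (continuous_const.mul continuous_id)).continuousOn
  strictMonoOn := fun s _ t _ hst => χ.strictMono (by gcongr)
  map_zero := by simp [h0]

lemma IsClassK.add_mul {γ : ℝ → ℝ} (h : IsClassK γ) {c : ℝ} (hc : 0 ≤ c) :
    IsClassK (fun s => γ s + c * s) where
  continuousOn := h.continuousOn.add (continuous_const.mul continuous_id).continuousOn
  strictMonoOn := fun s hs t ht hst => add_lt_add_of_lt_of_le (h.strictMonoOn hs ht hst) (by gcongr)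
  map_zero := by simp [h.map_zero]

lemma IsClassK.nonneg {γ : ℝ → ℝ} (h : IsClassK γ) {s : ℝ} (hs : 0 ≤ s) : 0 ≤ γ s := by
  rw [← h.map_zero]
  exact h.strictMonoOn.monotoneOn (Set.mem_Ici.2 le_rfl) hs hs

lemma IsClassK.orderIso_comp {γ : ℝ → ℝ} (h : IsClassK γ) {χ : ℝ ≃o ℝ} (h0 : χ 0 = 0) :
    IsClassK (fun s => χ (γ s)) where
  continuousOn := χ.continuous.comp_continuousOn h.continuousOn
  strictMonoOn := χ.strictMono.comp_strictMonoOn h.strictMonoOn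
  map_zero := by simp [h.map_zero, h0]

/-- A class `𝒦` function is small at small arguments. -/
lemma IsClassK.exists_lt {γ : ℝ → ℝ} (h : IsClassK γ) {b : ℝ} (hb : 0 < b) :
    ∃ a, 0 < a ∧ ∀ s, 0 ≤ s → s ≤ a → γ s < b := by
  have h1 : ∀ᶠ s in nhdsWithin 0 (Set.Ici 0), γ s < b :=
    (h.continuousOn 0 (Set.mem_Ici.2 le_rfl)).eventually_lt continuousWithinAt_const
      (by simpa [h.map_zero] using hb)
  rw [Filter.Eventually, Metric.mem_nhdsWithin_iff] at h1
  obtain ⟨a, ha, hs⟩ := h1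
  refine ⟨a / 2, by linarith, fun s h0 h1 => hs ⟨?_, h0⟩⟩
  rw [Metric.mem_ball, Real.dist_eq, sub_zero, abs_of_nonneg h0]
  linarith

/-! ### The flow of the descent -/

/-- The flow of `y' = -α y / 2` on `[0, ∞)` is of class `𝒦ℒ`. In the coordinate `x = log y`
the flow is conjugate, by the primitive `ℓ` of `2 eˣ / α (eˣ) ≥ 2`, to the translation flow
on `ℝ`. -/
lemma exists_classKL_flow (α : ℝ ≃o ℝ) (h0 : α 0 = 0) (hle : ∀ s, 0 ≤ s → α s ≤ s) :
    ∃ β : ℝ → ℝ → ℝ, IsClassKL β ∧ (∀ s, 0 ≤ s → β s 0 = s) ∧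
      ∀ s t, HasDerivAt (β s) (-(α (β s t)) / 2) t := by
  have hαpos : ∀ s, 0 < s → 0 < α s := fun s hs => by rw [← h0]; exact α.strictMono hs
  set g : ℝ → ℝ := fun x => 2 * Real.exp x / α (Real.exp x) with hg
  have hgc : Continuous g := by
    refine (continuous_const.mul Real.continuous_exp).div (α.continuous.comp Real.continuous_exp)
      fun x => (hαpos _ (Real.exp_pos x)).ne'
  have hg2 : ∀ x, 2 ≤ g x := fun x => by
    rw [hg, le_div_iff₀ (hαpos _ (Real.exp_pos x))]
    have := hle _ (Real.exp_pos x).le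
    linarith
  set l : ℝ → ℝ := fun x => ∫ y in (0:ℝ)..x, g y with hl
  have hld : ∀ x, HasDerivAt l (g x) x := fun x =>
    intervalIntegral.integral_hasDerivAt_right (hgc.intervalIntegrable _ _)
      (hgc.stronglyMeasurableAtFilter _ _) hgc.continuousAt
  have hlc : Continuous l := continuous_iff_continuousAt.2 fun x => (hld x).continuousAt
  have hlm : StrictMono l := strictMono_of_hasDerivAt_pos hld fun x => by linarith [hg2 x]
  have hgrow : Monotone fun x => l x - 2 * x := by
    refine monotone_of_hasDerivAt_nonneg
      (fun x => (hld x).sub ((hasDerivAt_id x).const_mul 2)) fun x => ?_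
    simpa using hg2 x
  have hl0 : l 0 = 0 := by simp [hl]
  have hsurj : Function.Surjective l := by
    refine hlc.surjective ?_ ?_
    · refine Filter.tendsto_atTop_mono' _ (f₁ := fun x : ℝ => 2 * x) ?_
        (Filter.tendsto_id.const_mul_atTop two_pos)
      filter_upwards [Filter.eventually_ge_atTop 0] with x hx
      have := hgrow hx
      simp only [hl0] at this
      linarith
    · refine Filter.tendsto_atBot_mono' _ (f₁ := fun x : ℝ => 2 * x) ?_
        (Filter.tendsto_id.const_mul_atBot two_pos)
      filter_upwards [Filter.eventually_le_atBot 0] with x hx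
      have := hgrow hx
      simp only [hl0] at this
      linarith
  set e : ℝ ≃o ℝ := hlm.orderIsoOfSurjective l hsurj with he
  have hel : ∀ x, e x = l x := fun x => rfl
  set β : ℝ → ℝ → ℝ := fun s t => if s ≤ 0 then 0 else Real.exp (e.symm (e (Real.log s) - t))
    with hβ
  have hβ0 : ∀ s t, s ≤ 0 → β s t = 0 := fun s t hs => by simp [hβ, hs]
  have hβp : ∀ s t, 0 < s → β s t = Real.exp (e.symm (e (Real.log s) - t)) := fun s t hs => by
    simp [hβ, hs]
  have hβnn : ∀ s t, 0 ≤ β s t := fun s t => by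
    rcases le_or_gt s 0 with hs | hs
    · rw [hβ0 s t hs]
    · rw [hβp s t hs]; exact (Real.exp_pos _).le
  have hβinit : ∀ s, 0 ≤ s → β s 0 = s := fun s hs => by
    rcases hs.eq_or_lt with rfl | hs
    · exact hβ0 _ _ le_rfl
    · rw [hβp s 0 hs, sub_zero, e.symm_apply_apply, Real.exp_log hs]
  have hanti : ∀ s, Antitone (β s) := fun s t t' htt => by
    rcases le_or_gt s 0 with hs | hs
    · rw [hβ0 s t hs, hβ0 s t' hs]
    · rw [hβp s t hs, hβp s t' hs]
      exact Real.exp_le_exp.2 (e.symm.monotone (by linarith))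
  have hjoint : ContinuousOn (fun q : ℝ × ℝ => β q.1 q.2) (Set.Ici 0 ×ˢ Set.Ici 0) := by
    rintro ⟨s, t⟩ ⟨hs, ht⟩
    simp only [Set.mem_Ici] at hs ht
    rcases hs.eq_or_lt with rfl | hs
    · rw [ContinuousWithinAt, hβ0 0 t le_rfl]
      refine tendsto_of_tendsto_of_tendsto_of_le_of_le' (g := fun _ => (0:ℝ))
        (h := fun q : ℝ × ℝ => q.1) tendsto_const_nhds ?_ ?_ ?_
      · exact (continuous_fst.tendsto ((0:ℝ), t)).mono_left nhdsWithin_le_nhds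
      · exact Filter.Eventually.of_forall fun q => hβnn _ _
      · filter_upwards [self_mem_nhdsWithin] with q hq
        exact (hanti _ hq.2).trans (hβinit _ hq.1).le
    · refine ContinuousAt.continuousWithinAt ?_
      have h1 : ContinuousAt (fun q : ℝ × ℝ => Real.exp (e.symm (e (Real.log q.1) - q.2)))
          (s, t) := by
        refine Real.continuous_exp.continuousAt.comp (e.symm.continuous.continuousAt.comp ?_)
        refine ContinuousAt.sub ?_ continuous_snd.continuousAt
        exact e.continuous.continuousAt.comp
          (ContinuousAt.log continuous_fst.continuousAt hs.ne')
      refine h1.congr ?_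
      filter_upwards [continuous_fst.continuousAt.eventually
        (lt_mem_nhds (show (0:ℝ) < ((s, t) : ℝ × ℝ).1 from hs))] with q hq
      exact (hβp _ _ hq).symm
  refine ⟨β, ⟨hjoint, ?_, fun s _ => (hanti s).antitoneOn _, ?_⟩, hβinit, ?_⟩
  · intro t ht
    refine ⟨?_, ?_, hβ0 0 t le_rfl⟩
    · exact hjoint.comp (f := fun s : ℝ => (s, t)) (by fun_prop) fun s hs => ⟨hs, ht⟩
    · intro s hs s' hs' hss
      simp only [Set.mem_Ici] at hs hs'
      have hs'' : 0 < s' := hs.trans_lt hss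
      simp only
      rw [hβp s' t hs'']
      rcases hs.eq_or_lt with rfl | hs
      · rw [hβ0 0 t le_rfl]; exact Real.exp_pos _
      · rw [hβp s t hs, Real.exp_lt_exp]
        refine e.symm.strictMono ?_
        have := e.strictMono (Real.log_lt_log hs hss)
        linarith
  · intro s hs
    rcases hs.eq_or_lt with rfl | hs
    · exact tendsto_const_nhds.congr fun t => (hβ0 0 t le_rfl).symm
    · refine Filter.Tendsto.congr (fun t => (hβp s t hs).symm) ?_
      refine Real.tendsto_exp_atBot.comp (e.symm.tendsto_atBot.comp ?_)
      exact Filter.tendsto_atBot_add_const_left _ _ Filter.tendsto_neg_atTop_atBot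
  · intro s t
    rcases le_or_gt s 0 with hs | hs
    · have : β s = fun _ => 0 := funext fun t => hβ0 s t hs
      rw [this]
      simpa [h0] using hasDerivAt_const t (0:ℝ)
    · have : β s = fun t => Real.exp (e.symm (e (Real.log s) - t)) := funext fun t => hβp s t hs
      rw [this]
      set c := e (Real.log s)
      have h1 : HasDerivAt e.symm (g (e.symm (c - t)))⁻¹ (c - t) :=
        HasDerivAt.of_local_left_inverse e.symm.continuous.continuousAt (hld _)
          (by linarith [hg2 (e.symm (c - t))])
          (Filter.Eventually.of_forall fun y => e.apply_symm_apply y)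
      have h2 := (h1.comp t ((hasDerivAt_id t).const_sub c)).exp
      convert! h2 using 1
      have := hαpos _ (Real.exp_pos (e.symm (c - t)))
      simp only [hg, Function.comp]
      field_simp

/-- Comparison with the flow of `y' = -ε α y / 2`, above a threshold `b` at which the decay rate
`α` is twice the perturbation. -/
lemma le_max_flow_of_sub_le_integral {α : ℝ ≃o ℝ} {β : ℝ → ℝ → ℝ} (h0 : α 0 = 0)
    (hβd : ∀ s t, HasDerivAt (β s) (-(α (β s t)) / 2) t) {ε b t₀ t₁ s : ℝ} (hε : 0 < ε)
    (hb : 0 ≤ b) (hβ0 : β s 0 = s) {z : ℝ → ℝ}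
    (hz : ContinuousOn z (Set.Icc t₀ t₁)) (hz0 : z t₀ ≤ s)
    (hdec : ∀ a ∈ Set.Icc t₀ t₁, ∀ c ∈ Set.Icc t₀ t₁, a ≤ c →
      z c - z a ≤ ∫ τ in a..c, ε * (α b / 2 - α (z τ))) :
    ∀ t ∈ Set.Icc t₀ t₁, z t ≤ max (β s (ε * (t - t₀))) b := by
  intro t ht
  by_contra! hcon
  have hβc : Continuous fun τ => β s (ε * (τ - t₀)) :=
    (continuous_iff_continuousAt.2 fun t => (hβd s t).continuousAt).comp (by fun_prop)
  set M : ℝ → ℝ := fun τ => max (β s (ε * (τ - t₀))) b with hM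
  have hMc : Continuous M := hβc.max continuous_const
  have hsub : Set.Icc t₀ t ⊆ Set.Icc t₀ t₁ := Set.Icc_subset_Icc_right ht.2
  set S : Set ℝ := Set.Icc t₀ t ∩ {τ | z τ ≤ M τ} with hS
  have hSc : IsCompact S := by
    have : IsClosed S := by
      exact isClosed_Icc.isClosed_le (hz.mono hsub) hMc.continuousOn
    exact isCompact_Icc.of_isClosed_subset this Set.inter_subset_left
  have hSne : S.Nonempty := ⟨t₀, ⟨le_rfl, ht.1⟩, by
    simp only [Set.mem_ofPred_eq, hM, sub_self, mul_zero, hβ0]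
    exact le_max_of_le_left hz0⟩
  -- `a` is the last time before `t` at which the asserted bound holds.
  obtain ⟨a, haS, ha⟩ := hSc.exists_isGreatest hSne
  have hat : a < t := lt_of_le_of_ne haS.1.2 (by
    rintro rfl; exact absurd haS.2 (not_le.2 hcon))
  have habove : ∀ τ ∈ Set.Ioc a t, M τ < z τ := fun τ hτ => by
    by_contra! hle
    exact absurd (ha ⟨⟨haS.1.1.trans hτ.1.le, hτ.2⟩, hle⟩) (not_le.2 hτ.1)
  have haI : a ∈ Set.Icc t₀ t₁ := hsub haS.1
  have hzc : ContinuousOn z (Set.uIcc a t) := by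
    rw [Set.uIcc_of_le hat.le]; exact hz.mono (Set.Icc_subset_Icc haI.1 ht.2)
  have h1 := hdec a haI t ht hat.le
  have hint1 : IntervalIntegrable (fun τ => ε * (α b / 2 - α (z τ))) volume a t :=
    (continuousOn_const.mul (continuousOn_const.sub
      (α.continuous.comp_continuousOn hzc))).intervalIntegrable
  have hpos : ∀ x, 0 ≤ x → 0 ≤ α x := fun x hx => by rw [← h0]; exact α.monotone hx
  -- On `(a, t]`, both `b` and the flow are less than `z`; hence `z` does not increase, and its rate
  -- is at most the rate of the flow. The larger one of both at time `a` gives the contradiction.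
  rcases le_total (β s (ε * (a - t₀))) b with hcase | hcase
  · have h2 : ∫ τ in a..t, ε * (α b / 2 - α (z τ)) ≤ ∫ τ in a..t, (0:ℝ) := by
      refine intervalIntegral.integral_mono_on_of_le_Ioo hat.le hint1 (by simp) fun τ hτ => ?_
      have hlt := habove τ ⟨hτ.1, hτ.2.le⟩
      have h3 : α b ≤ α (z τ) := α.monotone ((le_max_right _ _).trans hlt.le)
      have h4 := hpos b hb
      exact mul_nonpos_of_nonneg_of_nonpos hε.le (by linarith)
    simp only [intervalIntegral.integral_zero] at h2
    have h5 : z a ≤ b := by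
      have : z a ≤ M a := haS.2
      rwa [show M a = b from max_eq_right hcase] at this
    have h6 : b < z t := (le_max_right _ _).trans_lt hcon
    linarith
  · have hder : ∀ τ ∈ Set.uIcc a t, HasDerivAt (fun τ => β s (ε * (τ - t₀)))
        (-(α (β s (ε * (τ - t₀)))) / 2 * ε) τ := fun τ _ => by
      have := (hβd s (ε * (τ - t₀))).comp τ (((hasDerivAt_id τ).sub_const t₀).const_mul ε)
      simpa [Function.comp_def] using this
    have hint2 : IntervalIntegrable (fun τ => -(α (β s (ε * (τ - t₀)))) / 2 * ε) volume a t :=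
      (((α.continuous.comp hβc).neg.div_const 2).mul continuous_const).intervalIntegrable _ _
    have h2 : ∫ τ in a..t, ε * (α b / 2 - α (z τ)) ≤
        ∫ τ in a..t, -(α (β s (ε * (τ - t₀)))) / 2 * ε := by
      refine intervalIntegral.integral_mono_on_of_le_Ioo hat.le hint1 hint2 fun τ hτ => ?_
      have hlt := habove τ ⟨hτ.1, hτ.2.le⟩
      have h3 : α b ≤ α (z τ) := α.monotone ((le_max_right _ _).trans hlt.le)
      have h4 : α (β s (ε * (τ - t₀))) ≤ α (z τ) := α.monotone ((le_max_left _ _).trans hlt.le)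
      nlinarith
    rw [intervalIntegral.integral_eq_sub_of_hasDerivAt hder hint2] at h2
    have h5 : z a ≤ β s (ε * (a - t₀)) := by
      have : z a ≤ M a := haS.2
      rwa [show M a = β s (ε * (a - t₀)) from max_eq_left hcase] at this
    have h6 : β s (ε * (t - t₀)) < z t := (le_max_left _ _).trans_lt hcon
    linarith

/-! ### Parametric integrals -/

section Parametric

variable {E F : Type*} [NormedAddCommGroup E] [NormedSpace ℝ E] [ProperSpace E]
  [NormedAddCommGroup F] [NormedSpace ℝ F] {f : E × ℝ → F}

lemma hasFDerivAt_parametric_integral (hf : ContDiff ℝ 1 f) (a b : ℝ) (x : E) :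
    HasFDerivAt (fun x => ∫ s in a..b, f (x, s))
      (∫ s in a..b, (fderiv ℝ f (x, s)).comp (ContinuousLinearMap.inl ℝ E ℝ)) x := by
  have hF'c : Continuous fun q : E × ℝ =>
      (fderiv ℝ f q).comp (ContinuousLinearMap.inl ℝ E ℝ) :=
    (hf.continuous_fderiv (by norm_num)).clm_comp continuous_const
  obtain ⟨C, hC⟩ := ((isCompact_closedBall x 1).prod
    (isCompact_uIcc (a := a) (b := b))).exists_bound_of_continuousOn hF'c.continuousOn
  refine intervalIntegral.hasFDerivAt_integral_of_dominated_of_fderiv_le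
    (F' := fun x s => (fderiv ℝ f (x, s)).comp (ContinuousLinearMap.inl ℝ E ℝ))
    (bound := fun _ => C) (Metric.closedBall_mem_nhds x one_pos) ?_ ?_ ?_ ?_ ?_ ?_
  · exact Filter.Eventually.of_forall fun y =>
      (hf.continuous.comp (by fun_prop : Continuous fun s : ℝ => (y, s))).aestronglyMeasurable
  · exact (hf.continuous.comp
      (by fun_prop : Continuous fun s : ℝ => (x, s))).intervalIntegrable _ _
  · exact (hF'c.comp (by fun_prop : Continuous fun s : ℝ => (x, s))).aestronglyMeasurable
  · exact Filter.Eventually.of_forall fun s hs y hy =>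
      hC (y, s) ⟨hy, Set.uIoc_subset_uIcc hs⟩
  · exact intervalIntegrable_const
  · exact Filter.Eventually.of_forall fun s _ y _ =>
      ((hf.differentiable one_ne_zero) (y, s)).hasFDerivAt.comp y (hasFDerivAt_prodMk_left y s)

lemma contDiff_parametric_integral (hf : ContDiff ℝ 1 f) (a b : ℝ) :
    ContDiff ℝ 1 fun x => ∫ s in a..b, f (x, s) := by
  refine contDiff_one_iff_hasFDerivAt.2
    ⟨_, ?_, fun x => hasFDerivAt_parametric_integral hf a b x⟩
  refine intervalIntegral.continuous_parametric_intervalIntegral_of_continuous' ?_ a b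
  exact (hf.continuous_fderiv (by norm_num)).clm_comp continuous_const

lemma fderiv_parametric_integral_apply [CompleteSpace F] (hf : ContDiff ℝ 1 f) (a b : ℝ) (x u : E) :
    fderiv ℝ (fun x => ∫ s in a..b, f (x, s)) x u = ∫ s in a..b, fderiv ℝ f (x, s) (u, 0) := by
  rw [(hasFDerivAt_parametric_integral hf a b x).fderiv,
    ContinuousLinearMap.intervalIntegral_apply]
  · simp
  · refine Continuous.intervalIntegrable ?_ _ _
    exact ((hf.continuous_fderiv (by norm_num)).comp
      (by fun_prop : Continuous fun s : ℝ => (x, s))).clm_comp continuous_const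

end Parametric

/-! ### Rotations and polar coordinates -/

/-- The quarter turn `rot` as a continuous linear map. -/
noncomputable def rotL : Plane →L[ℝ] Plane :=
  LinearMap.toContinuousLinearMap
    { toFun := rot
      map_add' := fun u v => by ext i; fin_cases i <;> simp [rot, add_comm]
      map_smul' := fun c u => by ext i; fin_cases i <;> simp [rot] }

@[simp] lemma rotL_apply (u : Plane) : rotL u = rot u := rfl

lemma rot_rot (u : Plane) : rot (rot u) = -u := by
  ext i; fin_cases i <;> simp [rot]

/-- The rotation of `o` by the angle `s`. -/
noncomputable def turn (s : ℝ) (o : Plane) : Plane := Real.cos s • o + Real.sin s • rot o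

/-- The unit vector of angle `θ`. -/
noncomputable def dir (θ : ℝ) : Plane := !₂[Real.cos θ, Real.sin θ]

lemma contDiff_dir {n : WithTop ℕ∞} : ContDiff ℝ n dir := by
  rw [contDiff_euclidean]
  intro i
  fin_cases i
  · simpa [dir] using Real.contDiff_cos
  · simpa [dir] using Real.contDiff_sin

lemma norm_dir (θ : ℝ) : ‖dir θ‖ = 1 := by
  simp [EuclideanSpace.norm_eq, Fin.sum_univ_two, dir]

lemma dir_periodic : Function.Periodic dir (2 * Real.pi) := fun θ => by
  ext i; fin_cases i <;> simp [dir]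

lemma turn_dir (s θ : ℝ) : turn s (dir θ) = dir (s + θ) := by
  ext i; fin_cases i <;> simp [turn, dir, rot, Real.cos_add, Real.sin_add] <;> ring

lemma hasDerivAt_dir (θ : ℝ) : HasDerivAt dir (rot (dir θ)) θ := by
  have : dir = fun s => Real.cos s • dir 0 + Real.sin s • rot (dir 0) := by
    ext s i; fin_cases i <;> simp [dir, rot]
  have h2 : rot (dir θ) = (-Real.sin θ) • dir 0 + Real.cos θ • rot (dir 0) := by
    ext i; fin_cases i <;> simp [dir, rot]
  rw [h2]
  exact (((Real.hasDerivAt_cos θ).smul_const (dir 0)).add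
    ((Real.hasDerivAt_sin θ).smul_const (rot (dir 0)))).congr_of_eventuallyEq
      (Filter.Eventually.of_forall (congrFun this))

lemma hasDerivAt_turn (s : ℝ) (o : Plane) : HasDerivAt (fun s => turn s o) (turn s (rot o)) s := by
  have h2 : turn s (rot o) = (-Real.sin s) • o + Real.cos s • rot o := by
    simp [turn, rot_rot, add_comm]
  rw [h2]
  exact ((Real.hasDerivAt_cos s).smul_const _).add ((Real.hasDerivAt_sin s).smul_const _)

lemma contDiff_turn {G : Type*} [NormedAddCommGroup G] [NormedSpace ℝ G] {n : WithTop ℕ∞}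
    {s : G → ℝ} {o : G → Plane} (hs : ContDiff ℝ n s) (ho : ContDiff ℝ n o) :
    ContDiff ℝ n fun z => turn (s z) (o z) := by
  have : ContDiff ℝ n fun z => Real.cos (s z) • o z + Real.sin (s z) • rotL (o z) := by
    fun_prop
  exact this

lemma turn_add (s : ℝ) (o o' : Plane) : turn s (o + o') = turn s o + turn s o' := by
  ext i; fin_cases i <;> simp [turn, rot] <;> ring

lemma turn_smul (s c : ℝ) (o : Plane) : turn s (c • o) = c • turn s o := by
  ext i; fin_cases i <;> simp [turn, rot] <;> ring

lemma turn_two_pi (o : Plane) : turn (2 * Real.pi) o = o := by simp [turn]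

lemma exists_dir_eq {o : Plane} (ho : ‖o‖ = 1) : ∃ θ, dir θ = o := by
  have h : o 0 ^ 2 + o 1 ^ 2 = 1 := by
    have := EuclideanSpace.norm_sq_eq o
    simpa [ho, Fin.sum_univ_two] using this.symm
  refine ⟨Complex.arg ⟨o 0, o 1⟩, ?_⟩
  have hn : ‖(⟨o 0, o 1⟩ : ℂ)‖ = 1 := by
    rw [Complex.norm_def, Real.sqrt_eq_one, Complex.normSq_mk]; nlinarith
  have hne : (⟨o 0, o 1⟩ : ℂ) ≠ 0 := by rw [← norm_ne_zero_iff, hn]; exact one_ne_zero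
  ext i
  fin_cases i
  · simp [dir, Complex.cos_arg hne, hn]
  · simp [dir, Complex.sin_arg, hn]

/-- `u` in the rotating orthonormal frame `dir θ, rot (dir θ)`. -/
lemma eq_inner_smul_dir_add (θ : ℝ) (u : Plane) :
    u = inner ℝ (dir θ) u • dir θ + inner ℝ (rot (dir θ)) u • rot (dir θ) := by
  have h := Real.sin_sq_add_cos_sq θ
  ext i; fin_cases i
  · simp [dir, rot, PiLp.inner_apply, Fin.sum_univ_two]
    linear_combination (-(u 0)) * h
  · simp [dir, rot, PiLp.inner_apply, Fin.sum_univ_two]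
    linear_combination (-(u 1)) * h

lemma setIntegral_unit_disk {f : Plane → ℝ} (hf : Continuous f) :
    ∫ q in Metric.closedBall (0 : Plane) 1, f q =
      ∫ ρ in (0:ℝ)..1, ∫ θ in (0:ℝ)..(2 * Real.pi), ρ * f (ρ • dir θ) := by
  set F : Plane → ℝ := (Metric.closedBall (0 : Plane) 1).indicator f with hF
  have hcong : ∀ p ∈ polarCoord.target, p.1 • F !₂[(polarCoord.symm p).1, (polarCoord.symm p).2] =
      (Set.Ioc (0:ℝ) 1 ×ˢ Set.Ioo (-Real.pi) Real.pi).indicator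
        (fun p : ℝ × ℝ => p.1 * f (p.1 • dir p.2)) p := by
    rintro ⟨ρ, θ⟩ ⟨hρ, hθ⟩
    simp only [Set.mem_Ioi] at hρ
    have h1 : (!₂[(polarCoord.symm (ρ, θ)).1, (polarCoord.symm (ρ, θ)).2] : Plane) = ρ • dir θ := by
      ext i; fin_cases i <;> simp [dir, polarCoord]
    simp only [h1]
    have hmem : ρ • dir θ ∈ Metric.closedBall (0 : Plane) 1 ↔ ρ ≤ 1 := by
      rw [mem_closedBall_zero_iff, norm_smul, norm_dir, mul_one, Real.norm_of_nonneg hρ.le]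
    by_cases h : ρ ≤ 1
    · rw [hF, Set.indicator_of_mem (hmem.2 h), Set.indicator_of_mem (by exact ⟨⟨hρ, h⟩, hθ⟩),
        smul_eq_mul]
    · rw [hF, Set.indicator_of_notMem (fun h' => h (hmem.1 h')),
        Set.indicator_of_notMem (fun h' => h h'.1.2), smul_zero]
  have hm1 := (volume_preserving_finTwoArrow ℝ).symm
  have hm2 := (EuclideanSpace.volume_preserving_symm_measurableEquiv_toLp (Fin 2)).symm
  have hcongr' := setIntegral_congr_fun (μ := volume) polarCoord.open_target.measurableSet hcong
  have hgc : Continuous fun p : ℝ × ℝ => p.1 * f (p.1 • dir p.2) := by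
    have := contDiff_dir (n := 0) |>.continuous
    fun_prop
  calc ∫ q in Metric.closedBall (0 : Plane) 1, f q = ∫ q, F q :=
        (integral_indicator Metric.isClosed_closedBall.measurableSet).symm
    _ = ∫ p : ℝ × ℝ, F !₂[p.1, p.2] := by
        rw [← hm2.integral_comp' F, ← hm1.integral_comp']
        rfl
    _ = ∫ p in Set.Ioc (0:ℝ) 1 ×ˢ Set.Ioo (-Real.pi) Real.pi, p.1 * f (p.1 • dir p.2) := by
        rw [← integral_comp_polarCoord_symm, hcongr', setIntegral_indicator
          (measurableSet_Ioc.prod measurableSet_Ioo)]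
        congr 2
        ext ⟨ρ, θ⟩
        simp only [polarCoord, Set.mem_inter_iff, Set.mem_prod, Set.mem_Ioi, Set.mem_Ioc]
        tauto
    _ = ∫ ρ in Set.Ioc (0:ℝ) 1, ∫ θ in Set.Ioo (-Real.pi) Real.pi, ρ * f (ρ • dir θ) := by
        refine setIntegral_prod (fun p : ℝ × ℝ => p.1 * f (p.1 • dir p.2)) ?_
        exact (hgc.continuousOn.integrableOn_compact
          (isCompact_Icc.prod (isCompact_Icc (a := -Real.pi) (b := Real.pi)))).mono_set
          (Set.prod_mono Set.Ioc_subset_Icc_self Set.Ioo_subset_Icc_self)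
    _ = ∫ ρ in (0:ℝ)..1, ∫ θ in (0:ℝ)..(2 * Real.pi), ρ * f (ρ • dir θ) := by
        rw [intervalIntegral.integral_of_le zero_le_one]
        refine setIntegral_congr_fun measurableSet_Ioc fun ρ _ => ?_
        rw [← integral_Ioc_eq_integral_Ioo,
          ← intervalIntegral.integral_of_le (by linarith [Real.pi_pos])]
        have hper : Function.Periodic (fun θ => ρ * f (ρ • dir θ)) (2 * Real.pi) := fun θ => by
          change ρ * f (ρ • dir (θ + 2 * Real.pi)) = _
          rw [dir_periodic θ]
        have := hper.intervalIntegral_add_eq (-Real.pi) 0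
        rw [show -Real.pi + 2 * Real.pi = Real.pi by ring, zero_add] at this
        exact this

/-! ### The gradient of the disk average -/

/-- The derivative of the disk average at `q.1` in the direction `q.2`, as a circle integral. -/
noncomputable def slope (ψ : Plane → ℝ) (r : ℝ) (q : Plane × Plane) : ℝ :=
  (1 / (Real.pi * r)) *
    ∫ s in (0:ℝ)..(2 * Real.pi), ψ (q.1 + r • dir s) * inner ℝ (dir s) q.2

section DiskAverage

variable {ψ : Plane → ℝ} {r : ℝ}

lemma contDiff_slope (hψ : ContDiff ℝ 1 ψ) : ContDiff ℝ 1 (slope ψ r) := by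
  refine contDiff_const.mul (contDiff_parametric_integral
    (f := fun z : (Plane × Plane) × ℝ => ψ (z.1.1 + r • dir z.2) * inner ℝ (dir z.2) z.1.2) ?_ _ _)
  have h : ContDiff ℝ 1 dir := contDiff_dir
  exact ContDiff.mul (by fun_prop) (ContDiff.inner ℝ (by fun_prop) (by fun_prop))

lemma diskAverage_eq (hψ : Continuous ψ) (p : Plane) :
    diskAverage ψ r p = (1 / Real.pi) *
      ∫ ρ in (0:ℝ)..1, ∫ θ in (0:ℝ)..(2 * Real.pi), ρ * ψ (p + r • (ρ • dir θ)) := by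
  rw [diskAverage, setIntegral_unit_disk (by fun_prop)]

/-- The divergence theorem on the disk of radius `ρ`, differentiated in `ρ`: the flux density of
`ψ` through the circle is the integral of a total derivative away from the integral of the
directional derivative of `ψ`. -/
lemma integral_fderiv_circle (hψ : ContDiff ℝ 1 ψ) (p u : Plane) (ρ : ℝ) :
    ∫ θ in (0:ℝ)..(2 * Real.pi), r * (ρ * fderiv ℝ ψ (p + r • (ρ • dir θ)) u) =
      ∫ θ in (0:ℝ)..(2 * Real.pi),
        (ψ (p + r • (ρ • dir θ)) + ρ * (r * fderiv ℝ ψ (p + r • (ρ • dir θ)) (dir θ)))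
          * inner ℝ (dir θ) u := by
  have hdc : Continuous dir := (contDiff_dir (n := 0)).continuous
  have hrc : Continuous rot := rotL.continuous
  have hψc := hψ.continuous
  have hfc : Continuous (fderiv ℝ ψ) := hψ.continuous_fderiv (by norm_num)
  have hd : ∀ θ, HasDerivAt (fun θ => ψ (p + r • (ρ • dir θ)) * inner ℝ (rot (dir θ)) u)
      (fderiv ℝ ψ (p + r • (ρ • dir θ)) (r • (ρ • rot (dir θ))) * inner ℝ (rot (dir θ)) u
        + ψ (p + r • (ρ • dir θ)) * inner ℝ (-dir θ) u) θ := by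
    intro θ
    have h1 : HasDerivAt (fun θ => p + r • (ρ • dir θ)) (r • (ρ • rot (dir θ))) θ :=
      (((hasDerivAt_dir θ).const_smul ρ).const_smul r).const_add p
    have h2 := ((hψ.differentiable one_ne_zero) (p + r • (ρ • dir θ))).hasFDerivAt.comp_hasDerivAt
      θ h1
    have h3 : HasDerivAt (fun θ => rot (dir θ)) (-dir θ) θ := by
      have := rotL.hasFDerivAt.comp_hasDerivAt θ (hasDerivAt_dir θ)
      simpa [rot_rot, Function.comp_def] using this
    have h4 : HasDerivAt (fun θ => inner ℝ (rot (dir θ)) u) (inner ℝ (-dir θ) u) θ := by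
      simpa using h3.inner ℝ (hasDerivAt_const θ u)
    exact h2.mul h4
  have hint := intervalIntegral.integral_eq_sub_of_hasDerivAt (a := 0) (b := 2 * Real.pi)
    (fun θ _ => hd θ) (Continuous.intervalIntegrable (by fun_prop) _ _)
  have hper : dir (2 * Real.pi) = dir 0 := by simpa using dir_periodic 0
  rw [hper, sub_self] at hint
  have hsub := intervalIntegral.integral_sub (μ := volume) (a := 0) (b := 2 * Real.pi)
    (f := fun θ => r * (ρ * fderiv ℝ ψ (p + r • (ρ • dir θ)) u))
    (g := fun θ => (ψ (p + r • (ρ • dir θ)) + ρ * (r * fderiv ℝ ψ (p + r • (ρ • dir θ)) (dir θ)))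
          * inner ℝ (dir θ) u)
    (Continuous.intervalIntegrable (by fun_prop) _ _)
    (Continuous.intervalIntegrable (by fun_prop) _ _)
  rw [← sub_eq_zero, ← hsub]
  refine (intervalIntegral.integral_congr fun θ _ => ?_).trans hint
  have hu : fderiv ℝ ψ (p + r • (ρ • dir θ)) u =
      inner ℝ (dir θ) u * fderiv ℝ ψ (p + r • (ρ • dir θ)) (dir θ) +
      inner ℝ (rot (dir θ)) u * fderiv ℝ ψ (p + r • (ρ • dir θ)) (rot (dir θ)) := by
    conv_lhs => rw [eq_inner_smul_dir_add θ u]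
    simp only [map_add, map_smul, smul_eq_mul]
  simp only [hu, map_smul, smul_eq_mul, inner_neg_left]
  ring

lemma contDiff_diskAverage (hψ : ContDiff ℝ 1 ψ) : ContDiff ℝ 1 (diskAverage ψ r) := by
  have h1 : ContDiff ℝ 1 fun z : (Plane × ℝ) × ℝ => z.1.2 * ψ (z.1.1 + r • (z.1.2 • dir z.2)) := by
    have hdir : ContDiff ℝ 1 dir := contDiff_dir
    fun_prop
  have := contDiff_const (c := 1 / Real.pi).mul (contDiff_parametric_integral
    (contDiff_parametric_integral h1 0 (2 * Real.pi)) 0 1)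
  rwa [← show diskAverage ψ r = _ from funext fun p => diskAverage_eq hψ.continuous p] at this

/-- The derivative of a disk average is an integral over the boundary circle: integrate
`integral_fderiv_circle` over the radii. -/
lemma fderiv_diskAverage (hψ : ContDiff ℝ 1 ψ) (hr : 0 < r) (p u : Plane) :
    fderiv ℝ (diskAverage ψ r) p u = slope ψ r (p, u) := by
  have hdir : ContDiff ℝ 1 dir := contDiff_dir
  have h1 : ContDiff ℝ 1 fun z : (Plane × ℝ) × ℝ => z.1.2 * ψ (z.1.1 + r • (z.1.2 • dir z.2)) := by
    fun_prop
  have h2 := contDiff_parametric_integral h1 0 (2 * Real.pi)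
  have hfun : diskAverage ψ r = fun p => (1 / Real.pi) *
      ∫ ρ in (0:ℝ)..1, ∫ θ in (0:ℝ)..(2 * Real.pi), ρ * ψ (p + r • (ρ • dir θ)) :=
    funext fun p => diskAverage_eq hψ.continuous p
  have hdiff := (hasFDerivAt_parametric_integral h2 0 1 p).differentiableAt
  -- Joint derivatives are evaluated along lines.
  have hz : ∀ ρ θ, fderiv ℝ (fun z : (Plane × ℝ) × ℝ => z.1.2 * ψ (z.1.1 + r • (z.1.2 • dir z.2)))
      ((p, ρ), θ) ((u, 0), 0) = ρ * fderiv ℝ ψ (p + r • (ρ • dir θ)) u := by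
    intro ρ θ
    have hc : HasDerivAt (fun τ : ℝ => (((p + τ • u, ρ), θ) : (Plane × ℝ) × ℝ)) ((u, 0), 0) 0 := by
      have := ((hasDerivAt_id (0:ℝ)).smul_const u).const_add p
      simp only [id, one_smul] at this
      exact (this.prodMk (hasDerivAt_const _ _)).prodMk (hasDerivAt_const _ _)
    have ha := ((h1.differentiable one_ne_zero) ((p, ρ), θ)).hasFDerivAt.comp_hasDerivAt_of_eq 0 hc
      (by simp)
    have hc' : HasDerivAt (fun τ : ℝ => p + τ • u + r • (ρ • dir θ)) u 0 := by
      have := (((hasDerivAt_id (0:ℝ)).smul_const u).const_add p).add_const (r • (ρ • dir θ))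
      simpa using this
    have hb := (((hψ.differentiable one_ne_zero)
      (p + r • (ρ • dir θ))).hasFDerivAt.comp_hasDerivAt_of_eq 0 hc' (by simp)).const_mul ρ
    exact ha.unique hb
  -- The flux of `ψ` in the direction `u` through the circle of radius `ρ`, as a function of `ρ`.
  have hA1 : ContDiff ℝ 1 fun z : ℝ × ℝ =>
      z.1 * ψ (p + r • (z.1 • dir z.2)) * inner ℝ (dir z.2) u :=
    ContDiff.mul (by fun_prop) (ContDiff.inner ℝ (by fun_prop) (by fun_prop))
  have hA := contDiff_parametric_integral hA1 0 (2 * Real.pi)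
  have hAd : ∀ ρ : ℝ, HasDerivAt (fun ρ : ℝ => ∫ θ in (0:ℝ)..(2 * Real.pi),
      ρ * ψ (p + r • (ρ • dir θ)) * inner ℝ (dir θ) u)
      (∫ θ in (0:ℝ)..(2 * Real.pi), r * (ρ * fderiv ℝ ψ (p + r • (ρ • dir θ)) u)) ρ := by
    intro ρ
    have h3 := ((hA.differentiable one_ne_zero) ρ).hasFDerivAt.hasDerivAt
    rw [fderiv_parametric_integral_apply hA1] at h3
    convert! h3 using 1
    rw [integral_fderiv_circle hψ]
    refine intervalIntegral.integral_congr fun θ _ => ?_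
    have hc : HasDerivAt (fun τ : ℝ => ((τ, θ) : ℝ × ℝ)) (1, 0) ρ :=
      (hasDerivAt_id ρ).prodMk (hasDerivAt_const _ _)
    have ha := ((hA1.differentiable one_ne_zero) (ρ, θ)).hasFDerivAt.comp_hasDerivAt ρ hc
    have hc' : HasDerivAt (fun τ : ℝ => p + r • (τ • dir θ)) (r • dir θ) ρ := by
      have := (((hasDerivAt_id ρ).smul_const (dir θ)).const_smul r).const_add p
      simpa using this
    have hb := (((hasDerivAt_id ρ).mul (((hψ.differentiable one_ne_zero)
      (p + r • (ρ • dir θ))).hasFDerivAt.comp_hasDerivAt ρ hc')).mul_const (inner ℝ (dir θ) u))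
    refine Eq.trans ?_ (ha.unique hb).symm
    simp
  have hfin := intervalIntegral.integral_eq_sub_of_hasDerivAt (a := 0) (b := 1)
    (fun ρ _ => hAd ρ) (by
      refine (intervalIntegral.continuous_parametric_intervalIntegral_of_continuous' ?_
        _ _).intervalIntegrable _ _
      have hdc : Continuous dir := hdir.continuous
      have hfc : Continuous (fderiv ℝ ψ) := hψ.continuous_fderiv (by norm_num)
      simp only [Function.uncurry_def]
      fun_prop)
  simp only [zero_mul, one_mul, one_smul, intervalIntegral.integral_zero, sub_zero] at hfin
  have hL : fderiv ℝ (diskAverage ψ r) p u = (1 / Real.pi) * ∫ ρ in (0:ℝ)..1,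
      ∫ θ in (0:ℝ)..(2 * Real.pi), ρ * fderiv ℝ ψ (p + r • (ρ • dir θ)) u := by
    rw [hfun, fderiv_const_mul hdiff, smul_apply, smul_eq_mul,
      fderiv_parametric_integral_apply h2]
    congr 1
    refine intervalIntegral.integral_congr fun ρ _ => ?_
    simp only
    rw [fderiv_parametric_integral_apply h1]
    exact intervalIntegral.integral_congr fun θ _ => hz ρ θ
  simp only [intervalIntegral.integral_const_mul] at hfin hL ⊢
  rw [hL, slope, ← hfin]
  field_simp

lemma slope_eq_inner (hψ : ContDiff ℝ 1 ψ) (hr : 0 < r) (p u : Plane) :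
    slope ψ r (p, u) = inner ℝ (gradient (diskAverage ψ r) p) u := by
  rw [← fderiv_diskAverage hψ hr, gradient, InnerProductSpace.toDual_symm_apply]

lemma continuous_gradient_diskAverage (hψ : ContDiff ℝ 1 ψ) :
    Continuous (gradient (diskAverage ψ r)) :=
  (InnerProductSpace.toDual ℝ Plane).symm.continuous.comp
    ((contDiff_diskAverage hψ).continuous_fderiv (by norm_num))

/-! ### Averaging over rotations -/

/-- The average of `f (p, ·)` over the rotations of `o`. -/
noncomputable def turnMean (f : Plane × Plane → ℝ) (q : Plane × Plane) : ℝ :=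
  (1 / (2 * Real.pi)) * ∫ s in (0:ℝ)..(2 * Real.pi), f (q.1, turn s q.2)

/-- A primitive along rotations of `f - turnMean f`; the weight `s` yields a function that is
single-valued on the circle. -/
noncomputable def turnPrimitive (f : Plane × Plane → ℝ) (q : Plane × Plane) : ℝ :=
  (1 / (2 * Real.pi)) * ∫ s in (0:ℝ)..(2 * Real.pi), s * f (q.1, turn s q.2)

variable {f : Plane × Plane → ℝ}

lemma contDiff_turnPrimitive_integrand (hf : ContDiff ℝ 1 f) :
    ContDiff ℝ 1 fun z : (Plane × Plane) × ℝ => z.2 * f (z.1.1, turn z.2 z.1.2) := by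
  have h : ContDiff ℝ 1 fun z : (Plane × Plane) × ℝ => turn z.2 z.1.2 :=
    contDiff_turn contDiff_snd contDiff_fst.snd
  fun_prop

lemma contDiff_turnPrimitive (hf : ContDiff ℝ 1 f) : ContDiff ℝ 1 (turnPrimitive f) :=
  contDiff_const.mul (contDiff_parametric_integral (contDiff_turnPrimitive_integrand hf) _ _)

/-- Integration by parts; the boundary term at the full turn is `f` itself. -/
lemma fderiv_turnPrimitive_rot (hf : ContDiff ℝ 1 f) (p o : Plane) :
    fderiv ℝ (turnPrimitive f) (p, o) (0, rot o) = f (p, o) - turnMean f (p, o) := by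
  have h1 := contDiff_turnPrimitive_integrand hf
  have hdiff := (hasFDerivAt_parametric_integral h1 0 (2 * Real.pi) (p, o)).differentiableAt
  have htc : Continuous fun q : ℝ × Plane => turn q.1 q.2 :=
    (contDiff_turn (n := 0) contDiff_fst contDiff_snd).continuous
  have hfc := hf.continuous
  have hfdc : Continuous (fderiv ℝ f) := hf.continuous_fderiv (by norm_num)
  have hz : ∀ s, fderiv ℝ (fun z : (Plane × Plane) × ℝ => z.2 * f (z.1.1, turn z.2 z.1.2))
      ((p, o), s) ((0, rot o), 0) = s * fderiv ℝ f (p, turn s o) (0, turn s (rot o)) := by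
    intro s
    have hc : HasDerivAt (fun τ : ℝ => (((p, o + τ • rot o), s) : (Plane × Plane) × ℝ))
        ((0, rot o), 0) 0 := by
      have := ((hasDerivAt_id (0:ℝ)).smul_const (rot o)).const_add o
      simp only [id, one_smul] at this
      exact ((hasDerivAt_const _ _).prodMk this).prodMk (hasDerivAt_const _ _)
    have ha := ((h1.differentiable one_ne_zero) ((p, o), s)).hasFDerivAt.comp_hasDerivAt_of_eq 0 hc
      (by simp)
    have hc' : HasDerivAt (fun τ : ℝ => ((p, turn s (o + τ • rot o)) : Plane × Plane))
        (0, turn s (rot o)) 0 := by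
      have := ((hasDerivAt_id (0:ℝ)).smul_const (turn s (rot o))).const_add (turn s o)
      simp only [id, one_smul] at this
      simp only [turn_add, turn_smul]
      exact (hasDerivAt_const _ _).prodMk this
    have hb := (((hf.differentiable one_ne_zero) (p, turn s o)).hasFDerivAt.comp_hasDerivAt_of_eq
      0 hc' (by simp)).const_mul s
    exact ha.unique hb
  have hd : ∀ s, HasDerivAt (fun s => f (p, turn s o))
      (fderiv ℝ f (p, turn s o) (0, turn s (rot o))) s := fun s =>
    ((hf.differentiable one_ne_zero) (p, turn s o)).hasFDerivAt.comp_hasDerivAt s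
      ((hasDerivAt_const s p).prodMk (hasDerivAt_turn s o))
  have hparts := intervalIntegral.integral_mul_deriv_eq_deriv_mul (a := 0) (b := 2 * Real.pi)
    (fun s _ => hasDerivAt_id s) (fun s _ => hd s) intervalIntegrable_const
    (Continuous.intervalIntegrable (by fun_prop) _ _)
  simp only [id, turn_two_pi, zero_mul, sub_zero, one_mul] at hparts
  unfold turnPrimitive turnMean
  rw [fderiv_const_mul hdiff, smul_apply, smul_eq_mul,
    fderiv_parametric_integral_apply h1, intervalIntegral.integral_congr fun s _ => hz s, hparts]
  have := Real.pi_pos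
  field_simp

/-- The mean of the sensed signal times the slope in the direction of motion is the squared
gradient of the averaged signal. -/
lemma turnMean_mul_slope (hψ : ContDiff ℝ 1 ψ) (hr : 0 < r) (p : Plane) {o : Plane}
    (ho : ‖o‖ = 1) :
    turnMean (fun q => ψ (q.1 + r • q.2) * slope ψ r q) (p, o) =
      r / 2 * ‖gradient (diskAverage ψ r) p‖ ^ 2 := by
  obtain ⟨θ, rfl⟩ := exists_dir_eq ho
  set v := gradient (diskAverage ψ r) p with hv
  have h1 : slope ψ r (p, v) = ‖v‖ ^ 2 := by
    rw [slope_eq_inner hψ hr, ← hv, real_inner_self_eq_norm_sq]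
  rw [← h1, slope, turnMean]
  simp only [turn_dir, slope_eq_inner hψ hr, ← hv]
  rw [intervalIntegral.integral_comp_add_right
    (fun s => ψ (p + r • dir s) * inner ℝ v (dir s)) θ]
  have hper : Function.Periodic (fun s => ψ (p + r • dir s) * inner ℝ v (dir s)) (2 * Real.pi) :=
    fun s => by simp only [dir_periodic s]
  have := hper.intervalIntegral_add_eq θ 0
  rw [zero_add] at this
  rw [zero_add, add_comm (2 * Real.pi), this]
  simp only [real_inner_comm v]
  field_simp

end DiskAverage

/-! ### Absolutely continuous functions -/

lemma eq_add_integral_of_hasDerivWithinAt {F : Type*} [NormedAddCommGroup F] [NormedSpace ℝ F]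
    [CompleteSpace F] {u f : ℝ → F} {a b : ℝ}
    (hd : ∀ t ∈ Set.Icc a b, HasDerivWithinAt u (f t) (Set.Icc a b) t)
    (hf : ContinuousOn f (Set.Icc a b)) : ∀ t ∈ Set.Icc a b, u t = u a + ∫ τ in a..t, f τ := by
  intro t ht
  have hsub : Set.Icc a t ⊆ Set.Icc a b := Set.Icc_subset_Icc_right ht.2
  have := intervalIntegral.integral_eq_sub_of_hasDeriv_right_of_le ht.1
    (f := u) (f' := f) (fun s hs => ((hd s (hsub hs)).continuousWithinAt).mono hsub)
    (fun s hs => ((hd s ⟨hs.1.le, hs.2.le.trans ht.2⟩).hasDerivAt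
      (Icc_mem_nhds hs.1 (hs.2.trans_le ht.2))).hasDerivWithinAt)
    (by
      have h := hf.mono hsub
      rw [← Set.uIcc_of_le ht.1] at h
      exact h.intervalIntegrable)
  rw [this]; abel

lemma hasDerivWithinAt_of_eq_integral {F : Type*} [NormedAddCommGroup F] [NormedSpace ℝ F]
    [CompleteSpace F] {u f : ℝ → F} {u₀ : F} {a b t₀ : ℝ} (ht₀ : t₀ ∈ Set.Icc a b)
    (hf : ContinuousOn f (Set.Icc a b))
    (hu : ∀ t ∈ Set.Icc a b, u t = u₀ + ∫ τ in t₀..t, f τ) :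
    ∀ t ∈ Set.Icc a b, HasDerivWithinAt u (f t) (Set.Icc a b) t := by
  intro t ht
  have hab : a ≤ b := ht₀.1.trans ht₀.2
  set g : ℝ → F := fun s => f (Set.projIcc a b hab s) with hg
  have hgc : Continuous g :=
    (continuousOn_iff_continuous_domRestrict.1 hf).comp continuous_projIcc
  have hgf : ∀ s ∈ Set.Icc a b, g s = f s := fun s hs => by
    simp only [hg, Set.projIcc_of_mem hab hs]
  have hd : HasDerivAt (fun t => u₀ + ∫ τ in t₀..t, g τ) (g t) t :=
    (intervalIntegral.integral_hasDerivAt_right (hgc.intervalIntegrable _ _)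
      (hgc.stronglyMeasurableAtFilter _ _) hgc.continuousAt).const_add u₀
  rw [← hgf t ht]
  refine hd.hasDerivWithinAt.congr_of_mem (fun s hs => ?_) ht
  rw [hu s hs]
  congr 1
  refine intervalIntegral.integral_congr fun τ hτ => ?_
  exact (hgf τ (Set.ordConnected_Icc.uIcc_subset ht₀ hs hτ)).symm

/-- `u` is on `[a, b]` a primitive of the integrable function `f`; in other words, `u` is absolutely
continuous with almost everywhere derivative `f`. -/
structure IsPrimitiveOn (u f : ℝ → ℝ) (a b : ℝ) : Prop where
  le : a ≤ b
  integrable : IntervalIntegrable f volume a b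
  eq : ∀ t ∈ Set.Icc a b, u t = u a + ∫ τ in a..t, f τ

namespace IsPrimitiveOn

variable {u f v g : ℝ → ℝ} {a b : ℝ}

lemma integrable_sub (h : IsPrimitiveOn u f a b) {c d : ℝ} (hc : c ∈ Set.Icc a b)
    (hd : d ∈ Set.Icc a b) : IntervalIntegrable f volume c d :=
  h.integrable.mono_set (by
    rw [Set.uIcc_of_le h.le]
    exact Set.ordConnected_Icc.uIcc_subset hc hd)

lemma sub_eq (h : IsPrimitiveOn u f a b) {c d : ℝ} (hc : c ∈ Set.Icc a b)
    (hd : d ∈ Set.Icc a b) : u d - u c = ∫ τ in c..d, f τ := by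
  have ha : a ∈ Set.Icc a b := ⟨le_rfl, h.le⟩
  rw [h.eq d hd, h.eq c hc, ← intervalIntegral.integral_interval_sub_left
    (h.integrable_sub ha hd) (h.integrable_sub ha hc)]
  ring

lemma mono (h : IsPrimitiveOn u f a b) {c d : ℝ} (hc : c ∈ Set.Icc a b)
    (hd : d ∈ Set.Icc a b) (hcd : c ≤ d) : IsPrimitiveOn u f c d where
  le := hcd
  integrable := h.integrable_sub hc hd
  eq t ht := by rw [← h.sub_eq hc ⟨hc.1.trans ht.1, ht.2.trans hd.2⟩]; ring

lemma continuousOn (h : IsPrimitiveOn u f a b) : ContinuousOn u (Set.Icc a b) := by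
  have := intervalIntegral.continuousOn_primitive_interval' h.integrable Set.left_mem_uIcc
  rw [Set.uIcc_of_le h.le] at this
  exact (continuousOn_const.add this).congr h.eq

lemma add (hu : IsPrimitiveOn u f a b) (hv : IsPrimitiveOn v g a b) :
    IsPrimitiveOn (fun t => u t + v t) (fun t => f t + g t) a b where
  le := hu.le
  integrable := hu.integrable.add hv.integrable
  eq t ht := by
    have ha : a ∈ Set.Icc a b := ⟨le_rfl, hu.le⟩
    rw [intervalIntegral.integral_add (hu.integrable_sub ha ht) (hv.integrable_sub ha ht),
      hu.eq t ht, hv.eq t ht]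
    ring

lemma add_const (h : IsPrimitiveOn u f a b) (k : ℝ) :
    IsPrimitiveOn (fun t => u t + k) f a b where
  le := h.le
  integrable := h.integrable
  eq t ht := by rw [h.eq t ht]; ring

lemma const_mul (hu : IsPrimitiveOn u f a b) (c : ℝ) :
    IsPrimitiveOn (fun t => c * u t) (fun t => c * f t) a b where
  le := hu.le
  integrable := hu.integrable.const_mul c
  eq t ht := by rw [intervalIntegral.integral_const_mul, hu.eq t ht, mul_add]

lemma congr (hu : IsPrimitiveOn u f a b) (h : ∀ t, f t = g t) : IsPrimitiveOn u g a b := by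
  rwa [← funext h]

/-- The product rule for absolutely continuous functions. -/
lemma mul (hu : IsPrimitiveOn u f a b) (hv : IsPrimitiveOn v g a b) :
    IsPrimitiveOn (fun t => u t * v t) (fun t => f t * v t + u t * g t) a b where
  le := hu.le
  integrable := by
    have h1 := hu.continuousOn
    have h2 := hv.continuousOn
    rw [← Set.uIcc_of_le hu.le] at h1 h2
    exact (hu.integrable.mul_continuousOn h2).add (hv.integrable.continuousOn_mul h1)
  eq t ht := by
    have ha : a ∈ Set.Icc a b := ⟨le_rfl, hu.le⟩
    have hfi := hu.integrable_sub ha ht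
    have hgi := hv.integrable_sub ha ht
    have hU := (hfi.absolutelyContinuousOnInterval_intervalIntegral (c := a)
      Set.left_mem_uIcc)
    have hV := (hgi.absolutelyContinuousOnInterval_intervalIntegral (c := a)
      Set.left_mem_uIcc)
    have hc : ∀ c : ℝ, AbsolutelyContinuousOnInterval (fun _ => c) a t := fun c =>
      (contDiff_const.contDiffOn : ContDiffOn ℝ 1 (fun _ : ℝ => c) _).absolutelyContinuousOnInterval
    have key := AbsolutelyContinuousOnInterval.integral_deriv_mul_eq_sub
      ((hc (u a)).fun_add hU) ((hc (v a)).fun_add hV)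
    simp only [intervalIntegral.integral_same, add_zero] at key
    rw [← hu.eq t ht, ← hv.eq t ht] at key
    rw [← sub_eq_iff_eq_add', ← key]
    refine intervalIntegral.integral_congr_ae ?_
    filter_upwards [hfi.ae_hasDerivAt_integral, hgi.ae_hasDerivAt_integral] with x h1 h2 hx
    have hx' : x ∈ Set.uIcc a t := Set.uIoc_subset_uIcc hx
    have hxI : x ∈ Set.Icc a b := by
      rw [Set.uIcc_of_le ht.1] at hx'
      exact ⟨hx'.1, hx'.2.trans ht.2⟩
    rw [((h1 hx' a Set.left_mem_uIcc).const_add (u a)).deriv,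
      ((h2 hx' a Set.left_mem_uIcc).const_add (v a)).deriv, ← hu.eq x hxI, ← hv.eq x hxI]

lemma of_hasDerivWithinAt (hab : a ≤ b)
    (hd : ∀ t ∈ Set.Icc a b, HasDerivWithinAt u (f t) (Set.Icc a b) t)
    (hf : ContinuousOn f (Set.Icc a b)) : IsPrimitiveOn u f a b where
  le := hab
  integrable := by rw [← Set.uIcc_of_le hab] at hf; exact hf.intervalIntegrable
  eq := eq_add_integral_of_hasDerivWithinAt hd hf

lemma of_hasDerivAt (hab : a ≤ b) (hd : ∀ t, HasDerivAt u (f t) t) (hf : Continuous f) :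
    IsPrimitiveOn u f a b :=
  of_hasDerivWithinAt hab (fun t _ => (hd t).hasDerivWithinAt) hf.continuousOn

lemma sub_le_integral (h : IsPrimitiveOn u f a b) {φ : ℝ → ℝ}
    (hφ : ContinuousOn φ (Set.Icc a b)) (hle : ∀ᵐ τ, τ ∈ Set.Icc a b → f τ ≤ φ τ) :
    u b - u a ≤ ∫ τ in a..b, φ τ := by
  rw [h.sub_eq ⟨le_rfl, h.le⟩ ⟨h.le, le_rfl⟩]
  refine intervalIntegral.integral_mono_ae_restrict h.le h.integrable ?_
    ((ae_restrict_iff' measurableSet_Icc).2 hle)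
  rw [← Set.uIcc_of_le h.le] at hφ
  exact hφ.intervalIntegrable

/-- Variation of constants for `u' = -A u + f` with `f` bounded above. -/
lemma le_exp_mul_add {A M : ℝ} (hA : 0 < A) (h : IsPrimitiveOn u (fun t => -A * u t + f t) a b)
    (hM : ∀ᵐ τ, τ ∈ Set.Icc a b → f τ ≤ M) :
    u b ≤ u a * Real.exp (-(A * (b - a))) + M / A * (1 - Real.exp (-(A * (b - a)))) := by
  have hE : ∀ t, HasDerivAt (fun t => Real.exp (A * (t - a))) (A * Real.exp (A * (t - a))) t :=
    fun t => by
      have := (((hasDerivAt_id t).sub_const a).const_mul A).exp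
      simpa [mul_comm] using this
  have hEc : Continuous fun t => Real.exp (A * (t - a)) := by fun_prop
  have h1 := h.mul (of_hasDerivAt h.le hE (by fun_prop))
  have h2 : u b * Real.exp (A * (b - a)) - u a * Real.exp (A * (a - a)) ≤
      ∫ τ in a..b, M / A * (A * Real.exp (A * (τ - a))) := by
    refine h1.sub_le_integral (by fun_prop) ?_
    filter_upwards [hM] with τ hτ hτI
    have := hτ hτI
    have hp := Real.exp_pos (A * (τ - a))
    have e1 : M / A * (A * Real.exp (A * (τ - a))) = M * Real.exp (A * (τ - a)) := by
      field_simp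
    rw [e1]
    nlinarith
  rw [intervalIntegral.integral_const_mul, intervalIntegral.integral_eq_sub_of_hasDerivAt
    (fun t _ => hE t) (Continuous.intervalIntegrable (by fun_prop) _ _)] at h2
  simp only [sub_self, mul_zero, Real.exp_zero, mul_one] at h2
  have hp := Real.exp_pos (A * (b - a))
  have hinv : Real.exp (-(A * (b - a))) * Real.exp (A * (b - a)) = 1 := by
    rw [← Real.exp_add]; simp
  rw [← mul_le_mul_iff_of_pos_right hp]
  linear_combination h2 + (M / A - u a) * hinv

lemma abs_le_exp_mul_add {A M : ℝ} (hA : 0 < A)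
    (h : IsPrimitiveOn u (fun t => -A * u t + f t) a b)
    (hM : ∀ᵐ τ, τ ∈ Set.Icc a b → |f τ| ≤ M) :
    |u b| ≤ |u a| * Real.exp (-(A * (b - a))) + M / A * (1 - Real.exp (-(A * (b - a)))) := by
  have hp := Real.exp_pos (-(A * (b - a)))
  have h1 := h.le_exp_mul_add hA (M := M) (by
    filter_upwards [hM] with τ hτ hI using (le_abs_self _).trans (hτ hI))
  have h2 := ((h.const_mul (-1)).congr (g := fun t => -A * (-1 * u t) + -f t)
    (fun t => by ring)).le_exp_mul_add hA (M := M) (by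
    filter_upwards [hM] with τ hτ hI using (neg_le_abs _).trans (hτ hI))
  rw [abs_le']
  constructor
  · nlinarith [le_abs_self (u a)]
  · nlinarith [neg_abs_le (u a)]

end IsPrimitiveOn

/-! ### Essentially bounded functions -/

lemma ae_abs_le_norm (d : Lp ℝ ⊤ (volume : Measure ℝ)) : ∀ᵐ t, |d t| ≤ ‖d‖ := by
  have h1 := ae_le_eLpNormEssSup (f := d) (μ := (volume : Measure ℝ))
  filter_upwards [h1] with t ht
  have h2 : eLpNorm d ⊤ volume ≠ ⊤ := (Lp.memLp d).eLpNorm_ne_top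
  rw [← eLpNorm_exponent_top] at ht
  have := ENNReal.toReal_mono h2 ht
  rwa [Lp.norm_def, ← Real.norm_eq_abs, ← toReal_enorm]

lemma intervalIntegrable_Lp (d : Lp ℝ ⊤ (volume : Measure ℝ)) (a b : ℝ) :
    IntervalIntegrable d volume a b := by
  have h : LocallyIntegrable d volume := (Lp.memLp d).locallyIntegrable le_top
  exact (h.integrableOn_isCompact isCompact_uIcc).intervalIntegrable

/-! ### Distance to an interval -/

lemma infDist_Icc {a b x : ℝ} (hab : a ≤ b) :
    Metric.infDist x (Set.Icc a b) = max (max (a - x) (x - b)) 0 := by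
  have hne : (Set.Icc a b).Nonempty := Set.nonempty_Icc.2 hab
  apply le_antisymm
  · have hmem : max a (min b x) ∈ Set.Icc a b :=
      ⟨le_max_left _ _, max_le hab (min_le_left _ _)⟩
    refine (Metric.infDist_le_dist_of_mem hmem).trans ?_
    rw [Real.dist_eq]
    grind
  · rw [Metric.le_infDist hne]
    intro y hy
    rw [Real.dist_eq]
    obtain ⟨h1, h2⟩ := hy
    grind

/-! ### Balance equations along a solution -/

lemma Params.ωstar_pos (c : Params) : 0 < c.ωstar := div_pos c.τ_pos c.κ_pos

/-- The right-hand side of the equation of the translational velocity. -/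
noncomputable def vRate (c : Params) (ψ : Plane → ℝ) (ε : ℝ) (s : State) (ds dt : ℝ) : ℝ :=
  (1 / c.m) * (-c.lam * (ψ (s.p + c.r • s.o) - s.η) - (1 / ε) * c.k * s.v - c.lam * ds + dt)

/-- The right-hand side of the equation of the filter state. -/
noncomputable def ηRate (c : Params) (ψ : Plane → ℝ) (ε : ℝ) (s : State) (ds : ℝ) : ℝ :=
  -ε * c.h * s.η + ε * c.h * ψ (s.p + c.r • s.o) + ε * c.h * ds

/-- The sensed signal times the slope of the averaged signal in the direction of motion. -/
noncomputable def signalSlope (ψ : Plane → ℝ) (r : ℝ) (q : Plane × Plane) : ℝ :=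
  ψ (q.1 + r • q.2) * slope ψ r q

/-- The slope of the averaged signal in the direction perpendicular to the motion. -/
noncomputable def slopeRot (ψ : Plane → ℝ) (r : ℝ) (q : Plane × Plane) : ℝ :=
  slope ψ r (q.1, rot q.2)

/-- The derivative of `g` for a motion of unit speed with fixed orientation. -/
noncomputable def drift (g : Plane × Plane → ℝ) (q : Plane × Plane) : ℝ :=
  fderiv ℝ g q (q.2, 0)

/-- The averaged signal with the correctors of first order in `ε` for the fast translational
velocity and for the fast rotation. -/
noncomputable def energy (c : Params) (ψ : Plane → ℝ) (ε : ℝ) (s : State) : ℝ :=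
  diskAverage ψ c.r s.p + ε * c.m / c.k * (s.v * slope ψ c.r (s.p, s.o)) +
    ε * c.lam / (c.k * c.ωstar) *
      (turnPrimitive (signalSlope ψ c.r) (s.p, s.o) + s.η * slopeRot ψ c.r (s.p, s.o))

/-- The part of the rate of the corrected averaged signal that is not the gradient descent. -/
noncomputable def energyError (c : Params) (ψ : Plane → ℝ) (ε : ℝ) (s : State) (ds dt : ℝ) : ℝ :=
  1 / c.k * (slope ψ c.r (s.p, s.o) * (dt - c.lam * ds)) +
    c.m / c.k * (s.v * (s.v * drift (slope ψ c.r) (s.p, s.o) + s.ω * slopeRot ψ c.r (s.p, s.o))) +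
    c.lam / (c.k * c.ωstar) *
      (s.v * drift (turnPrimitive (signalSlope ψ c.r)) (s.p, s.o) +
        s.η * (s.v * drift (slopeRot ψ c.r) (s.p, s.o)) +
        ηRate c ψ ε s ds * slopeRot ψ c.r (s.p, s.o) +
        (s.ω - c.ωstar) * (signalSlope ψ c.r (s.p, s.o) -
          c.r / 2 * ‖gradient (diskAverage ψ c.r) s.p‖ ^ 2 - s.η * slope ψ c.r (s.p, s.o)))

section Calculus

variable {ψ : Plane → ℝ} {r : ℝ}

lemma contDiff_signalSlope (hψ : ContDiff ℝ 1 ψ) : ContDiff ℝ 1 (signalSlope ψ r) := by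
  have := contDiff_slope (r := r) hψ
  unfold signalSlope
  fun_prop

lemma contDiff_slopeRot (hψ : ContDiff ℝ 1 ψ) : ContDiff ℝ 1 (slopeRot ψ r) := by
  have h : ContDiff ℝ 1 fun q : Plane × Plane => slope ψ r (q.1, rotL q.2) :=
    (contDiff_slope (r := r) hψ).comp (by fun_prop)
  exact h

lemma continuous_drift {g : Plane × Plane → ℝ} (hg : ContDiff ℝ 1 g) : Continuous (drift g) :=
  (hg.continuous_fderiv (by norm_num)).clm_apply (by fun_prop)

/-- A function that is affine in a direction has its slope as directional derivative. -/
lemma fderiv_apply_rot {g : Plane × Plane → ℝ} (hg : ContDiff ℝ 1 g) {p o : Plane} {a : ℝ}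
    (h : ∀ τ : ℝ, g (p, o + τ • rot o) = g (p, o) + τ * a) :
    fderiv ℝ g (p, o) (0, rot o) = a := by
  have hc : HasDerivAt (fun τ : ℝ => ((p, o + τ • rot o) : Plane × Plane)) (0, rot o) 0 := by
    have := ((hasDerivAt_id (0:ℝ)).smul_const (rot o)).const_add o
    simp only [id, one_smul] at this
    exact (hasDerivAt_const _ _).prodMk this
  have h1 := ((hg.differentiable one_ne_zero) (p, o)).hasFDerivAt.comp_hasDerivAt_of_eq 0 hc
    (by simp)
  have h2 : HasDerivAt (fun τ : ℝ => g (p, o) + τ * a) a 0 := by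
    simpa using ((hasDerivAt_id (0:ℝ)).mul_const a).const_add (g (p, o))
  exact h1.unique (h2.congr_of_eventuallyEq (Filter.Eventually.of_forall h))

lemma slope_add_smul (hψ : ContDiff ℝ 1 ψ) (hr : 0 < r) (p u w : Plane) (τ : ℝ) :
    slope ψ r (p, u + τ • w) = slope ψ r (p, u) + τ * slope ψ r (p, w) := by
  simp [← fderiv_diskAverage hψ hr]

lemma fderiv_slope_rot (hψ : ContDiff ℝ 1 ψ) (hr : 0 < r) (p o : Plane) :
    fderiv ℝ (slope ψ r) (p, o) (0, rot o) = slopeRot ψ r (p, o) :=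
  fderiv_apply_rot (contDiff_slope hψ) fun τ => slope_add_smul hψ hr p o (rot o) τ

lemma fderiv_slopeRot_rot (hψ : ContDiff ℝ 1 ψ) (hr : 0 < r) (p o : Plane) :
    fderiv ℝ (slopeRot ψ r) (p, o) (0, rot o) = -slope ψ r (p, o) := by
  refine fderiv_apply_rot (contDiff_slopeRot hψ) fun τ => ?_
  have h1 : rot (o + τ • rot o) = rot o + (-τ) • o := by
    rw [← rotL_apply, map_add, map_smul, rotL_apply, rotL_apply, rot_rot]
    simp
  simp only [slopeRot, h1, slope_add_smul hψ hr]
  ring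

end Calculus

section Solution

variable {c : Params} {ψ : Plane → ℝ} {ε : ℝ} {dr ds dt : ℝ → ℝ} {t₀ t₁ : ℝ} {x₀ : State}
  {I : Set ℝ} {x : ℝ → State}

lemma IsSolution.apply_start (hx : IsSolution c ψ ε dr ds dt t₀ x₀ I x) : x t₀ = x₀ := by
  have h1 := hx.eq_p t₀ hx.mem
  have h2 := hx.eq_o t₀ hx.mem
  have h3 := hx.eq_v t₀ hx.mem
  have h4 := hx.eq_ω t₀ hx.mem
  have h5 := hx.eq_η t₀ hx.mem
  simp only [intervalIntegral.integral_same, add_zero] at h1 h2 h3 h4 h5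
  cases h : x t₀
  cases x₀
  simp_all

lemma IsSolution.continuousOn_signal (hx : IsSolution c ψ ε dr ds dt t₀ x₀ I x)
    (hψ : Continuous ψ) : ContinuousOn (fun t => ψ ((x t).p + c.r • (x t).o)) I :=
  hψ.comp_continuousOn (hx.cont_p.add (hx.cont_o.const_smul c.r))

variable (hx : IsSolution c ψ ε dr ds dt t₀ x₀ I x) (h01 : t₀ ≤ t₁) (hI : Set.Icc t₀ t₁ ⊆ I)
include hx h01 hI

lemma IsSolution.isPrimitiveOn_of_eq {u f : ℝ → ℝ} {u₀ : ℝ}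
    (hf : IntervalIntegrable f volume t₀ t₁) (hu : ∀ t ∈ I, u t = u₀ + ∫ s in t₀..t, f s) :
    IsPrimitiveOn u f t₀ t₁ where
  le := h01
  integrable := hf
  eq t ht := by
    have h1 := hu t₀ hx.mem
    rw [intervalIntegral.integral_same, add_zero] at h1
    rw [h1, hu t (hI ht)]

lemma IsSolution.isPrimitiveOn_v (hψ : Continuous ψ) (hds : IntervalIntegrable ds volume t₀ t₁)
    (hdt : IntervalIntegrable dt volume t₀ t₁) :
    IsPrimitiveOn (fun t => (x t).v) (fun t => vRate c ψ ε (x t) (ds t) (dt t)) t₀ t₁ := by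
  refine hx.isPrimitiveOn_of_eq h01 hI ?_ hx.eq_v
  have h1 := (hx.continuousOn_signal hψ).mono hI
  have h2 := hx.cont_η.mono hI
  have h3 := hx.cont_v.mono hI
  rw [← Set.uIcc_of_le h01] at h1 h2 h3
  have h4 : ContinuousOn (fun t => -c.lam * (ψ ((x t).p + c.r • (x t).o) - (x t).η)
      - (1 / ε) * c.k * (x t).v) (Set.uIcc t₀ t₁) :=
    (continuousOn_const.mul (h1.sub h2)).sub (continuousOn_const.mul h3)
  exact ((h4.intervalIntegrable.sub (hds.const_mul c.lam)).add hdt).const_mul (1 / c.m)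

lemma IsSolution.isPrimitiveOn_ω (hdr : IntervalIntegrable dr volume t₀ t₁) :
    IsPrimitiveOn (fun t => (x t).ω)
      (fun t => (1 / c.J) * (-c.κ * ((x t).ω - c.ωstar) + dr t)) t₀ t₁ := by
  refine hx.isPrimitiveOn_of_eq h01 hI ?_ hx.eq_ω
  have h3 := hx.cont_ω.mono hI
  rw [← Set.uIcc_of_le h01] at h3
  have h4 : ContinuousOn (fun t => -c.κ * ((x t).ω - c.ωstar)) (Set.uIcc t₀ t₁) := by fun_prop
  exact (h4.intervalIntegrable.add hdr).const_mul (1 / c.J)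

lemma IsSolution.isPrimitiveOn_η (hψ : Continuous ψ) (hds : IntervalIntegrable ds volume t₀ t₁) :
    IsPrimitiveOn (fun t => (x t).η) (fun t => ηRate c ψ ε (x t) (ds t)) t₀ t₁ := by
  refine hx.isPrimitiveOn_of_eq h01 hI ?_ hx.eq_η
  have h1 := (hx.continuousOn_signal hψ).mono hI
  have h2 := hx.cont_η.mono hI
  rw [← Set.uIcc_of_le h01] at h1 h2
  have h4 : ContinuousOn (fun t => -ε * c.h * (x t).η + ε * c.h * ψ ((x t).p + c.r • (x t).o))
    (Set.uIcc t₀ t₁) := (continuousOn_const.mul h2).add (continuousOn_const.mul h1)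
  exact h4.intervalIntegrable.add (hds.const_mul (ε * c.h))

lemma IsSolution.hasDerivWithinAt_config :
    ∀ t ∈ Set.Icc t₀ t₁, HasDerivWithinAt (fun t => ((x t).p, (x t).o))
      ((x t).v • (x t).o, (x t).ω • rot (x t).o) (Set.Icc t₀ t₁) t := by
  have hv := hx.cont_v.mono hI
  have ho := hx.cont_o.mono hI
  have hω := hx.cont_ω.mono hI
  have hro : ContinuousOn (fun t => rot (x t).o) (Set.Icc t₀ t₁) :=
    rotL.continuous.comp_continuousOn ho
  intro t ht
  exact (hasDerivWithinAt_of_eq_integral (f := fun t => (x t).v • (x t).o) ⟨le_rfl, h01⟩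
      (hv.smul ho) (fun t ht => hx.eq_p t (hI ht)) t ht).prodMk
    (hasDerivWithinAt_of_eq_integral (f := fun t => (x t).ω • rot (x t).o) ⟨le_rfl, h01⟩
      (hω.smul hro) (fun t ht => hx.eq_o t (hI ht)) t ht)

lemma IsSolution.isPrimitiveOn_comp_config {g : Plane × Plane → ℝ} (hg : ContDiff ℝ 1 g) :
    IsPrimitiveOn (fun t => g ((x t).p, (x t).o))
      (fun t => (x t).v * drift g ((x t).p, (x t).o) +
        (x t).ω * fderiv ℝ g ((x t).p, (x t).o) (0, rot (x t).o)) t₀ t₁ := by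
  have hv := hx.cont_v.mono hI
  have hp := hx.cont_p.mono hI
  have ho := hx.cont_o.mono hI
  have hω := hx.cont_ω.mono hI
  have hro : ContinuousOn (fun t => rot (x t).o) (Set.Icc t₀ t₁) :=
    rotL.continuous.comp_continuousOn ho
  have hfd : Continuous (fderiv ℝ g) := hg.continuous_fderiv (by norm_num)
  have hdr := continuous_drift hg
  refine IsPrimitiveOn.of_hasDerivWithinAt h01 (fun t ht => ?_) ?_
  · have h1 := ((hg.differentiable one_ne_zero) ((x t).p, (x t).o)).hasFDerivAt.comp_hasDerivWithinAt
      t (hx.hasDerivWithinAt_config h01 hI t ht)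
    have h2 : (((x t).v • (x t).o, (x t).ω • rot (x t).o) : Plane × Plane) =
        (x t).v • ((x t).o, 0) + (x t).ω • (0, rot (x t).o) := by simp
    rw [h2, map_add, map_smul, map_smul] at h1
    exact h1
  · fun_prop

/-- The balance of the corrected averaged signal. The correctors are chosen such that their rates
cancel the terms of order `1` and the oscillating terms of order `ε` in the rate of the averaged
signal. -/
lemma IsSolution.isPrimitiveOn_energy (hψ : ContDiff ℝ 1 ψ) (hε : 0 < ε)
    (hds : IntervalIntegrable ds volume t₀ t₁) (hdt : IntervalIntegrable dt volume t₀ t₁) :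
    ∃ w : ℝ → ℝ, IsPrimitiveOn (fun t => energy c ψ ε (x t)) w t₀ t₁ ∧
      ∀ t ∈ Set.Icc t₀ t₁, w t =
        ε * (-(c.lam * c.r / (2 * c.k) * ‖gradient (diskAverage ψ c.r) (x t).p‖ ^ 2) +
          energyError c ψ ε (x t) (ds t) (dt t)) := by
  have hψc := hψ.continuous
  have hV := hx.isPrimitiveOn_v h01 hI hψc hds hdt
  have hH := hx.isPrimitiveOn_η h01 hI hψc hds
  have hΨ := hx.isPrimitiveOn_comp_config h01 hI (g := fun q => diskAverage ψ c.r q.1)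
    ((contDiff_diskAverage hψ).comp contDiff_fst)
  have h1 := hx.isPrimitiveOn_comp_config h01 hI (contDiff_slope (r := c.r) hψ)
  have h2 := hx.isPrimitiveOn_comp_config h01 hI
    (contDiff_turnPrimitive (contDiff_signalSlope (r := c.r) hψ))
  have h3 := hx.isPrimitiveOn_comp_config h01 hI (contDiff_slopeRot (r := c.r) hψ)
  refine ⟨_, (hΨ.add ((hV.mul h1).const_mul (ε * c.m / c.k))).add
    ((h2.add (hH.mul h3)).const_mul (ε * c.lam / (c.k * c.ωstar))), fun t ht => ?_⟩
  have ho : ‖(x t).o‖ = 1 := by simpa using hx.norm_o t (hI ht)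
  have hΨd : ∀ u : Plane × Plane, fderiv ℝ (fun q : Plane × Plane => diskAverage ψ c.r q.1)
      ((x t).p, (x t).o) u = slope ψ c.r ((x t).p, u.1) := fun u => by
    have := HasFDerivAt.comp (f := Prod.fst) ((x t).p, (x t).o)
      ((((contDiff_diskAverage (r := c.r) hψ).differentiable one_ne_zero) (x t).p).hasFDerivAt)
      hasFDerivAt_fst
    rw [show (fun q : Plane × Plane => diskAverage ψ c.r q.1) = diskAverage ψ c.r ∘ Prod.fst
      from rfl, this.fderiv, ← fderiv_diskAverage hψ c.r_pos]
    rfl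
  have hz : slope ψ c.r ((x t).p, 0) = 0 := by simp [slope]
  have hm : turnMean (signalSlope ψ c.r) ((x t).p, (x t).o) = _ :=
    turnMean_mul_slope hψ c.r_pos (x t).p ho
  rw [fderiv_slope_rot hψ c.r_pos, fderiv_slopeRot_rot hψ c.r_pos,
    fderiv_turnPrimitive_rot (contDiff_signalSlope hψ), hm]
  simp only [drift, hΨd, hz, energyError, vRate, signalSlope]
  have := c.ωstar_pos
  have := c.k_pos
  have := c.m_pos
  -- What remains is an identity of rational functions.
  generalize slopeRot ψ c.r ((x t).p, (x t).o) = g3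
  generalize slope ψ c.r ((x t).p, (x t).o) = g1
  generalize ηRate c ψ ε (x t) (ds t) = y
  generalize ψ ((x t).p + c.r • (x t).o) = s
  generalize ‖gradient (diskAverage ψ c.r) (x t).p‖ ^ 2 = n
  generalize fderiv ℝ (slope ψ c.r) ((x t).p, (x t).o) ((x t).o, 0) = b1
  generalize fderiv ℝ (slopeRot ψ c.r) ((x t).p, (x t).o) ((x t).o, 0) = b3
  generalize fderiv ℝ (turnPrimitive (signalSlope ψ c.r)) ((x t).p, (x t).o) ((x t).o, 0) = b2
  field_simp
  ring

end Solution

/-! ### Linear estimates -/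

section Linear

variable {c : Params} {ψ : Plane → ℝ} {ε : ℝ} {dr ds dt : ℝ → ℝ} {t₀ t₁ : ℝ} {x₀ : State}
  {I : Set ℝ} {x : ℝ → State} {M D : ℝ}
  (hx : IsSolution c ψ ε dr ds dt t₀ x₀ I x) (h01 : t₀ ≤ t₁) (hI : Set.Icc t₀ t₁ ⊆ I)
include hx h01 hI

lemma IsSolution.abs_η_le (hψ : Continuous ψ) (hε : 0 < ε)
    (hds : IntervalIntegrable ds volume t₀ t₁) (hD : ∀ᵐ t, |ds t| ≤ D)
    (hM : ∀ t ∈ Set.Icc t₀ t₁, |ψ ((x t).p + c.r • (x t).o)| ≤ M) {N : ℝ} (hN : |x₀.η| ≤ N)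
    (hMN : M + D ≤ N) : |(x t₁).η| ≤ N := by
  have hA : 0 < ε * c.h := mul_pos hε c.h_pos
  have h1 := ((hx.isPrimitiveOn_η h01 hI hψ hds).congr (g := fun t => -(ε * c.h) * (x t).η +
    ε * c.h * (ψ ((x t).p + c.r • (x t).o) + ds t)) fun t => by
      simp only [ηRate]; ring).abs_le_exp_mul_add hA (M := ε * c.h * N) (by
        filter_upwards [hD] with t ht htI
        rw [abs_mul, abs_of_pos hA]
        gcongr
        exact (abs_add_le _ _).trans ((add_le_add (hM t htI) ht).trans hMN))
  rw [mul_div_cancel_left₀ _ hA.ne', hx.apply_start] at h1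
  have he := Real.exp_pos (-(ε * c.h * (t₁ - t₀)))
  nlinarith

lemma IsSolution.abs_v_le (hψ : Continuous ψ) (hε : 0 < ε)
    (hds : IntervalIntegrable ds volume t₀ t₁) (hdt : IntervalIntegrable dt volume t₀ t₁) {F : ℝ}
    (hF : ∀ᵐ t, t ∈ Set.Icc t₀ t₁ →
      |-c.lam * (ψ ((x t).p + c.r • (x t).o) - (x t).η) - c.lam * ds t + dt t| ≤ F) (hF0 : 0 ≤ F) :
    |(x t₁).v| ≤ |x₀.v| * Real.exp (-((1 / ε) * (c.k / c.m) * (t₁ - t₀))) + F / c.k * ε := by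
  have hk := c.k_pos
  have hm := c.m_pos
  have hA : 0 < (1 / ε) * (c.k / c.m) := by positivity
  have h1 := ((hx.isPrimitiveOn_v h01 hI hψ hds hdt).congr
    (g := fun t => -((1 / ε) * (c.k / c.m)) * (x t).v + 1 / c.m *
      (-c.lam * (ψ ((x t).p + c.r • (x t).o) - (x t).η) - c.lam * ds t + dt t)) fun t => by
      simp only [vRate]; ring).abs_le_exp_mul_add hA (M := 1 / c.m * F) (by
        filter_upwards [hF] with t ht htI
        rw [abs_mul, abs_of_pos (by positivity : 0 < 1 / c.m)]
        gcongr
        exact ht htI)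
  rw [hx.apply_start] at h1
  have he := Real.exp_pos (-((1 / ε) * (c.k / c.m) * (t₁ - t₀)))
  refine h1.trans ?_
  have e1 : 1 / c.m * F / ((1 / ε) * (c.k / c.m)) = F / c.k * ε := by field_simp
  rw [e1]
  have : 0 ≤ F / c.k * ε := by positivity
  nlinarith

lemma IsSolution.abs_ω_sub_le (hdr : IntervalIntegrable dr volume t₀ t₁)
    (hD : ∀ᵐ t, |dr t| ≤ D) (hD0 : 0 ≤ D) :
    |(x t₁).ω - c.ωstar| ≤
      |x₀.ω - c.ωstar| * Real.exp (-((c.κ / c.J) * (t₁ - t₀))) + (1 / c.κ) * D := by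
  have hκ := c.κ_pos
  have hJ := c.J_pos
  have hA : 0 < c.κ / c.J := by positivity
  have h1 := (((hx.isPrimitiveOn_ω h01 hI hdr).add_const (-c.ωstar)).congr
    (g := fun t => -(c.κ / c.J) * ((x t).ω + -c.ωstar) + 1 / c.J * dr t) fun t => by
      ring).abs_le_exp_mul_add hA (M := 1 / c.J * D) (by
        filter_upwards [hD] with t ht _
        rw [abs_mul, abs_of_pos (by positivity : 0 < 1 / c.J)]
        gcongr)
  simp only [hx.apply_start, ← sub_eq_add_neg] at h1
  have he := Real.exp_pos (-((c.κ / c.J) * (t₁ - t₀)))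
  refine h1.trans ?_
  have e1 : 1 / c.J * D / (c.κ / c.J) = 1 / c.κ * D := by field_simp
  rw [e1]
  have : 0 ≤ 1 / c.κ * D := by positivity
  nlinarith

/-- The distance to the interval `[a, b]` is the largest of `a - η`, `η - b` and `0`, and the first
two satisfy linear equations. -/
lemma IsSolution.infDist_η_le (hψ : Continuous ψ) (hε : 0 < ε)
    (hds : IntervalIntegrable ds volume t₀ t₁) (hD : ∀ᵐ t, |ds t| ≤ D) (hD0 : 0 ≤ D) {a b ν : ℝ}
    (hab : a ≤ b) (hν : 0 ≤ ν)
    (hM : ∀ t ∈ Set.Icc t₀ t₁,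
      Metric.infDist (ψ ((x t).p + c.r • (x t).o)) (Set.Icc a b) ≤ ν) :
    Metric.infDist (x t₁).η (Set.Icc a b) ≤
      Metric.infDist x₀.η (Set.Icc a b) * Real.exp (-(ε * c.h * (t₁ - t₀))) + D + ν := by
  have hA : 0 < ε * c.h := mul_pos hε c.h_pos
  simp only [infDist_Icc hab, max_le_iff, and_assoc] at hM
  rw [infDist_Icc hab, infDist_Icc hab]
  have hη := hx.isPrimitiveOn_η h01 hI hψ hds
  have h1 := ((hη.add_const (-b)).congr (g := fun t => -(ε * c.h) * ((x t).η + -b) +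
    ε * c.h * (ψ ((x t).p + c.r • (x t).o) + ds t - b)) fun t => by
      simp only [ηRate]; ring).le_exp_mul_add hA (M := ε * c.h * (D + ν)) (by
        filter_upwards [hD] with t ht htI
        gcongr
        linarith [hM t htI, (abs_le.1 ht).2])
  have h2 := (((hη.const_mul (-1)).add_const a).congr
    (g := fun t => -(ε * c.h) * (-1 * (x t).η + a) +
    ε * c.h * (a - (ψ ((x t).p + c.r • (x t).o) + ds t))) fun t => by
      simp only [ηRate]; ring).le_exp_mul_add hA (M := ε * c.h * (D + ν)) (by
        filter_upwards [hD] with t ht htI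
        gcongr
        linarith [hM t htI, (abs_le.1 ht).1])
  rw [mul_div_cancel_left₀ _ hA.ne'] at h1 h2
  simp only [hx.apply_start] at h1 h2
  have he := Real.exp_pos (-(ε * c.h * (t₁ - t₀)))
  set E := Real.exp (-(ε * c.h * (t₁ - t₀)))
  have h3 : a - x₀.η ≤ max (max (a - x₀.η) (x₀.η - b)) 0 :=
    (le_max_left _ _).trans (le_max_left _ _)
  have h4 : x₀.η - b ≤ max (max (a - x₀.η) (x₀.η - b)) 0 :=
    (le_max_right _ _).trans (le_max_left _ _)
  have h5 : 0 ≤ max (max (a - x₀.η) (x₀.η - b)) 0 := le_max_right _ _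
  refine max_le (max_le ?_ ?_) ?_
  · nlinarith [mul_le_mul_of_nonneg_right h3 he.le]
  · nlinarith [mul_le_mul_of_nonneg_right h4 he.le]
  · positivity

end Linear

/-! ### A trapping neighbourhood of the sublevel set -/

/-- A compact neighbourhood `K` of the compact sublevel set `C` such that a path in `K` stays in an
open subset as long as `Ψ < y₀ + δ`, and such that the gradient does not vanish above the level
`ystar`. On the compact set `B` of points that are on the boundary of a closed neighbourhood or have
a vanishing gradient above the level, `Ψ` is larger than `y₀`, and therefore larger than
`y₀ + δ`. -/
lemma exists_trapping_set {Ψ : Plane → ℝ} (hΨ : ContDiff ℝ 1 Ψ) {P C : Set Plane}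
    (hP : IsOpen P) {ystar y₀ : ℝ} (hy : ystar < y₀) (hC : C = {p | p ∈ P ∧ Ψ p ≤ y₀})
    (hcompact : IsCompact C)
    (hgrad : ∀ p ∈ P, ystar < Ψ p → Ψ p ≤ y₀ → gradient Ψ p ≠ 0) :
    ∃ (K U : Set Plane) (δ : ℝ), IsCompact K ∧ K ⊆ P ∧ C ⊆ K ∧ IsOpen U ∧ U ⊆ K ∧ 0 < δ ∧
      (∀ p ∈ K, Ψ p < y₀ + δ → p ∈ U) ∧ ∀ p ∈ K, ystar < Ψ p → gradient Ψ p ≠ 0 := by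
  have hΨc := hΨ.continuous
  have hgc : Continuous (gradient Ψ) := (InnerProductSpace.toDual ℝ Plane).symm.continuous.comp
    (hΨ.continuous_fderiv (by norm_num))
  have hCP : C ⊆ P := fun p hp => by rw [hC] at hp; exact hp.1
  obtain ⟨d, hd, hdP⟩ := hcompact.exists_cthickening_subset_open hP hCP
  set K₁ := Metric.cthickening d C with hK₁
  have hK₁c : IsCompact K₁ := hcompact.cthickening
  set V := Metric.thickening d C with hV
  have hVo : IsOpen V := Metric.isOpen_thickening
  have hCV : C ⊆ V := Metric.self_subset_thickening hd C
  -- The level `(ystar + y₀) / 2` makes the condition `ystar < Ψ p` a closed one.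
  set B : Set Plane := K₁ ∩ (Vᶜ ∪ ({p | gradient Ψ p = 0} ∩ {p | (ystar + y₀) / 2 ≤ Ψ p})) with hB
  have hBc : IsCompact B := hK₁c.inter_right (hVo.isClosed_compl.union
    ((isClosed_eq hgc continuous_const).inter (isClosed_le continuous_const hΨc)))
  have hBy : ∀ p ∈ B, y₀ < Ψ p := by
    rintro p ⟨hp1, hp2⟩
    by_contra! hle
    have hpC : p ∈ C := by rw [hC]; exact ⟨hdP hp1, hle⟩
    rcases hp2 with hp2 | ⟨hp2, hp3⟩
    · exact hp2 (hCV hpC)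
    · exact hgrad p (hdP hp1) (by simp only [Set.mem_ofPred_eq] at hp3; linarith) hle hp2
  obtain ⟨δ, hδ, hBδ⟩ : ∃ δ > 0, ∀ p ∈ B, y₀ + δ < Ψ p := by
    rcases B.eq_empty_or_nonempty with hBe | hBne
    · exact ⟨1, one_pos, fun p hp => by rw [hBe] at hp; exact hp.elim⟩
    · obtain ⟨q, hq, hqm⟩ := hBc.exists_isMinOn hBne hΨc.continuousOn
      refine ⟨(Ψ q - y₀) / 2, by linarith [hBy q hq], fun p hp => ?_⟩
      have h1 : Ψ q ≤ Ψ p := hqm hp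
      linarith [hBy q hq]
  refine ⟨K₁ ∩ {p | Ψ p ≤ y₀ + δ}, V ∩ {p | Ψ p < y₀ + δ}, δ,
    hK₁c.inter_right (isClosed_le hΨc continuous_const), fun p hp => hdP hp.1, fun p hp =>
    ⟨Metric.self_subset_cthickening C hp, ?_⟩, hVo.inter (isOpen_lt hΨc continuous_const),
    fun p hp => ⟨Metric.thickening_subset_cthickening d C hp.1,
      le_of_lt (show Ψ p < y₀ + δ from hp.2)⟩, hδ, ?_, ?_⟩
  · rw [hC] at hp
    have := hp.2
    simp only [Set.mem_ofPred_eq]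
    linarith
  · intro p hp hlt
    refine ⟨?_, hlt⟩
    by_contra hpV
    exact absurd (hBδ p ⟨hp.1, Or.inl hpV⟩) (not_lt.2 hp.2)
  · intro p hp hlt h0
    rcases le_or_gt (Ψ p) y₀ with hle | hgt
    · exact hgrad p (hdP hp.1) hlt hle h0
    · exact absurd (hBδ p ⟨hp.1, Or.inr ⟨h0, by simp only [Set.mem_ofPred_eq]; linarith⟩⟩)
        (not_lt.2 hp.2)

/-! ### The signal interval -/

section Signal

variable {ψ : Plane → ℝ} {r y : ℝ} {P : Set Plane}

lemma signalValues_eq_image : signalValues ψ r P y =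
    (fun q : Plane × Plane => ψ (q.1 + r • q.2)) ''
      (sublevel ψ r P y ×ˢ Metric.sphere (0 : Plane) 1) := by
  ext a
  constructor
  · rintro ⟨p, hp, o, ho, rfl⟩
    exact ⟨(p, o), ⟨hp, ho⟩, rfl⟩
  · rintro ⟨⟨p, o⟩, ⟨hp, ho⟩, rfl⟩
    exact ⟨p, hp, o, ho, rfl⟩

lemma mem_signalInterval {p o : Plane} (hp : p ∈ sublevel ψ r P y)
    (ho : o ∈ Metric.sphere (0 : Plane) 1) : ψ (p + r • o) ∈ signalInterval ψ r P y :=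
  subset_convexHull ℝ _ ⟨p, hp, o, ho, rfl⟩

lemma exists_signalInterval_eq_Icc (hψ : Continuous ψ) (hc : IsCompact (sublevel ψ r P y))
    (hne : (signalValues ψ r P y).Nonempty) :
    ∃ a b, a ≤ b ∧ signalInterval ψ r P y = Set.Icc a b := by
  have hK : IsCompact (signalValues ψ r P y) := by
    rw [signalValues_eq_image]
    exact (hc.prod (isCompact_sphere _ _)).image (by fun_prop)
  have h1 := hK.sInf_mem hne
  have h2 := hK.sSup_mem hne
  have hle : sInf (signalValues ψ r P y) ≤ sSup (signalValues ψ r P y) := csInf_le hK.bddBelow h2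
  refine ⟨_, _, hle, Set.Subset.antisymm ?_ ?_⟩
  · exact convexHull_min (fun a ha => ⟨csInf_le hK.bddBelow ha, le_csSup hK.bddAbove ha⟩)
      (convex_Icc _ _)
  · rw [← segment_eq_Icc hle]
    exact segment_subset_convexHull h1 h2

end Signal

/-! ### Bounds on the correctors -/

lemma abs_mul_le_mul {a b A B : ℝ} (ha : |a| ≤ A) (hb : |b| ≤ B) : |a * b| ≤ A * B := by
  rw [abs_mul]
  exact mul_le_mul ha hb (abs_nonneg _) ((abs_nonneg _).trans ha)

/-- `B` bounds all functions of the configuration that occur in `energy` and `energyError`. -/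
structure ConfigBound (ψ : Plane → ℝ) (r B : ℝ) (q : Plane × Plane) : Prop where
  signal : |ψ (q.1 + r • q.2)| ≤ B
  slope : |slope ψ r q| ≤ B
  slopeRot : |slopeRot ψ r q| ≤ B
  prim : |turnPrimitive (signalSlope ψ r) q| ≤ B
  drift_slope : |drift (SourceSeeking.slope ψ r) q| ≤ B
  drift_slopeRot : |drift (SourceSeeking.slopeRot ψ r) q| ≤ B
  drift_prim : |drift (turnPrimitive (signalSlope ψ r)) q| ≤ B
  osc : |signalSlope ψ r q - r / 2 * ‖gradient (diskAverage ψ r) q.1‖ ^ 2| ≤ B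

lemma exists_configBound {ψ : Plane → ℝ} {r : ℝ} (hψ : ContDiff ℝ 1 ψ) {K : Set (Plane × Plane)}
    (hK : IsCompact K) : ∃ B, 0 ≤ B ∧ ∀ q ∈ K, ConfigBound ψ r B q := by
  have hb : ∀ f : Plane × Plane → ℝ, Continuous f → ∃ B, 0 ≤ B ∧ ∀ q ∈ K, |f q| ≤ B := by
    intro f hf
    obtain ⟨B, hB⟩ := hK.exists_bound_of_continuousOn hf.continuousOn
    exact ⟨max B 0, le_max_right _ _, fun q hq => (hB q hq).trans (le_max_left _ _)⟩
  have hs := contDiff_slope (r := r) hψ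
  have hr := contDiff_slopeRot (r := r) hψ
  have hf := contDiff_signalSlope (r := r) hψ
  have hp := contDiff_turnPrimitive hf
  have hψc := hψ.continuous
  have hgc := continuous_gradient_diskAverage (r := r) hψ
  have hfc := hf.continuous
  obtain ⟨B1, h1, k1⟩ := hb (fun q => ψ (q.1 + r • q.2)) (by fun_prop)
  obtain ⟨B2, h2, k2⟩ := hb _ hs.continuous
  obtain ⟨B3, h3, k3⟩ := hb _ hr.continuous
  obtain ⟨B4, h4, k4⟩ := hb _ hp.continuous
  obtain ⟨B5, h5, k5⟩ := hb _ (continuous_drift hs)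
  obtain ⟨B6, h6, k6⟩ := hb _ (continuous_drift hr)
  obtain ⟨B7, h7, k7⟩ := hb _ (continuous_drift hp)
  obtain ⟨B8, h8, k8⟩ := hb
    (fun q => signalSlope ψ r q - r / 2 * ‖gradient (diskAverage ψ r) q.1‖ ^ 2) (by fun_prop)
  refine ⟨B1 + B2 + B3 + B4 + B5 + B6 + B7 + B8, by positivity, fun q hq => ⟨?_, ?_, ?_, ?_, ?_, ?_,
    ?_, ?_⟩⟩
  · linarith [k1 q hq]
  · linarith [k2 q hq]
  · linarith [k3 q hq]
  · linarith [k4 q hq]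
  · linarith [k5 q hq]
  · linarith [k6 q hq]
  · linarith [k7 q hq]
  · linarith [k8 q hq]

section Correctors

variable {c : Params} {ψ : Plane → ℝ} {ε : ℝ}

lemma abs_energy_sub_le {s : State} {B V N : ℝ} (hε : 0 < ε) (hB : ConfigBound ψ c.r B (s.p, s.o))
    (hV : |s.v| ≤ V) (hN : |s.η| ≤ N) :
    |energy c ψ ε s - diskAverage ψ c.r s.p| ≤
      (c.m / c.k * (V * B) + c.lam / (c.k * c.ωstar) * (B + N * B)) * ε := by
  have hm := c.m_pos
  have hk := c.k_pos
  have hl := c.lam_pos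
  have hw := c.ωstar_pos
  have e : energy c ψ ε s - diskAverage ψ c.r s.p =
      ε * (c.m / c.k * (s.v * slope ψ c.r (s.p, s.o)) + c.lam / (c.k * c.ωstar) *
        (turnPrimitive (signalSlope ψ c.r) (s.p, s.o) + s.η * slopeRot ψ c.r (s.p, s.o))) := by
    simp only [energy]; ring
  have p1 : |c.m / c.k| ≤ c.m / c.k := (abs_of_pos (by positivity)).le
  have p2 : |c.lam / (c.k * c.ωstar)| ≤ c.lam / (c.k * c.ωstar) := (abs_of_pos (by positivity)).le
  rw [e, mul_comm _ ε]
  refine abs_mul_le_mul (abs_of_pos hε).le ((abs_add_le _ _).trans (add_le_add ?_ ?_))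
  · exact abs_mul_le_mul p1 (abs_mul_le_mul hV hB.slope)
  · exact abs_mul_le_mul p2 ((abs_add_le _ _).trans
      (add_le_add hB.prim (abs_mul_le_mul hN hB.slopeRot)))

lemma abs_energyError_le {s : State} {ds dt B V Ω N A₁ A₂ H X : ℝ}
    (hB : ConfigBound ψ c.r B (s.p, s.o)) (hV : |s.v| ≤ V) (hΩ : |s.ω| ≤ Ω) (hN : |s.η| ≤ N)
    (hH : |ηRate c ψ ε s ds| ≤ H * X) (hA₁ : |s.v| ≤ A₁ * X) (hA₂ : |s.ω - c.ωstar| ≤ A₂ * X)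
    (hds : |ds| ≤ X) (hdt : |dt| ≤ X) :
    |energyError c ψ ε s ds dt| ≤
      (1 / c.k * (B * (1 + c.lam)) + c.m / c.k * (A₁ * (V * B + Ω * B)) +
        c.lam / (c.k * c.ωstar) * (A₁ * B + N * (A₁ * B) + H * B + A₂ * (B + N * B))) * X := by
  have hm := c.m_pos
  have hk := c.k_pos
  have hl := c.lam_pos
  have hw := c.ωstar_pos
  have p1 : |c.m / c.k| ≤ c.m / c.k := (abs_of_pos (by positivity)).le
  have p2 : |c.lam / (c.k * c.ωstar)| ≤ c.lam / (c.k * c.ωstar) := (abs_of_pos (by positivity)).le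
  have p3 : |1 / c.k| ≤ 1 / c.k := (abs_of_pos (by positivity)).le
  have q1 : |slope ψ c.r (s.p, s.o) * (dt - c.lam * ds)| ≤ B * (X + c.lam * X) :=
    abs_mul_le_mul hB.slope ((abs_sub _ _).trans
      (add_le_add hdt (abs_mul_le_mul (abs_of_pos hl).le hds)))
  have q2 : |s.v * (s.v * drift (slope ψ c.r) (s.p, s.o) + s.ω * slopeRot ψ c.r (s.p, s.o))| ≤
      A₁ * X * (V * B + Ω * B) :=
    abs_mul_le_mul hA₁ ((abs_add_le _ _).trans (add_le_add (abs_mul_le_mul hV hB.drift_slope)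
      (abs_mul_le_mul hΩ hB.slopeRot)))
  have q3 := abs_mul_le_mul hA₁ hB.drift_prim
  have q4 := abs_mul_le_mul hN (abs_mul_le_mul hA₁ hB.drift_slopeRot)
  have q5 := abs_mul_le_mul hH hB.slopeRot
  have q6 := abs_mul_le_mul hA₂ ((abs_sub _ _).trans
    (add_le_add hB.osc (abs_mul_le_mul hN hB.slope)))
  unfold energyError
  refine ((abs_add_le _ _).trans (add_le_add ((abs_add_le _ _).trans
    (add_le_add (abs_mul_le_mul p3 q1) (abs_mul_le_mul p1 q2))) (abs_mul_le_mul p2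
      ((abs_add_le _ _).trans (add_le_add ((abs_add_le _ _).trans
        (add_le_add ((abs_add_le _ _).trans (add_le_add q3 q4)) q5)) q6))))).trans_eq ?_
  ring

/-! ### Descent of the averaged signal -/

/-- If the error in the balance of the corrected averaged signal is small up to an integrable
transient, the averaged signal descends like the flow `β`. The lower barrier of the averaged signal
used as comparison function absorbs the corrector and the transient. -/
lemma IsSolution.diskAverage_le {dr ds dt : ℝ → ℝ} {t₀ t₁ : ℝ} {x₀ : State}
    {I : Set ℝ} {x : ℝ → State}
    (hx : IsSolution c ψ ε dr ds dt t₀ x₀ I x) (h01 : t₀ ≤ t₁) (hI : Set.Icc t₀ t₁ ⊆ I)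
    (hψ : ContDiff ℝ 1 ψ) (hε : 0 < ε)
    (hds : IntervalIntegrable ds volume t₀ t₁) (hdt : IntervalIntegrable dt volume t₀ t₁)
    {K : Set Plane} {ystar : ℝ} {α : ℝ ≃o ℝ} {β : ℝ → ℝ → ℝ} (hα0 : α 0 = 0)
    (hα : ∀ p ∈ K, 0 ≤ diskAverage ψ c.r p - ystar → α (diskAverage ψ c.r p - ystar) ≤
      c.lam * c.r / (2 * c.k) * ‖gradient (diskAverage ψ c.r) p‖ ^ 2)
    (hβ0 : ∀ s, 0 ≤ s → β s 0 = s) (hβd : ∀ s t, HasDerivAt (β s) (-(α (β s t)) / 2) t)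
    (hK : ∀ t ∈ Set.Icc t₀ t₁, (x t).p ∈ K) {C₁ C d a : ℝ} (ha : 0 < a) (hC : 0 ≤ C) (hd : 0 ≤ d)
    (hE : ∀ t ∈ Set.Icc t₀ t₁, |energy c ψ ε (x t) - diskAverage ψ c.r (x t).p| ≤ C₁ * ε)
    (hErr : ∀ᵐ t, t ∈ Set.Icc t₀ t₁ →
      energyError c ψ ε (x t) (ds t) (dt t) ≤ C * (d + ε + Real.exp (-(a * (t - t₀))))) :
    diskAverage ψ c.r (x t₁).p - ystar ≤
      max (β (max (diskAverage ψ c.r x₀.p - ystar) 0) (ε * (t₁ - t₀))) (α.symm (2 * C * (d + ε)))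
        + (2 * C₁ + C / a) * ε := by
  obtain ⟨w, hw, hwe⟩ := hx.isPrimitiveOn_energy h01 hI hψ hε hds hdt
  have hexp : ∀ t, HasDerivAt (fun t => Real.exp (-(a * (t - t₀))))
      (-a * Real.exp (-(a * (t - t₀)))) t := fun t => by
    have := ((((hasDerivAt_id t).sub_const t₀).const_mul a).neg).exp
    simpa [mul_comm] using this
  have hZ := (hw.add ((IsPrimitiveOn.of_hasDerivAt h01 hexp (by fun_prop)).const_mul
    (C / a * ε))).add_const (-ystar - C₁ * ε - C / a * ε)
  -- The middle summand is a primitive of the transient; the last one makes `z` a lower barrier.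
  set z : ℝ → ℝ := fun t => energy c ψ ε (x t) + C / a * ε * Real.exp (-(a * (t - t₀))) +
    (-ystar - C₁ * ε - C / a * ε) with hz
  set b := α.symm (2 * C * (d + ε)) with hb
  have hCa : 0 ≤ C / a * ε := by positivity
  have hzle : ∀ t ∈ Set.Icc t₀ t₁, z t ≤ diskAverage ψ c.r (x t).p - ystar := by
    intro t ht
    have h1 := (abs_le.1 (hE t ht)).2
    have h2 : Real.exp (-(a * (t - t₀))) ≤ 1 := Real.exp_le_one_iff.2 (by
      have := mul_nonneg ha.le (sub_nonneg.2 ht.1); linarith)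
    have h3 := mul_le_mul_of_nonneg_left h2 hCa
    simp only [hz]
    linarith
  have hlez : ∀ t ∈ Set.Icc t₀ t₁,
      diskAverage ψ c.r (x t).p - ystar ≤ z t + (2 * C₁ + C / a) * ε := by
    intro t ht
    have h1 := (abs_le.1 (hE t ht)).1
    have h2 := mul_nonneg hCa (Real.exp_pos (-(a * (t - t₀)))).le
    simp only [hz]
    linarith
  have hαz : ∀ t ∈ Set.Icc t₀ t₁, α (z t) ≤
      c.lam * c.r / (2 * c.k) * ‖gradient (diskAverage ψ c.r) (x t).p‖ ^ 2 := by
    intro t ht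
    have h1 := hzle t ht
    rcases le_total 0 (diskAverage ψ c.r (x t).p - ystar) with h0 | h0
    · exact (α.monotone h1).trans (hα _ (hK t ht) h0)
    · have h2 : α (z t) ≤ 0 := by rw [← hα0]; exact α.monotone (h1.trans h0)
      have := c.lam_pos
      have := c.r_pos
      have := c.k_pos
      exact h2.trans (by positivity)
  have hmem₀ : t₀ ∈ Set.Icc t₀ t₁ := ⟨le_rfl, h01⟩
  have hmem₁ : t₁ ∈ Set.Icc t₀ t₁ := ⟨h01, le_rfl⟩
  have hb0 : 0 ≤ b := by
    rw [hb, ← α.symm_apply_apply 0, hα0]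
    exact α.symm.monotone (by positivity)
  have hzc : ContinuousOn z (Set.Icc t₀ t₁) := hZ.continuousOn
  have hfin := le_max_flow_of_sub_le_integral (z := z) hα0 hβd hε hb0 (hβ0 _ (le_max_right _ _))
    hzc ((hzle t₀ hmem₀).trans (by rw [hx.apply_start]; exact le_max_left _ _)) (by
      intro t ht t' ht' htt
      refine (hZ.mono ht ht' htt).sub_le_integral ?_ ?_
      · exact continuousOn_const.mul (continuousOn_const.sub (α.continuous.comp_continuousOn
          (hzc.mono (Set.Icc_subset_Icc ht.1 ht'.2))))
      · filter_upwards [hErr] with τ hτ hτI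
        have hτJ : τ ∈ Set.Icc t₀ t₁ := ⟨ht.1.trans hτI.1, hτI.2.trans ht'.2⟩
        have h1 := hτ hτJ
        have h2 := hαz τ hτJ
        rw [hwe τ hτJ]
        have h3 : α b / 2 = C * (d + ε) := by rw [hb, α.apply_symm_apply]; ring
        have h4 : C / a * ε * (-a * Real.exp (-(a * (τ - t₀)))) =
          ε * (-(C * Real.exp (-(a * (τ - t₀))))) := by field_simp
        rw [h3, h4, ← mul_add]
        refine mul_le_mul_of_nonneg_left ?_ hε.le
        linarith) t₁ hmem₁
  linarith [hlez t₁ hmem₁]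

end Correctors

/-! ### A priori estimates -/

/-- The bounds on the state `s` at the time `T` after the start at `x₀`, with
disturbances of norms `nr`, `ns`, `nt`. -/
structure StateBounds (c : Params) (ψ : Plane → ℝ) (P : Set Plane) (ystar y₀ : ℝ)
    (β : ℝ → ℝ → ℝ) (γr γs γt νp νη : ℝ → ℝ) (νv ε nr ns nt T : ℝ) (x₀ s : State) : Prop where
  mem : s.p ∈ P
  signal : diskAverage ψ c.r s.p - ystar ≤
    max (β (max (diskAverage ψ c.r x₀.p - ystar) 0) (ε * T)) (γr nr + γs ns + γt nt) + νp ε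
  v : |s.v| ≤ |x₀.v| * Real.exp (-((1 / ε) * (c.k / c.m) * T)) + νv * ε
  ω : |s.ω - c.ωstar| ≤ |x₀.ω - c.ωstar| * Real.exp (-((c.κ / c.J) * T)) + (1 / c.κ) * nr
  η : Metric.infDist s.η (signalInterval ψ c.r P y₀) ≤
    Metric.infDist x₀.η (signalInterval ψ c.r P y₀) * Real.exp (-(ε * c.h * T)) + ns + νη ε

/-- The admissible initial states. -/
structure IsInitial (c : Params) (ψ : Plane → ℝ) (P : Set Plane) (y₀ ρv ρω ρη : ℝ)
    (x₀ : State) : Prop where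
  p : x₀.p ∈ sublevel ψ c.r P y₀
  o : x₀.o ∈ Metric.sphere (0 : Plane) 1
  v : |x₀.v| ≤ ρv
  ω : |x₀.ω - c.ωstar| ≤ ρω
  η : Metric.infDist x₀.η (signalInterval ψ c.r P y₀) ≤ ρη

/-- A sum of four nonnegative numbers is at most four times one of them. -/
lemma orderIso_add_le {χ : ℝ ≃o ℝ} (h0 : χ 0 = 0) {C a₁ a₂ a₃ a₄ : ℝ} (hC : 0 ≤ C)
    (h1 : 0 ≤ a₁) (h2 : 0 ≤ a₂) (h3 : 0 ≤ a₃) (h4 : 0 ≤ a₄) :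
    χ (2 * C * (a₁ + a₂ + a₃ + a₄)) ≤
      χ (8 * C * a₁) + χ (8 * C * a₂) + χ (8 * C * a₃) + χ (8 * C * a₄) := by
  have hpos : ∀ a, 0 ≤ a → 0 ≤ χ (8 * C * a) := fun a ha => by
    rw [← h0]; exact χ.monotone (by positivity)
  have k1 := hpos a₁ h1
  have k2 := hpos a₂ h2
  have k3 := hpos a₃ h3
  have k4 := hpos a₄ h4
  have key : ∀ a, a₁ + a₂ + a₃ + a₄ ≤ 4 * a → χ (2 * C * (a₁ + a₂ + a₃ + a₄)) ≤ χ (8 * C * a) :=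
    fun a ha => χ.monotone (by nlinarith)
  by_cases c1 : a₁ + a₂ + a₃ + a₄ ≤ 4 * a₁
  · linarith [key _ c1]
  by_cases c2 : a₁ + a₂ + a₃ + a₄ ≤ 4 * a₂
  · linarith [key _ c2]
  by_cases c3 : a₁ + a₂ + a₃ + a₄ ≤ 4 * a₃
  · linarith [key _ c3]
  · linarith [key a₄ (by linarith)]

set_option maxHeartbeats 1600000 in
/-- As long as the position stays in a suitable compact neighbourhood `K` of the sublevel set, all
asserted bounds hold, and the position stays in an open subset `U` of `K`. -/
theorem exists_apriori_bounds (c : Params) {ψ : Plane → ℝ} (hψ : ContDiff ℝ 1 ψ)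
    {P : Set Plane} (hP : IsOpen P) {ystar y₀ : ℝ} (hy : ystar < y₀)
    (hcompact : IsCompact (sublevel ψ c.r P y₀))
    (hgrad : ∀ p ∈ P, ystar < diskAverage ψ c.r p → diskAverage ψ c.r p ≤ y₀ →
      gradient (diskAverage ψ c.r) p ≠ 0)
    {ρv ρω ρη : ℝ} (hρv : 0 < ρv) (hρω : 0 < ρω) (hρη : 0 < ρη) :
    ∃ β : ℝ → ℝ → ℝ, IsClassKL β ∧ (∀ s, 0 ≤ s → β s 0 = s) ∧
    ∃ γ νp νη : ℝ → ℝ, IsClassK γ ∧ IsClassK νp ∧ IsClassK νη ∧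
    ∃ ε₀ δ νv : ℝ, 0 < ε₀ ∧ 0 < δ ∧ 0 < νv ∧
    ∃ (K U : Set Plane) (R : ℝ), IsCompact K ∧ IsOpen U ∧ U ⊆ K ∧ sublevel ψ c.r P y₀ ⊆ K ∧
    ∀ ε : ℝ, 0 < ε → ε < ε₀ → ∀ (t₀ : ℝ) (x₀ : State), IsInitial c ψ P y₀ ρv ρω ρη x₀ →
    ∀ dr ds dt : Lp ℝ ⊤ (volume : Measure ℝ), ‖dr‖ ≤ δ → ‖ds‖ ≤ δ → ‖dt‖ ≤ δ →
    ∀ (I : Set ℝ) (x : ℝ → State) (t₁ : ℝ), IsSolution c ψ ε dr ds dt t₀ x₀ I x → t₀ ≤ t₁ →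
      Set.Icc t₀ t₁ ⊆ I → (∀ t ∈ Set.Icc t₀ t₁, (x t).p ∈ K) →
      (x t₁).p ∈ U ∧ |(x t₁).v| ≤ R ∧ |(x t₁).ω| ≤ R ∧ |(x t₁).η| ≤ R ∧
      StateBounds c ψ P ystar y₀ β γ γ γ νp νη νv ε ‖dr‖ ‖ds‖ ‖dt‖ (t₁ - t₀) x₀ (x t₁) := by
  have hm := c.m_pos
  have hJ := c.J_pos
  have hk := c.k_pos
  have hκ := c.κ_pos
  have hl := c.lam_pos
  have hh := c.h_pos
  have hr := c.r_pos
  have hw := c.ωstar_pos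
  have hψc := hψ.continuous
  have hΨ := contDiff_diskAverage (r := c.r) hψ
  have hΨc := hΨ.continuous
  have hgc := continuous_gradient_diskAverage (r := c.r) hψ
  obtain ⟨K, U, δ₀, hKc, hKP, hCK, hUo, hUK, hδ₀, hKU, hKgrad⟩ :=
    exists_trapping_set hΨ hP hy rfl hcompact hgrad
  have hKS : IsCompact (K ×ˢ Metric.sphere (0 : Plane) 1) := hKc.prod (isCompact_sphere _ _)
  -- The decay rate `α` and the flow `β` of the descent.
  obtain ⟨α, hα0, hαle, hα⟩ := exists_orderIso_comp_le_on hKc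
    (u := fun p => c.lam * c.r / (2 * c.k) * ‖gradient (diskAverage ψ c.r) p‖ ^ 2)
    (D := fun p => diskAverage ψ c.r p - ystar) (by fun_prop) (by fun_prop)
    (fun p _ => by positivity) (fun p hp hpos => by
      have := norm_pos_iff.2 (hKgrad p hp (sub_pos.1 hpos))
      positivity)
  obtain ⟨β, hβ, hβ0, hβd⟩ := exists_classKL_flow α hα0 hαle
  -- On `K`, the signal is close to the signal interval if the averaged signal is not much larger
  -- than `y₀`.
  obtain ⟨α', hα'0, -, hα'⟩ := exists_orderIso_comp_le_on hKS
    (u := fun q => max (diskAverage ψ c.r q.1 - y₀) 0)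
    (D := fun q => Metric.infDist (ψ (q.1 + c.r • q.2)) (signalInterval ψ c.r P y₀))
    (((hΨc.comp continuous_fst).sub continuous_const).max continuous_const).continuousOn
    ((Metric.continuous_infDist_pt _).comp (by fun_prop)).continuousOn
    (fun q _ => le_max_right _ _) (fun q hq hpos => by
      by_contra! hle
      have hq1 : q.1 ∈ sublevel ψ c.r P y₀ :=
        ⟨hKP hq.1, by linarith [(max_le_iff.1 hle).1]⟩
      rw [Metric.infDist_zero_of_mem (mem_signalInterval hq1 hq.2)] at hpos
      exact lt_irrefl _ hpos)
  obtain ⟨B, hB0, hB⟩ := exists_configBound (ψ := ψ) (r := c.r) hψ hKS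
  have hχ0 : α.symm 0 = 0 := α.symm_apply_eq.2 hα0.symm
  have hχ'0 : α'.symm 0 = 0 := α'.symm_apply_eq.2 hα'0.symm
  -- `N`, `V`, `Ω` bound the filter state and the velocities, `F` bounds the force without damping,
  -- `A₂` and `H` occur in the bounds of the deviation of the rotational velocity and of the rate of
  -- the filter state, and `a` is the decay rate of the transients, for `ε ≤ 1`.
  set N := B + ρη + 1 with hN
  set F := c.lam * (B + N) + c.lam + 1 with hF
  set νv := F / c.k with hνv
  set V := ρv + νv with hV
  set Ω := c.ωstar + ρω + 1 / c.κ with hΩ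
  set a := min (c.k / c.m) (c.κ / c.J) with ha
  set A₂ := ρω + 1 / c.κ with hA₂
  set H := c.h * (N + B + 1) with hH
  have hN0 : 0 < N := by positivity
  have hF0 : 0 < F := by positivity
  have hνv0 : 0 < νv := by positivity
  have hV0 : 0 < V := by positivity
  have ha0 : 0 < a := lt_min (by positivity) (by positivity)
  have hA₂0 : 0 < A₂ := by positivity
  set C₁ := c.m / c.k * (V * B) + c.lam / (c.k * c.ωstar) * (B + N * B) with hC₁
  set C₀ := 1 / c.k * (B * (1 + c.lam)) + c.m / c.k * (V * (V * B + Ω * B)) +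
        c.lam / (c.k * c.ωstar) * (V * B + N * (V * B) + H * B + A₂ * (B + N * B)) with hC₀
  have hC₁0 : 0 ≤ C₁ := by positivity
  have hC₀0 : 0 ≤ C₀ := by positivity
  set C := C₀ + 1 with hC
  have hC0 : 0 < C := by positivity
  set γ : ℝ → ℝ := fun s => α.symm (8 * C * s) with hγ
  have hγK : IsClassK γ := isClassK_orderIso_mul hχ0 (by positivity)
  set νp : ℝ → ℝ := fun s => γ s + (2 * C₁ + C / a) * s with hνp
  have hνpK : IsClassK νp := hγK.add_mul (by positivity)
  -- For disturbances of norm at most `a₁`, the gains sum up to less than `y₀ - ystar`, so that the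
  -- averaged signal stays below `y₀ + νp ε`, which for `ε ≤ a₂` is less than `y₀ + δ₀`.
  obtain ⟨a₁, ha₁, hγa⟩ := hγK.exists_lt (b := (y₀ - ystar) / 3) (by linarith)
  obtain ⟨a₂, ha₂, hνa⟩ := hνpK.exists_lt hδ₀
  refine ⟨β, hβ, hβ0, γ, νp, fun s => α'.symm (νp s), hγK, hνpK, hνpK.orderIso_comp hχ'0,
    min 1 a₂, min 1 a₁, νv, lt_min one_pos ha₂, lt_min one_pos ha₁, hνv0, K, U, V + Ω + N, hKc,
    hUo, hUK, hCK, ?_⟩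
  intro ε hε hεlt t₀ x₀ hx₀ dr ds dt hdr hds hdt I x t₁ hx h01 hI hxK
  have hε1 : ε ≤ 1 := (hεlt.trans_le (min_le_left _ _)).le
  have hr0 := norm_nonneg dr
  have hs0 := norm_nonneg ds
  have ht0 := norm_nonneg dt
  have hdr1 := hdr.trans (min_le_left _ _)
  have hds1 := hds.trans (min_le_left _ _)
  have hdt1 := hdt.trans (min_le_left _ _)
  have hir := intervalIntegrable_Lp dr
  have his := intervalIntegrable_Lp ds
  have hit := intervalIntegrable_Lp dt
  have haer := ae_abs_le_norm dr
  have haes := ae_abs_le_norm ds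
  have haet := ae_abs_le_norm dt
  have hcfg : ∀ t ∈ Set.Icc t₀ t₁, ConfigBound ψ c.r B ((x t).p, (x t).o) := fun t ht =>
    hB _ ⟨hxK t ht, hx.norm_o t (hI ht)⟩
  -- The signal interval is contained in `[-B, B]`.
  obtain ⟨l, u, hlu, hΛ⟩ := exists_signalInterval_eq_Icc (P := P) (y := y₀) (r := c.r) hψc hcompact
    ⟨_, x₀.p, hx₀.p, x₀.o, hx₀.o, rfl⟩
  have hΛB : Set.Icc l u ⊆ Set.Icc (-B) B := by
    rw [← hΛ]
    refine convexHull_min ?_ (convex_Icc _ _)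
    rintro _ ⟨p, hp, o, ho, rfl⟩
    exact abs_le.1 (hB (p, o) ⟨hCK hp, ho⟩).signal
  have hlB := (hΛB ⟨le_rfl, hlu⟩).1
  have huB := (hΛB ⟨hlu, le_rfl⟩).2
  have hη₀ : |x₀.η| ≤ N := by
    have h1 := hx₀.η
    rw [hΛ, infDist_Icc hlu] at h1
    simp only [max_le_iff] at h1
    rw [abs_le]
    constructor <;> linarith [h1.1.1, h1.1.2]
  have hsub : ∀ t ∈ Set.Icc t₀ t₁, Set.Icc t₀ t ⊆ Set.Icc t₀ t₁ := fun t ht =>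
    Set.Icc_subset_Icc_right ht.2
  have hη : ∀ t ∈ Set.Icc t₀ t₁, |(x t).η| ≤ N := fun t ht =>
    hx.abs_η_le ht.1 ((hsub t ht).trans hI) hψc hε (his _ _) haes
      (fun s hs => (hcfg s (hsub t ht hs)).signal) hη₀ (by linarith)
  have hv : ∀ t ∈ Set.Icc t₀ t₁, |(x t).v| ≤
      |x₀.v| * Real.exp (-((1 / ε) * (c.k / c.m) * (t - t₀))) + νv * ε := fun t ht => by
    refine hx.abs_v_le ht.1 ((hsub t ht).trans hI) hψc hε (his _ _) (hit _ _) ?_ hF0.le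
    filter_upwards [haes, haet] with τ h1 h2 hτ
    have h3 := (hcfg τ (hsub t ht hτ)).signal
    have h4 := hη τ (hsub t ht hτ)
    have h5 : |-c.lam| ≤ c.lam := by rw [abs_neg, abs_of_pos hl]
    have h6 : |c.lam| ≤ c.lam := (abs_of_pos hl).le
    refine (abs_add_le _ _).trans (add_le_add ((abs_sub _ _).trans (add_le_add
      (abs_mul_le_mul h5 ((abs_sub _ _).trans (add_le_add h3 h4))) ?_)) (h2.trans hdt1))
    exact (abs_mul_le_mul h6 (h1.trans hds1)).trans_eq (mul_one _)
  have hω : ∀ t ∈ Set.Icc t₀ t₁, |(x t).ω - c.ωstar| ≤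
      |x₀.ω - c.ωstar| * Real.exp (-((c.κ / c.J) * (t - t₀))) + (1 / c.κ) * ‖dr‖ := fun t ht =>
    hx.abs_ω_sub_le ht.1 ((hsub t ht).trans hI) (hir _ _) haer hr0
  have hvV : ∀ t ∈ Set.Icc t₀ t₁, |(x t).v| ≤ V := fun t ht => by
    have h1 : Real.exp (-((1 / ε) * (c.k / c.m) * (t - t₀))) ≤ 1 := Real.exp_le_one_iff.2 (by
      have : 0 ≤ (1 / ε) * (c.k / c.m) * (t - t₀) :=
        mul_nonneg (by positivity) (sub_nonneg.2 ht.1)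
      linarith)
    refine (hv t ht).trans (add_le_add ?_ (mul_le_of_le_one_right hνv0.le hε1))
    exact (mul_le_of_le_one_right (abs_nonneg _) h1).trans hx₀.v
  have hωΩ : ∀ t ∈ Set.Icc t₀ t₁, |(x t).ω| ≤ Ω := fun t ht => by
    have h1 : Real.exp (-((c.κ / c.J) * (t - t₀))) ≤ 1 := Real.exp_le_one_iff.2 (by
      have : 0 ≤ (c.κ / c.J) * (t - t₀) := mul_nonneg (by positivity) (sub_nonneg.2 ht.1)
      linarith)
    have h2 := (hω t ht).trans (add_le_add
      ((mul_le_of_le_one_right (abs_nonneg _) h1).trans hx₀.ω)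
      (mul_le_of_le_one_right (by positivity) hdr1))
    have h3 := abs_add_le ((x t).ω - c.ωstar) c.ωstar
    rw [sub_add_cancel, abs_of_pos hw] at h3
    linarith
  -- Every term of the error has a factor that is bounded by a multiple of the number `X` below.
  set d := ‖dr‖ + ‖ds‖ + ‖dt‖ with hd
  have hErr : ∀ᵐ t, t ∈ Set.Icc t₀ t₁ → energyError c ψ ε (x t) (ds t) (dt t) ≤
      C * (d + ε + Real.exp (-(a * (t - t₀)))) := by
    filter_upwards [haes, haet] with t h1 h2 ht
    have he := Real.exp_pos (-(a * (t - t₀)))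
    have hT : 0 ≤ t - t₀ := sub_nonneg.2 ht.1
    set X := d + ε + Real.exp (-(a * (t - t₀))) with hX
    have hX0 : 0 ≤ X := by positivity
    have hεX : ε ≤ X := by linarith
    have heX : Real.exp (-(a * (t - t₀))) ≤ X := by linarith
    have e1 : Real.exp (-((1 / ε) * (c.k / c.m) * (t - t₀))) ≤ X := by
      refine (Real.exp_le_exp.2 (neg_le_neg ?_)).trans heX
      refine mul_le_mul_of_nonneg_right ((min_le_left _ _).trans ?_) hT
      exact le_mul_of_one_le_left (by positivity) ((one_le_div hε).2 hε1)
    have e2 : Real.exp (-((c.κ / c.J) * (t - t₀))) ≤ X := by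
      refine (Real.exp_le_exp.2 (neg_le_neg ?_)).trans heX
      exact mul_le_mul_of_nonneg_right (min_le_right _ _) hT
    have hv1 : |(x t).v| ≤ V * X := by
      refine (hv t ht).trans ?_
      rw [hV, add_mul]
      have := hx₀.v
      gcongr
    have hω1 : |(x t).ω - c.ωstar| ≤ A₂ * X := by
      refine (hω t ht).trans ?_
      rw [hA₂, add_mul]
      have := hx₀.ω
      gcongr
      linarith
    have hη1 : |ηRate c ψ ε (x t) (ds t)| ≤ H * X := by
      have e3 : ηRate c ψ ε (x t) (ds t) =
          ε * (c.h * (ψ ((x t).p + c.r • (x t).o) - (x t).η + ds t)) := by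
        simp only [ηRate]; ring
      have h4 : |ψ ((x t).p + c.r • (x t).o) - (x t).η + ds t| ≤ B + N + 1 :=
        (abs_add_le _ _).trans (add_le_add ((abs_sub _ _).trans
          (add_le_add (hcfg t ht).signal (hη t ht))) (h1.trans hds1))
      rw [e3, mul_comm H]
      refine abs_mul_le_mul ((abs_of_pos hε).le.trans hεX) ?_
      refine (abs_mul_le_mul (abs_of_pos hh).le h4).trans_eq ?_
      rw [hH]; ring
    refine (le_abs_self _).trans ((abs_energyError_le (X := X) (hcfg t ht) (hvV t ht) (hωΩ t ht)
      (hη t ht) hη1 hv1 hω1 (h1.trans (by linarith)) (h2.trans (by linarith))).trans ?_)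
    rw [← hC₀]
    gcongr
    linarith
  have hsig : ∀ t ∈ Set.Icc t₀ t₁, diskAverage ψ c.r (x t).p - ystar ≤
      max (β (max (diskAverage ψ c.r x₀.p - ystar) 0) (ε * (t - t₀)))
        (γ ‖dr‖ + γ ‖ds‖ + γ ‖dt‖) + νp ε := fun t ht => by
    have h1 := hx.diskAverage_le (K := K) (α := α) (ystar := ystar) (C₁ := C₁) (C := C) (d := d)
      ht.1 ((hsub t ht).trans hI) hψ hε (his _ _) (hit _ _) hα0 hα hβ0 hβd
      (fun s hs => hxK s (hsub t ht hs)) ha0 hC0.le (by positivity)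
      (fun s hs => abs_energy_sub_le hε (hcfg s (hsub t ht hs)) (hvV s (hsub t ht hs))
        (hη s (hsub t ht hs))) (by filter_upwards [hErr] with s hs hsI using hs (hsub t ht hsI))
    have h2 := orderIso_add_le hχ0 hC0.le hr0 hs0 ht0 hε.le
    have h3 : 0 ≤ γ ε := hγK.nonneg hε.le
    have h4 : max (β (max (diskAverage ψ c.r x₀.p - ystar) 0) (ε * (t - t₀)))
        (α.symm (2 * C * (d + ε))) ≤
        max (β (max (diskAverage ψ c.r x₀.p - ystar) 0) (ε * (t - t₀)))
        (γ ‖dr‖ + γ ‖ds‖ + γ ‖dt‖) + γ ε :=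
      max_le ((le_max_left _ _).trans (le_add_of_nonneg_right h3))
        (h2.trans (add_le_add (le_max_right _ _) le_rfl))
    simp only [hνp]
    linarith
  have hsig' : ∀ t ∈ Set.Icc t₀ t₁, diskAverage ψ c.r (x t).p ≤ y₀ + νp ε := fun t ht => by
    have h1 := hsig t ht
    have h2 : 0 ≤ max (diskAverage ψ c.r x₀.p - ystar) 0 := le_max_right _ _
    have h3 : β (max (diskAverage ψ c.r x₀.p - ystar) 0) (ε * (t - t₀)) ≤ y₀ - ystar :=
      (hβ.antitoneOn _ h2 (Set.mem_Ici.2 le_rfl)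
        (mul_nonneg hε.le (sub_nonneg.2 ht.1)) (mul_nonneg hε.le (sub_nonneg.2 ht.1))).trans
        ((hβ0 _ h2).le.trans (max_le (by linarith [hx₀.p.2]) (by linarith)))
    have h4 := hγa _ hr0 (hdr.trans (min_le_right _ _))
    have h5 := hγa _ hs0 (hds.trans (min_le_right _ _))
    have h6 := hγa _ ht0 (hdt.trans (min_le_right _ _))
    have h7 := max_le h3 (show γ ‖dr‖ + γ ‖ds‖ + γ ‖dt‖ ≤ y₀ - ystar by linarith)
    linarith
  have hmem₁ : t₁ ∈ Set.Icc t₀ t₁ := ⟨h01, le_rfl⟩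
  have hν0 : 0 ≤ α'.symm (νp ε) := (hνpK.orderIso_comp hχ'0).nonneg hε.le
  have hν : ∀ t ∈ Set.Icc t₀ t₁, Metric.infDist (ψ ((x t).p + c.r • (x t).o)) (Set.Icc l u) ≤
      α'.symm (νp ε) := fun t ht => by
    have h1 := hα' ((x t).p, (x t).o) ⟨hxK t ht, hx.norm_o t (hI ht)⟩ Metric.infDist_nonneg
    rw [← hΛ, ← α'.le_iff_le, α'.apply_symm_apply]
    refine h1.trans (max_le ?_ (hνpK.nonneg hε.le))
    linarith [hsig' t ht]
  have hΩ0 : 0 < Ω := by positivity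
  refine ⟨hKU _ (hxK t₁ hmem₁) ?_, ?_, ?_, ?_, hKP (hxK t₁ hmem₁), hsig t₁ hmem₁, hv t₁ hmem₁,
    hω t₁ hmem₁, ?_⟩
  · have := hνa ε hε.le (hεlt.le.trans (min_le_right _ _))
    linarith [hsig' t₁ hmem₁]
  · linarith [hvV t₁ hmem₁]
  · linarith [hωΩ t₁ hmem₁]
  · linarith [hη t₁ hmem₁]
  · rw [hΛ]
    exact hx.infDist_η_le h01 hI hψc hε (his _ _) haes hs0 hlu hν0 hν

/-! ### The system as an ordinary differential equation with continuous right-hand side -/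

/-- The state space as a normed space: position, orientation, translational velocity, rotational
velocity, filter state. -/
abbrev StateSpace : Type := Plane × Plane × ℝ × ℝ × ℝ

/-- The coordinates of a state. -/
def State.coords (s : State) : StateSpace := (s.p, s.o, s.v, s.ω, s.η)

/-- The state with given coordinates. -/
def stateOf (y : StateSpace) : State := ⟨y.1, y.2.1, y.2.2.1, y.2.2.2.1, y.2.2.2.2⟩

/-- The vector field of the undisturbed system. -/
noncomputable def field (c : Params) (ψ : Plane → ℝ) (ε : ℝ) (y : StateSpace) : StateSpace :=
  (y.2.2.1 • y.2.1, y.2.2.2.1 • rotL y.2.1,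
    (1 / c.m) * (-c.lam * (ψ (y.1 + c.r • y.2.1) - y.2.2.2.2) - (1 / ε) * c.k * y.2.2.1),
    (1 / c.J) * (-c.κ * (y.2.2.2.1 - c.ωstar)),
    -ε * c.h * y.2.2.2.2 + ε * c.h * ψ (y.1 + c.r • y.2.1))

/-- The integrated disturbances. They enter the system additively, so that the difference of a
solution and this function is continuously differentiable. -/
noncomputable def integratedDisturbance (c : Params) (ε : ℝ) (dr ds dt : ℝ → ℝ) (t₀ t : ℝ) :
    StateSpace :=
  (0, 0, ∫ s in t₀..t, (1 / c.m) * (-c.lam * ds s + dt s), ∫ s in t₀..t, (1 / c.J) * dr s,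
    ∫ s in t₀..t, ε * c.h * ds s)

/-- An open set is not left if it is not left as long as the path stays in a larger closed set. -/
lemma mem_of_forall_mem_imp {X : Type*} [TopologicalSpace X] {y : ℝ → X} {a b : ℝ} {G S : Set X}
    (hy : ContinuousOn y (Set.Icc a b)) (hG : IsOpen G) (hS : IsClosed S) (hGS : G ⊆ S)
    (h0 : y a ∈ S) (h : ∀ t ∈ Set.Icc a b, (∀ s ∈ Set.Icc a t, y s ∈ S) → y t ∈ G) :
    ∀ t ∈ Set.Icc a b, y t ∈ G := by
  by_contra! hcon
  obtain ⟨t, ht, htG⟩ := hcon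
  set B : Set ℝ := Set.Icc a b ∩ y ⁻¹' Gᶜ with hB
  have hBc : IsCompact B := isCompact_Icc.of_isClosed_subset
    (hy.preimage_isClosed_of_isClosed isClosed_Icc hG.isClosed_compl) Set.inter_subset_left
  obtain ⟨T, hT, hTm⟩ := hBc.exists_isLeast ⟨t, ht, htG⟩
  have hlt : ∀ s ∈ Set.Ico a T, y s ∈ G := fun s hs => by
    by_contra hsG
    exact absurd (hTm ⟨⟨hs.1, hs.2.le.trans hT.1.2⟩, hsG⟩) (not_le.2 hs.2)
  have hTS : ∀ s ∈ Set.Icc a T, y s ∈ S := by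
    rcases hT.1.1.eq_or_lt with heq | hlt'
    · intro s hs
      rw [← heq, Set.Icc_self] at hs
      rw [Set.mem_singleton_iff.1 hs]
      exact h0
    · have h1 : Set.MapsTo y (Set.Ico a T) S := fun s hs => hGS (hlt s hs)
      have h2 := h1.closure_of_continuousOn (by
        rw [closure_Ico hlt'.ne]
        exact hy.mono (Set.Icc_subset_Icc_right hT.1.2))
      rw [closure_Ico hlt'.ne, hS.closure_eq] at h2
      exact fun s hs => h2 hs
  exact hT.2 (h T hT.1 hTS)

section System

variable {c : Params} {ψ : Plane → ℝ} {ε : ℝ} {dr ds dt : ℝ → ℝ} {t₀ : ℝ}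

lemma contDiff_field (hψ : ContDiff ℝ 1 ψ) : ContDiff ℝ 1 (field c ψ ε) := by
  unfold field
  fun_prop

lemma continuous_integratedDisturbance (hdr : ∀ a b, IntervalIntegrable dr volume a b)
    (hds : ∀ a b, IntervalIntegrable ds volume a b)
    (hdt : ∀ a b, IntervalIntegrable dt volume a b) :
    Continuous (integratedDisturbance c ε dr ds dt t₀) := by
  refine continuous_const.prodMk (continuous_const.prodMk (Continuous.prodMk ?_
    (Continuous.prodMk ?_ ?_)))
  · exact intervalIntegral.continuous_primitive
      (fun a b => (((hds a b).const_mul _).add (hdt a b)).const_mul _) _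
  · exact intervalIntegral.continuous_primitive (fun a b => (hdr a b).const_mul _) _
  · exact intervalIntegral.continuous_primitive (fun a b => (hds a b).const_mul _) _

lemma integratedDisturbance_self : integratedDisturbance c ε dr ds dt t₀ t₀ = 0 := by
  simp [integratedDisturbance]

variable {x₀ : State} {I : Set ℝ} {x : ℝ → State}

lemma IsSolution.continuousOn_coords (hx : IsSolution c ψ ε dr ds dt t₀ x₀ I x) :
    ContinuousOn (fun t => (x t).coords) I :=
  hx.cont_p.prodMk (hx.cont_o.prodMk (hx.cont_v.prodMk (hx.cont_ω.prodMk hx.cont_η)))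

/-- Carathéodory solutions become classical solutions by subtraction of the integrated
disturbances. -/
lemma IsSolution.hasDerivWithinAt_coords (hx : IsSolution c ψ ε dr ds dt t₀ x₀ I x)
    (hψ : Continuous ψ) (hdr : ∀ a b, IntervalIntegrable dr volume a b)
    (hds : ∀ a b, IntervalIntegrable ds volume a b)
    (hdt : ∀ a b, IntervalIntegrable dt volume a b) {a b : ℝ} (hab : t₀ ∈ Set.Icc a b)
    (hI : Set.Icc a b ⊆ I) : ∀ t ∈ Set.Icc a b,
      HasDerivWithinAt (fun t => (x t).coords - integratedDisturbance c ε dr ds dt t₀ t)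
        (field c ψ ε (x t).coords) (Set.Icc a b) t := by
  have hp := hx.cont_p.mono hI
  have ho := hx.cont_o.mono hI
  have hv := hx.cont_v.mono hI
  have hω := hx.cont_ω.mono hI
  have hη := hx.cont_η.mono hI
  have hs := (hx.continuousOn_signal hψ).mono hI
  have hro : ContinuousOn (fun t => rot (x t).o) (Set.Icc a b) :=
    rotL.continuous.comp_continuousOn ho
  have hsubI : ∀ t ∈ Set.Icc a b, Set.uIcc t₀ t ⊆ Set.Icc a b := fun t ht =>
    Set.ordConnected_Icc.uIcc_subset hab ht
  have kv : ContinuousOn (fun t => (1 / c.m) * (-c.lam * (ψ ((x t).p + c.r • (x t).o) - (x t).η)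
      - (1 / ε) * c.k * (x t).v)) (Set.Icc a b) :=
    continuousOn_const.mul ((continuousOn_const.mul (hs.sub hη)).sub (continuousOn_const.mul hv))
  have kω : ContinuousOn (fun t => (1 / c.J) * (-c.κ * ((x t).ω - c.ωstar))) (Set.Icc a b) :=
    continuousOn_const.mul (continuousOn_const.mul (hω.sub continuousOn_const))
  have kη : ContinuousOn (fun t => -ε * c.h * (x t).η + ε * c.h * ψ ((x t).p + c.r • (x t).o))
      (Set.Icc a b) := (continuousOn_const.mul hη).add (continuousOn_const.mul hs)
  intro t ht
  refine HasDerivWithinAt.prodMk ?_ (HasDerivWithinAt.prodMk ?_ (HasDerivWithinAt.prodMk ?_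
    (HasDerivWithinAt.prodMk ?_ ?_)))
  · refine hasDerivWithinAt_of_eq_integral (u₀ := x₀.p) (f := fun t => (x t).v • (x t).o) hab
      (hv.smul ho) (fun t ht => ?_) t ht
    rw [← hx.eq_p t (hI ht)]
    exact sub_zero _
  · refine hasDerivWithinAt_of_eq_integral (u₀ := x₀.o) (f := fun t => (x t).ω • rot (x t).o) hab
      (hω.smul hro) (fun t ht => ?_) t ht
    rw [← hx.eq_o t (hI ht)]
    exact sub_zero _
  · refine hasDerivWithinAt_of_eq_integral (u₀ := x₀.v) (f := fun t =>
      (1 / c.m) * (-c.lam * (ψ ((x t).p + c.r • (x t).o) - (x t).η)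
      - (1 / ε) * c.k * (x t).v)) hab kv (fun t ht => ?_) t ht
    change (x t).v - ∫ s in t₀..t, (1 / c.m) * (-c.lam * ds s + dt s) = _
    rw [sub_eq_iff_eq_add, add_assoc, ← intervalIntegral.integral_add
      ((kv.mono (hsubI t ht)).intervalIntegrable)
      ((((hds _ _).const_mul _).add (hdt _ _)).const_mul _), hx.eq_v t (hI ht)]
    congr 1
    exact intervalIntegral.integral_congr fun s _ => by ring
  · refine hasDerivWithinAt_of_eq_integral (u₀ := x₀.ω) (f := fun t =>
      (1 / c.J) * (-c.κ * ((x t).ω - c.ωstar))) hab kω (fun t ht => ?_) t ht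
    change (x t).ω - ∫ s in t₀..t, (1 / c.J) * dr s = _
    rw [sub_eq_iff_eq_add, add_assoc, ← intervalIntegral.integral_add
      ((kω.mono (hsubI t ht)).intervalIntegrable) ((hdr _ _).const_mul _), hx.eq_ω t (hI ht)]
    congr 1
    exact intervalIntegral.integral_congr fun s _ => by ring
  · refine hasDerivWithinAt_of_eq_integral (u₀ := x₀.η) (f := fun t =>
      -ε * c.h * (x t).η + ε * c.h * ψ ((x t).p + c.r • (x t).o)) hab kη (fun t ht => ?_) t ht
    change (x t).η - ∫ s in t₀..t, ε * c.h * ds s = _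
    rw [sub_eq_iff_eq_add, add_assoc, ← intervalIntegral.integral_add
      ((kη.mono (hsubI t ht)).intervalIntegrable) ((hds _ _).const_mul _), hx.eq_η t (hI ht)]

/-- The converse of `IsSolution.hasDerivWithinAt_coords`. -/
lemma isSolution_of_hasDerivWithinAt (hψ : Continuous ψ)
    (hdr : ∀ a b, IntervalIntegrable dr volume a b)
    (hds : ∀ a b, IntervalIntegrable ds volume a b)
    (hdt : ∀ a b, IntervalIntegrable dt volume a b) {t₁ : ℝ} (h01 : t₀ ≤ t₁) {y : ℝ → StateSpace}
    (hy0 : y t₀ = x₀.coords) (hyc : ContinuousOn y (Set.Icc t₀ t₁))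
    (hyo : ∀ t ∈ Set.Icc t₀ t₁, ‖(y t).2.1‖ = 1)
    (hyd : ∀ t ∈ Set.Icc t₀ t₁, HasDerivWithinAt
      (fun t => y t - integratedDisturbance c ε dr ds dt t₀ t) (field c ψ ε (y t))
      (Set.Icc t₀ t₁) t) :
    IsSolution c ψ ε dr ds dt t₀ x₀ (Set.Icc t₀ t₁) (fun t => stateOf (y t)) := by
  have hp : ContinuousOn (fun t => (y t).1) (Set.Icc t₀ t₁) := hyc.fst
  have ho : ContinuousOn (fun t => (y t).2.1) (Set.Icc t₀ t₁) := hyc.snd.fst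
  have hv : ContinuousOn (fun t => (y t).2.2.1) (Set.Icc t₀ t₁) := hyc.snd.snd.fst
  have hω : ContinuousOn (fun t => (y t).2.2.2.1) (Set.Icc t₀ t₁) := hyc.snd.snd.snd.fst
  have hη : ContinuousOn (fun t => (y t).2.2.2.2) (Set.Icc t₀ t₁) := hyc.snd.snd.snd.snd
  have hs : ContinuousOn (fun t => ψ ((y t).1 + c.r • (y t).2.1)) (Set.Icc t₀ t₁) :=
    hψ.comp_continuousOn (hp.add (ho.const_smul c.r))
  have hro : ContinuousOn (fun t => rot (y t).2.1) (Set.Icc t₀ t₁) :=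
    rotL.continuous.comp_continuousOn ho
  have kv : ContinuousOn (fun t => (1 / c.m) * (-c.lam * (ψ ((y t).1 + c.r • (y t).2.1)
      - (y t).2.2.2.2) - (1 / ε) * c.k * (y t).2.2.1)) (Set.Icc t₀ t₁) :=
    continuousOn_const.mul ((continuousOn_const.mul (hs.sub hη)).sub (continuousOn_const.mul hv))
  have kω : ContinuousOn (fun t => (1 / c.J) * (-c.κ * ((y t).2.2.2.1 - c.ωstar)))
      (Set.Icc t₀ t₁) :=
    continuousOn_const.mul (continuousOn_const.mul (hω.sub continuousOn_const))
  have kη : ContinuousOn (fun t => -ε * c.h * (y t).2.2.2.2 +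
      ε * c.h * ψ ((y t).1 + c.r • (y t).2.1)) (Set.Icc t₀ t₁) :=
    (continuousOn_const.mul hη).add (continuousOn_const.mul hs)
  have h0 : y t₀ - integratedDisturbance c ε dr ds dt t₀ t₀ = x₀.coords := by
    rw [integratedDisturbance_self, sub_zero, hy0]
  have hsubI : ∀ t ∈ Set.Icc t₀ t₁, Set.uIcc t₀ t ⊆ Set.Icc t₀ t₁ := fun t ht =>
    Set.ordConnected_Icc.uIcc_subset ⟨le_rfl, h01⟩ ht
  refine ⟨Set.ordConnected_Icc, ⟨le_rfl, h01⟩, fun t ht =>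
    mem_sphere_zero_iff_norm.2 (hyo t ht), hp, ho, hv, hω,
    hη, fun t ht => ?_, fun t ht => ?_, fun t ht => ?_, fun t ht => ?_, fun t ht => ?_⟩
  · have := eq_add_integral_of_hasDerivWithinAt (fun t ht => (hyd t ht).fst) (hv.smul ho) t ht
    rw [h0] at this
    exact (sub_zero _).symm.trans this
  · have := eq_add_integral_of_hasDerivWithinAt (fun t ht => (hyd t ht).snd.fst)
      (hω.smul hro) t ht
    rw [h0] at this
    exact (sub_zero _).symm.trans this
  · have := eq_add_integral_of_hasDerivWithinAt (fun t ht => (hyd t ht).snd.snd.fst) kv t ht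
    rw [h0] at this
    have h1 := eq_add_of_sub_eq this
    rw [add_assoc] at h1
    change (y t).2.2.1 = _
    refine h1.trans (congrArg (x₀.v + ·) ?_)
    refine (intervalIntegral.integral_add ((kv.mono (hsubI t ht)).intervalIntegrable)
      ((((hds _ _).const_mul _).add (hdt _ _)).const_mul _)).symm.trans ?_
    exact intervalIntegral.integral_congr fun s _ => by simp only [stateOf]; ring
  · have := eq_add_integral_of_hasDerivWithinAt (fun t ht => (hyd t ht).snd.snd.snd.fst) kω t ht
    rw [h0] at this
    have h1 := eq_add_of_sub_eq this
    rw [add_assoc] at h1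
    change (y t).2.2.2.1 = _
    refine h1.trans (congrArg (x₀.ω + ·) ?_)
    refine (intervalIntegral.integral_add ((kω.mono (hsubI t ht)).intervalIntegrable)
      ((hdr _ _).const_mul _)).symm.trans ?_
    exact intervalIntegral.integral_congr fun s _ => by simp only [stateOf]; ring
  · have := eq_add_integral_of_hasDerivWithinAt (fun t ht => (hyd t ht).snd.snd.snd.snd) kη t ht
    rw [h0] at this
    have h1 := eq_add_of_sub_eq this
    rw [add_assoc] at h1
    change (y t).2.2.2.2 = _
    refine h1.trans (congrArg (x₀.η + ·) ?_)
    exact (intervalIntegral.integral_add ((kη.mono (hsubI t ht)).intervalIntegrable)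
      ((hds _ _).const_mul _)).symm

end System

/-! ### Existence, uniqueness, and the maximal solution -/

lemma inner_rot_self (u : Plane) : inner ℝ u (rot u) = 0 := by
  simp [rot, PiLp.inner_apply, Fin.sum_univ_two]
  ring

lemma State.coords_injective : Function.Injective State.coords := fun s s' h => by
  cases s; cases s'
  simpa [State.coords] using h

section System

variable {c : Params} {ψ : Plane → ℝ} {ε : ℝ} {dr ds dt : ℝ → ℝ} {t₀ : ℝ} {x₀ : State}

/-- A Lipschitz bounded vector field, shifted by a continuous function of time, has solutions on
every compact interval. -/
lemma exists_hasDerivWithinAt_shift {E : Type*} [NormedAddCommGroup E] [NormedSpace ℝ E]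
    [CompleteSpace E] {F : E → E} {L : NNReal} (hF : LipschitzWith L F) {B : ℝ}
    (hB : ∀ y, ‖F y‖ ≤ B) {D : ℝ → E} (hD : Continuous D) {t₁ : ℝ} (h01 : t₀ ≤ t₁) (y₀ : E) :
    ∃ α : ℝ → E, α t₀ = y₀ ∧ ∀ t ∈ Set.Icc t₀ t₁,
      HasDerivWithinAt α (F (α t + D t)) (Set.Icc t₀ t₁) t := by
  have hB0 : 0 ≤ B := (norm_nonneg _).trans (hB 0)
  have hpl : IsPicardLindelof (fun t y => F (y + D t)) (⟨t₀, le_rfl, h01⟩ : Set.Icc t₀ t₁) y₀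
      (⟨B, hB0⟩ * ⟨t₁ - t₀, sub_nonneg.2 h01⟩) 0 ⟨B, hB0⟩ L :=
    { lipschitzOnWith := fun t _ => by
        refine LipschitzWith.lipschitzOnWith (LipschitzWith.of_dist_le_mul fun y z => ?_)
        simpa using hF.dist_le_mul (y + D t) (z + D t)
      continuousOn := fun y _ => (hF.continuous.comp (continuous_const.add hD)).continuousOn
      norm_le := fun t _ y _ => hB _
      mul_max_le := by
        change B * max (t₁ - t₀) (t₀ - t₀) ≤ B * (t₁ - t₀) - 0
        rw [sub_self, max_eq_left (sub_nonneg.2 h01), sub_zero] }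
  exact hpl.exists_eq_forall_mem_Icc_hasDerivWithinAt₀

/-- Solutions exist as long as an a priori estimate keeps them in an open bounded set: they are
obtained from a truncated vector field, and the truncation does not act on them. -/
theorem exists_isSolution_Icc (hψ : ContDiff ℝ 1 ψ)
    (hdr : ∀ a b, IntervalIntegrable dr volume a b)
    (hds : ∀ a b, IntervalIntegrable ds volume a b)
    (hdt : ∀ a b, IntervalIntegrable dt volume a b) {K U : Set Plane} {R : ℝ} (hK : IsCompact K)
    (hU : IsOpen U) (hUK : U ⊆ K) (hp₀ : x₀.p ∈ K) (ho₀ : ‖x₀.o‖ = 1) {t₁ : ℝ} (h01 : t₀ ≤ t₁)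
    (hapriori : ∀ x : ℝ → State, ∀ t ∈ Set.Icc t₀ t₁,
      IsSolution c ψ ε dr ds dt t₀ x₀ (Set.Icc t₀ t) x → (∀ s ∈ Set.Icc t₀ t, (x s).p ∈ K) →
      (x t).p ∈ U ∧ |(x t).v| ≤ R ∧ |(x t).ω| ≤ R ∧ |(x t).η| ≤ R) :
    ∃ x, IsSolution c ψ ε dr ds dt t₀ x₀ (Set.Icc t₀ t₁) x ∧
      ∀ t ∈ Set.Icc t₀ t₁, (x t).p ∈ K := by
  obtain ⟨C, hC⟩ := hK.isBounded.exists_norm_le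
  have hC0 : 0 ≤ C := (norm_nonneg _).trans (hC _ hp₀)
  set M : ℝ := C + |R| + ‖x₀.coords‖ + 2 with hM
  have hR := le_abs_self R
  have hR0 := abs_nonneg R
  have hx₀n := norm_nonneg x₀.coords
  have hM0 : 0 < M := by positivity
  let φ : ContDiffBump (0 : StateSpace) := ⟨M, M + 1, hM0, by linarith⟩
  set F : StateSpace → StateSpace := fun y => φ y • field c ψ ε y with hFdef
  have hFc : ContDiff ℝ 1 F := (φ.contDiff (n := 1)).smul (contDiff_field hψ)
  have hFs : HasCompactSupport F := φ.hasCompactSupport.smul_right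
  obtain ⟨L, hL⟩ := hFc.lipschitzWith_of_hasCompactSupport hFs one_ne_zero
  obtain ⟨B, hB⟩ := hFs.exists_bound_of_continuous hFc.continuous
  set D := integratedDisturbance c ε dr ds dt t₀ with hD
  have hDc : Continuous D := continuous_integratedDisturbance hdr hds hdt
  obtain ⟨α, hα0, hα⟩ := exists_hasDerivWithinAt_shift hL hB hDc h01 x₀.coords
  have hαc : ContinuousOn α (Set.Icc t₀ t₁) := fun t ht => (hα t ht).continuousWithinAt
  set y : ℝ → StateSpace := fun t => α t + D t with hy
  have hyc : ContinuousOn y (Set.Icc t₀ t₁) := hαc.add hDc.continuousOn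
  have hy0 : y t₀ = x₀.coords := by
    simp only [hy, hα0, hD, integratedDisturbance_self, add_zero]
  have hyα : (fun t => y t - D t) = α := by funext t; simp [hy]
  -- The truncated field is tangential to the circle of orientations, too.
  have hyo : ∀ t ∈ Set.Icc t₀ t₁, ‖(y t).2.1‖ = 1 := by
    have hα2 : ∀ t, (y t).2.1 = (α t).2.1 := fun t => add_zero _
    have hd : ∀ t ∈ Set.Icc t₀ t₁, HasDerivWithinAt (fun t => ‖(α t).2.1‖ ^ 2) 0
        (Set.Icc t₀ t₁) t := fun t ht => by
      have h0 : HasDerivWithinAt (fun t => (α t).2.1) (F (α t + D t)).2.1 (Set.Icc t₀ t₁) t :=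
        (hα t ht).snd.fst
      have h1 := h0.norm_sq
      have h2 : inner ℝ (α t).2.1 (F (α t + D t)).2.1 = 0 := by
        change inner ℝ (α t).2.1 (φ (y t) • ((y t).2.2.2.1 • rot (y t).2.1)) = 0
        rw [hα2, inner_smul_right, inner_smul_right, inner_rot_self, mul_zero, mul_zero]
      rwa [h2, mul_zero] at h1
    intro t ht
    have h1 := eq_add_integral_of_hasDerivWithinAt hd continuousOn_const t ht
    simp only [intervalIntegral.integral_zero, add_zero, hα0] at h1
    have h2 : ‖x₀.coords.2.1‖ = 1 := ho₀
    rw [h2, one_pow] at h1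
    rw [hα2]
    exact (pow_eq_one_iff_of_nonneg (norm_nonneg _) two_ne_zero).1 h1
  have hsol : ∀ t ∈ Set.Icc t₀ t₁, (∀ s ∈ Set.Icc t₀ t, ‖y s‖ ≤ M) →
      IsSolution c ψ ε dr ds dt t₀ x₀ (Set.Icc t₀ t) (fun s => stateOf (y s)) := by
    intro t ht hyM
    have hsub : Set.Icc t₀ t ⊆ Set.Icc t₀ t₁ := Set.Icc_subset_Icc_right ht.2
    refine isSolution_of_hasDerivWithinAt hψ.continuous hdr hds hdt ht.1 hy0 (hyc.mono hsub)
      (fun s hs => hyo s (hsub hs)) (fun s hs => ?_)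
    rw [← hD, hyα]
    have h1 := (hα s (hsub hs)).mono hsub
    have h2 : F (α s + D s) = field c ψ ε (y s) := by
      have : φ (y s) = 1 := φ.one_of_mem_closedBall (mem_closedBall_zero_iff.2 (hyM s hs))
      change φ (y s) • field c ψ ε (y s) = _
      rw [this, one_smul]
    rwa [h2] at h1
  have hstay : ∀ t ∈ Set.Icc t₀ t₁, y t ∈ {z : StateSpace | z.1 ∈ U ∧ ‖z‖ < M} := by
    refine mem_of_forall_mem_imp (S := {z : StateSpace | z.1 ∈ K ∧ ‖z‖ ≤ M}) hyc
      ((hU.preimage continuous_fst).inter (isOpen_lt continuous_norm continuous_const))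
      ((hK.isClosed.preimage continuous_fst).inter (isClosed_le continuous_norm continuous_const))
      (fun z hz => ⟨hUK hz.1, hz.2.le⟩) ?_ ?_
    · rw [hy0]
      exact ⟨hp₀, by linarith⟩
    · intro t ht hS
      obtain ⟨hpU, hv, hω, hη⟩ := hapriori _ t ht (hsol t ht fun s hs => (hS s hs).2)
        (fun s hs => (hS s hs).1)
      have hv' : ‖(y t).2.2.1‖ ≤ R := hv
      have hω' : ‖(y t).2.2.2.1‖ ≤ R := hω
      have hη' : ‖(y t).2.2.2.2‖ ≤ R := hη
      refine ⟨hpU, ?_⟩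
      have hp : ‖(y t).1‖ ≤ C := hC _ (hUK hpU)
      have ho := hyo t ht
      simp only [Prod.norm_def, max_lt_iff]
      refine ⟨?_, ?_, ?_, ?_, ?_⟩ <;> linarith
  exact ⟨fun s => stateOf (y s), hsol t₁ ⟨h01, le_rfl⟩ fun s hs => (hstay s hs).2.le,
    fun s hs => hUK (hstay s hs).1⟩

/-- Uniqueness, by Gronwall's inequality. -/
theorem IsSolution.eq_of_mem (hψ : ContDiff ℝ 1 ψ)
    (hdr : ∀ a b, IntervalIntegrable dr volume a b)
    (hds : ∀ a b, IntervalIntegrable ds volume a b)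
    (hdt : ∀ a b, IntervalIntegrable dt volume a b) {I I' : Set ℝ} {x x' : ℝ → State}
    (hx : IsSolution c ψ ε dr ds dt t₀ x₀ I x) (hx' : IsSolution c ψ ε dr ds dt t₀ x₀ I' x')
    {t : ℝ} (ht : t ∈ I) (ht' : t ∈ I') : x t = x' t := by
  have hI : Set.uIcc t₀ t ⊆ I := hx.ordConnected.uIcc_subset hx.mem ht
  have hI' : Set.uIcc t₀ t ⊆ I' := hx'.ordConnected.uIcc_subset hx'.mem ht'
  set D := integratedDisturbance c ε dr ds dt t₀ with hD
  have hc := hx.continuousOn_coords.mono hI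
  have hc' := hx'.continuousOn_coords.mono hI'
  obtain ⟨M, hM⟩ := (isCompact_uIcc.image_of_continuousOn hc).isBounded.exists_norm_le
  obtain ⟨M', hM'⟩ := (isCompact_uIcc.image_of_continuousOn hc').isBounded.exists_norm_le
  set B : Set StateSpace := Metric.closedBall 0 (max M M') with hB
  have hmem : ∀ s ∈ Set.uIcc t₀ t, (x s).coords ∈ B := fun s hs =>
    mem_closedBall_zero_iff.2 ((hM _ ⟨s, hs, rfl⟩).trans (le_max_left _ _))
  have hmem' : ∀ s ∈ Set.uIcc t₀ t, (x' s).coords ∈ B := fun s hs =>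
    mem_closedBall_zero_iff.2 ((hM' _ ⟨s, hs, rfl⟩).trans (le_max_right _ _))
  obtain ⟨L, hL⟩ := ((contDiff_field (c := c) (ε := ε) hψ).contDiffOn
    (s := B)).exists_lipschitzOnWith one_ne_zero (convex_closedBall _ _) (isCompact_closedBall _ _)
  set V : ℝ → StateSpace → StateSpace := fun s z => field c ψ ε (z + D s) with hV
  set S : ℝ → Set StateSpace := fun s => {z | z + D s ∈ B} with hS
  have hVL : ∀ s, LipschitzOnWith L (V s) (S s) := fun s => by
    refine LipschitzOnWith.of_dist_le_mul fun z hz w hw => ?_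
    simpa using hL.dist_le_mul (z + D s) hz (w + D s) hw
  have h0 : (x t₀).coords - D t₀ = (x' t₀).coords - D t₀ := by
    rw [hx.apply_start, hx'.apply_start]
  have hS1 : ∀ s ∈ Set.uIcc t₀ t, (x s).coords - D s ∈ S s := fun s hs => by
    simpa [hS] using hmem s hs
  have hS2 : ∀ s ∈ Set.uIcc t₀ t, (x' s).coords - D s ∈ S s := fun s hs => by
    simpa [hS] using hmem' s hs
  have hd := hx.hasDerivWithinAt_coords hψ.continuous hdr hds hdt
    (a := min t₀ t) (b := max t₀ t) ⟨min_le_left _ _, le_max_left _ _⟩ hI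
  have hd' := hx'.hasDerivWithinAt_coords hψ.continuous hdr hds hdt
    (a := min t₀ t) (b := max t₀ t) ⟨min_le_left _ _, le_max_left _ _⟩ hI'
  have hVx : ∀ s, V s ((x s).coords - D s) = field c ψ ε (x s).coords := fun s => by simp [hV]
  have hVx' : ∀ s, V s ((x' s).coords - D s) = field c ψ ε (x' s).coords := fun s => by simp [hV]
  rw [← hD] at hd hd'
  have key : (x t).coords - D t = (x' t).coords - D t := by
    rcases le_total t₀ t with h | h
    · rw [Set.uIcc_of_le h] at hS1 hS2
      rw [min_eq_left h, max_eq_right h] at hd hd'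
      refine ODE_solution_unique_of_mem_Icc_right (v := V) (s := S) (fun s _ => hVL s)
        (fun s hs => (hd s hs).continuousWithinAt) (fun s hs => ?_)
        (fun s hs => hS1 s (Set.Ico_subset_Icc_self hs))
        (fun s hs => (hd' s hs).continuousWithinAt) (fun s hs => ?_)
        (fun s hs => hS2 s (Set.Ico_subset_Icc_self hs)) h0 ⟨h, le_rfl⟩
      · rw [hVx]
        exact (hd s (Set.Ico_subset_Icc_self hs)).mono_of_mem_nhdsWithin (Icc_mem_nhdsGE_of_mem hs)
      · rw [hVx']
        exact (hd' s (Set.Ico_subset_Icc_self hs)).mono_of_mem_nhdsWithin (Icc_mem_nhdsGE_of_mem hs)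
    · rw [Set.uIcc_of_ge h] at hS1 hS2
      rw [min_eq_right h, max_eq_left h] at hd hd'
      refine ODE_solution_unique_of_mem_Icc_left (v := V) (s := S) (fun s _ => hVL s)
        (fun s hs => (hd s hs).continuousWithinAt) (fun s hs => ?_)
        (fun s hs => hS1 s (Set.Ioc_subset_Icc_self hs))
        (fun s hs => (hd' s hs).continuousWithinAt) (fun s hs => ?_)
        (fun s hs => hS2 s (Set.Ioc_subset_Icc_self hs)) h0 ⟨le_rfl, h⟩
      · rw [hVx]
        exact (hd s (Set.Ioc_subset_Icc_self hs)).mono_of_mem_nhdsWithin (Icc_mem_nhdsLE_of_mem hs)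
      · rw [hVx']
        exact (hd' s (Set.Ioc_subset_Icc_self hs)).mono_of_mem_nhdsWithin (Icc_mem_nhdsLE_of_mem hs)
  exact State.coords_injective (sub_left_injective key)

/-- Solutions that agree on the intersections of their domains can be glued: the union of all
solutions is the maximal one. -/
theorem exists_isMaximalSolution
    (huniq : ∀ (I I' : Set ℝ) (x x' : ℝ → State), IsSolution c ψ ε dr ds dt t₀ x₀ I x →
      IsSolution c ψ ε dr ds dt t₀ x₀ I' x' → ∀ t ∈ I, t ∈ I' → x t = x' t)
    (hex : ∃ I x, IsSolution c ψ ε dr ds dt t₀ x₀ I x) :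
    ∃ I x, IsMaximalSolution c ψ ε dr ds dt t₀ x₀ I x := by
  classical
  have hsel : ∀ t, ∃ z : State, ∀ I' x', IsSolution c ψ ε dr ds dt t₀ x₀ I' x' → t ∈ I' →
      x' t = z := by
    intro t
    by_cases h : ∃ I' x', IsSolution c ψ ε dr ds dt t₀ x₀ I' x' ∧ t ∈ I'
    · obtain ⟨I', x', hx', ht⟩ := h
      exact ⟨x' t, fun I'' x'' hx'' ht'' => huniq _ _ _ _ hx'' hx' t ht'' ht⟩
    · exact ⟨x₀, fun I' x' hx' ht => absurd ⟨I', x', hx', ht⟩ h⟩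
  choose z hz using hsel
  set J : Set ℝ := {t | ∃ I' x', IsSolution c ψ ε dr ds dt t₀ x₀ I' x' ∧ t ∈ I'} with hJ
  have hsubJ : ∀ {I' x'}, IsSolution c ψ ε dr ds dt t₀ x₀ I' x' → I' ⊆ J :=
    fun hx' t ht => ⟨_, _, hx', ht⟩
  obtain ⟨I₁, x₁, hx₁⟩ := hex
  have hseg : ∀ t ∈ J, Set.uIcc t₀ t ⊆ J := by
    rintro t ⟨I', x', hx', ht⟩
    exact (hx'.ordConnected.uIcc_subset hx'.mem ht).trans (hsubJ hx')
  have hJo : J.OrdConnected := by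
    refine ⟨fun a ha b hb s hs => ?_⟩
    rcases le_total t₀ s with h | h
    · exact hseg b hb (Set.mem_uIcc.2 (Or.inl ⟨h, hs.2⟩))
    · exact hseg a ha (Set.mem_uIcc.2 (Or.inr ⟨hs.1, h⟩))
  -- Continuity at a point is inherited from one solution on each side of the point.
  have hcont : ∀ {X : Type} [TopologicalSpace X] (g : State → X),
      (∀ I' x', IsSolution c ψ ε dr ds dt t₀ x₀ I' x' → ContinuousOn (fun t => g (x' t)) I') →
      ContinuousOn (fun t => g (z t)) J := by
    intro X _ g hg t ht
    have hloc : ∀ {I' x'}, IsSolution c ψ ε dr ds dt t₀ x₀ I' x' → t ∈ I' →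
        ContinuousWithinAt (fun t => g (z t)) I' t := fun hx' ht' =>
      (hg _ _ hx' t ht').congr (fun s hs => by rw [hz s _ _ hx' hs]) (by rw [hz t _ _ hx' ht'])
    have hr : ContinuousWithinAt (fun t => g (z t)) (J ∩ Set.Ici t) t := by
      by_cases h : ∃ b ∈ J, t < b
      · obtain ⟨b, ⟨I', x', hx', hb⟩, htb⟩ := h
        obtain ⟨I'', x'', hx'', ht''⟩ := ht
        rcases le_total t₀ t with h0 | h0
        · have hs : Set.Icc t b ⊆ I' :=
            (Set.Icc_subset_Icc_left h0).trans (hx'.ordConnected.out hx'.mem hb)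
          exact (hloc hx' (hs ⟨le_rfl, htb.le⟩)).mono_of_mem_nhdsWithin
            (Filter.mem_of_superset (nhdsWithin_mono _ Set.inter_subset_right
              (Icc_mem_nhdsGE htb)) hs)
        · rcases h0.eq_or_lt with h0 | h0
          · have hs : Set.Icc t b ⊆ I' := hx'.ordConnected.out (h0 ▸ hx'.mem) hb
            exact (hloc hx' (hs ⟨le_rfl, htb.le⟩)).mono_of_mem_nhdsWithin
              (Filter.mem_of_superset (nhdsWithin_mono _ Set.inter_subset_right
                (Icc_mem_nhdsGE htb)) hs)
          · have hs : Set.Icc t t₀ ⊆ I'' := hx''.ordConnected.out ht'' hx''.mem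
            exact (hloc hx'' ht'').mono_of_mem_nhdsWithin
              (Filter.mem_of_superset (nhdsWithin_mono _ Set.inter_subset_right
                (Icc_mem_nhdsGE h0)) hs)
      · push Not at h
        refine continuousWithinAt_singleton.mono (t := {t}) fun s hs => ?_
        exact le_antisymm (h s hs.1) hs.2
    have hl : ContinuousWithinAt (fun t => g (z t)) (J ∩ Set.Iic t) t := by
      by_cases h : ∃ a ∈ J, a < t
      · obtain ⟨a, ⟨I', x', hx', ha⟩, hat⟩ := h
        obtain ⟨I'', x'', hx'', ht''⟩ := ht
        rcases lt_or_ge t₀ t with h0 | h0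
        · have hs : Set.Icc t₀ t ⊆ I'' := hx''.ordConnected.out hx''.mem ht''
          exact (hloc hx'' ht'').mono_of_mem_nhdsWithin
            (Filter.mem_of_superset (nhdsWithin_mono _ Set.inter_subset_right
              (Icc_mem_nhdsLE h0)) hs)
        · have hs : Set.Icc a t ⊆ I' :=
            (Set.Icc_subset_Icc_right h0).trans (hx'.ordConnected.out ha hx'.mem)
          exact (hloc hx' (hs ⟨hat.le, le_rfl⟩)).mono_of_mem_nhdsWithin
            (Filter.mem_of_superset (nhdsWithin_mono _ Set.inter_subset_right
              (Icc_mem_nhdsLE hat)) hs)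
      · push Not at h
        refine continuousWithinAt_singleton.mono (t := {t}) fun s hs => ?_
        exact le_antisymm hs.2 (h s hs.1)
    have := hl.union hr
    rwa [← Set.inter_union_distrib_left, Set.Iic_union_Ici, Set.inter_univ] at this
  -- The integral equations at `t` only involve the solution between `t₀` and `t`.
  have heq : ∀ {I' x'}, IsSolution c ψ ε dr ds dt t₀ x₀ I' x' → ∀ t ∈ I',
      ∀ s ∈ Set.uIcc t₀ t, x' s = z s := fun hx' t ht s hs =>
    hz s _ _ hx' (hx'.ordConnected.uIcc_subset hx'.mem ht hs)
  refine ⟨J, z, ⟨hJo, ⟨I₁, x₁, hx₁, hx₁.mem⟩, ?_, hcont _ fun _ _ h => h.cont_p,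
    hcont _ fun _ _ h => h.cont_o, hcont _ fun _ _ h => h.cont_v, hcont _ fun _ _ h => h.cont_ω,
    hcont _ fun _ _ h => h.cont_η, ?_, ?_, ?_, ?_, ?_⟩,
    fun I' x' hx' => ⟨hsubJ hx', fun t ht => hz t _ _ hx' ht⟩⟩
  all_goals
    rintro t ⟨I', x', hx', ht⟩
    have h1 := heq hx' t ht
    rw [← hz t _ _ hx' ht]
  · exact hx'.norm_o t ht
  · rw [hx'.eq_p t ht]
    exact congrArg _ (intervalIntegral.integral_congr fun s hs => by simp only [h1 s hs])
  · rw [hx'.eq_o t ht]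
    exact congrArg _ (intervalIntegral.integral_congr fun s hs => by simp only [h1 s hs])
  · rw [hx'.eq_v t ht]
    exact congrArg _ (intervalIntegral.integral_congr fun s hs => by simp only [h1 s hs])
  · rw [hx'.eq_ω t ht]
    exact congrArg _ (intervalIntegral.integral_congr fun s hs => by simp only [h1 s hs])
  · rw [hx'.eq_η t ht]
    exact congrArg _ (intervalIntegral.integral_congr fun s hs => by simp only [h1 s hs])

/-- The maximal solution exists for all future times as long as an a priori estimate keeps all
solutions in an open bounded set, and it has all properties that the a priori estimate yields. -/
theorem exists_isMaximalSolution_Ici (hψ : ContDiff ℝ 1 ψ)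
    (hdr : ∀ a b, IntervalIntegrable dr volume a b)
    (hds : ∀ a b, IntervalIntegrable ds volume a b)
    (hdt : ∀ a b, IntervalIntegrable dt volume a b) {K U : Set Plane} {R : ℝ} (hK : IsCompact K)
    (hU : IsOpen U) (hUK : U ⊆ K) (hp₀ : x₀.p ∈ K) (ho₀ : ‖x₀.o‖ = 1) {Q : ℝ → State → Prop}
    (hapriori : ∀ (x : ℝ → State) (t : ℝ), IsSolution c ψ ε dr ds dt t₀ x₀ (Set.Icc t₀ t) x →
      t₀ ≤ t → (∀ s ∈ Set.Icc t₀ t, (x s).p ∈ K) →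
      (x t).p ∈ U ∧ |(x t).v| ≤ R ∧ |(x t).ω| ≤ R ∧ |(x t).η| ≤ R ∧ Q t (x t)) :
    ∃ I x, IsMaximalSolution c ψ ε dr ds dt t₀ x₀ I x ∧ Set.Ici t₀ ⊆ I ∧
      ∀ t, t₀ ≤ t → Q t (x t) := by
  have hex : ∀ t₁, t₀ ≤ t₁ → ∃ x, IsSolution c ψ ε dr ds dt t₀ x₀ (Set.Icc t₀ t₁) x ∧
      ∀ t ∈ Set.Icc t₀ t₁, (x t).p ∈ K := fun t₁ h01 =>
    exists_isSolution_Icc hψ hdr hds hdt hK hU hUK hp₀ ho₀ h01 fun x t ht hx hxK =>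
      let ⟨h1, h2, h3, h4, _⟩ := hapriori x t hx ht.1 hxK
      ⟨h1, h2, h3, h4⟩
  obtain ⟨x₁, hx₁, -⟩ := hex t₀ le_rfl
  obtain ⟨I, x, hx⟩ := exists_isMaximalSolution
    (fun I I' x x' h h' t ht ht' => h.eq_of_mem hψ hdr hds hdt h' ht ht') ⟨_, x₁, hx₁⟩
  refine ⟨I, x, hx, fun t ht => ?_, fun t ht => ?_⟩
  · obtain ⟨x', hx', -⟩ := hex t ht
    exact (hx.2 _ x' hx').1 ⟨ht, le_rfl⟩
  · obtain ⟨x', hx', hK'⟩ := hex t ht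
    obtain ⟨-, -, -, -, h⟩ := hapriori x' t hx' ht hK'
    rwa [(hx.2 _ x' hx').2 ⟨ht, le_rfl⟩] at h

end System

end SourceSeeking

theorem theorem1 (c : Params) (ψ : Plane → ℝ) (hψ : ContDiff ℝ (⊤ : ℕ∞) ψ)
    (P : Set Plane) (hPopen : IsOpen P) (hPne : P.Nonempty)
    (ystar y₀ : ℝ) (hy : ystar < y₀)
    (hcompact : IsCompact (sublevel ψ c.r P y₀))
    (hgrad : ∀ p ∈ P, ystar < diskAverage ψ c.r p → diskAverage ψ c.r p ≤ y₀ →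
      gradient (diskAverage ψ c.r) p ≠ 0)
    (ρv ρω ρη : ℝ) (hρv : 0 < ρv) (hρω : 0 < ρω) (hρη : 0 < ρη) :
    ∃ β : ℝ → ℝ → ℝ, IsClassKL β ∧ (∀ s, 0 ≤ s → β s 0 = s) ∧
    ∃ γr γs γt νp νη : ℝ → ℝ,
      IsClassK γr ∧ IsClassK γs ∧ IsClassK γt ∧ IsClassK νp ∧ IsClassK νη ∧
    ∃ ε₀ δr δs δt νv : ℝ, 0 < ε₀ ∧ 0 < δr ∧ 0 < δs ∧ 0 < δt ∧ 0 < νv ∧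
    ∀ ε : ℝ, 0 < ε → ε < ε₀ → ∀ t₀ : ℝ,
    ∀ p₀ ∈ sublevel ψ c.r P y₀, ∀ o₀ ∈ Metric.sphere (0 : Plane) 1,
    ∀ v₀ : ℝ, |v₀| ≤ ρv → ∀ ω₀ : ℝ, |ω₀ - c.ωstar| ≤ ρω →
    ∀ η₀ : ℝ, Metric.infDist η₀ (signalInterval ψ c.r P y₀) ≤ ρη →
    ∀ dr ds dt : Lp ℝ ⊤ (volume : Measure ℝ), ‖dr‖ ≤ δr → ‖ds‖ ≤ δs → ‖dt‖ ≤ δt →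
    ∃ (I : Set ℝ) (x : ℝ → State),
      IsMaximalSolution c ψ ε dr ds dt t₀ ⟨p₀, o₀, v₀, ω₀, η₀⟩ I x ∧
      Set.Ici t₀ ⊆ I ∧
      ∀ t, t₀ ≤ t →
        (x t).p ∈ P ∧
        diskAverage ψ c.r (x t).p - ystar ≤
          max (β (max (diskAverage ψ c.r p₀ - ystar) 0) (ε * (t - t₀)))
            (γr ‖dr‖ + γs ‖ds‖ + γt ‖dt‖) + νp ε ∧
        |(x t).v| ≤ |v₀| * Real.exp (-((1 / ε) * (c.k / c.m) * (t - t₀))) + νv * ε ∧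
        |(x t).ω - c.ωstar| ≤
          |ω₀ - c.ωstar| * Real.exp (-((c.κ / c.J) * (t - t₀))) + (1 / c.κ) * ‖dr‖ ∧
        Metric.infDist (x t).η (signalInterval ψ c.r P y₀) ≤
          Metric.infDist η₀ (signalInterval ψ c.r P y₀) * Real.exp (-(ε * c.h * (t - t₀)))
            + ‖ds‖ + νη ε := by
  have hψ1 : ContDiff ℝ 1 ψ := hψ.of_le (by exact_mod_cast le_top)
  obtain ⟨β, hβ, hβ0, γ, νp, νη, hγ, hνp, hνη, ε₀, δ, νv, hε₀, hδ, hνv, K, U, R, hK, hU, hUK, hCK,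
    hb⟩ := exists_apriori_bounds c hψ1 hPopen hy hcompact hgrad hρv hρω hρη
  refine ⟨β, hβ, hβ0, γ, γ, γ, νp, νη, hγ, hγ, hγ, hνp, hνη, ε₀, δ, δ, δ, νv, hε₀, hδ, hδ, hδ, hνv,
    fun ε hε hεε₀ t₀ p₀ hp₀ o₀ ho₀ v₀ hv₀ ω₀ hω₀ η₀ hη₀ dr ds dt hdr hds hdt => ?_⟩
  have hx₀ : IsInitial c ψ P y₀ ρv ρω ρη ⟨p₀, o₀, v₀, ω₀, η₀⟩ := ⟨hp₀, ho₀, hv₀, hω₀, hη₀⟩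
  have hb' := hb ε hε hεε₀ t₀ _ hx₀ dr ds dt hdr hds hdt
  obtain ⟨I, x, hx, hI, h⟩ := exists_isMaximalSolution_Ici hψ1 (intervalIntegrable_Lp dr)
    (intervalIntegrable_Lp ds) (intervalIntegrable_Lp dt) hK hU hUK (hCK hx₀.p)
    (mem_sphere_zero_iff_norm.1 hx₀.o)
    (Q := fun t s => StateBounds c ψ P ystar y₀ β γ γ γ νp νη νv ε ‖dr‖ ‖ds‖ ‖dt‖ (t - t₀)
      ⟨p₀, o₀, v₀, ω₀, η₀⟩ s)
    (fun x t hx ht hxK => hb' _ x t hx ht subset_rfl hxK)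
  exact ⟨I, x, hx, hI, fun t ht => ⟨(h t ht).mem, (h t ht).signal, (h t ht).v, (h t ht).ω,
    (h t ht).η⟩⟩
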